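/- Let $\mathbb K=\mathbb R$ or $\mathbb C$; all objects below are smooth if $\mathbb K=\mathbb R$ and holomorphic if $\mathbb K=\mathbb C$. Vector fields and sections are allowed to be local, i.e. defined on open subsets. For a vector field $X$ and a multiplication $\circ$ on the tangent bundle of a manifold put $L_X(\circ)(Y,Z)=[X,Y\circ Z]-[X,Y]\circ Z-Y\circ[X,Z]$. A triple $(N,\circ,e)$ is an $F$-manifold if $N$ is a manifold, $\circ$ is a fiber preserving, bilinear, commutative, associative multiplication on $TN$ with unit field $e$, and $L_{X\circ Y}(\circ)=X\circ L_Y(\circ)+Y\circ L_X(\circ)$ for all vector fields $X,Y$. Let $M$ be a finite-dimensional $\mathbb K$-manifold and $\pi:V\to M$ a $\mathbb K$-vector bundle of finite rank with a connection $D$. For $v\in V$, $p=\pi(v)$, let $T_vV=T_pM\oplus V_p$ be the decomposition into horizontal and vertical subspaces determined by $D$, and denote by $\tilde X\in T_vV$ the horizontal lift of $X\in T_pM$. Let $\circ_M$ be a fiber preserving, bilinear, commutative, associative multiplication on $TM$ with unit field $e_M$, let $\circ_V$ be a fiber preserving, bilinear, commutative, associative multiplication on $V$ with unit section $e_V$,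 and let $\alpha:V\to TM$ be a vector bundle morphism such that $\alpha(v_1\circ_V v_2)=\alpha(v_1)\circ_M\alpha(v_2)$ for all $v_1,v_2\in V_p$, $p\in M$, and $\alpha(e_V)=e_M$. Define a multiplication $\circ$ on the tangent bundle of the manifold $V$ by $$\tilde X\circ\tilde Y=(X\circ_M Y)^{\sim},\qquad v_1\circ v_2=v_1\circ_V v_2,\qquad v_1\circ\tilde X=\tilde X\circ v_1=(\alpha(v_1)\circ_M X)^{\sim}$$ for $X,Y\in T_pM$ and vertical vectors $v_1,v_2\in V_p$, and view $e_V$ as a vertical vector field on $V$. Then $(V,\circ,e_V)$ is an $F$-manifold if and only if the following four conditions hold: 1. $(M,\circ_M,e_M)$ is an $F$-manifold; 2. the connection $D$ is flat; 3. $L_{\alpha(s)}(\circ_M)=0$ for every $D$-parallel local section $s$ of $V$; 4. for all $D$-parallel local sections $s_1,s_2$ of $V$ over the same open set, the section $s_1\circ_V s_2$ is $D$-parallel and $[\alpha(s_1),\alpha(s_2)]=0$. -/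

import Mathlib

open Bundle VectorField
open scoped Manifold ContDiff Topology

noncomputable section

namespace TotalSpaceFManifold

section Multiplications

variable {𝕜 : Type*} [NontriviallyNormedField 𝕜]
  {E : Type*} [NormedAddCommGroup E] [NormedSpace 𝕜 E]
  {H : Type*} [TopologicalSpace H] (I : ModelWithCorners 𝕜 E H)
  {M : Type*} [TopologicalSpace M] [ChartedSpace H M]
  (F : Type*) [NormedAddCommGroup F] [NormedSpace 𝕜 F]
  {V : M → Type*} [TopologicalSpace (TotalSpace F V)]
  [∀ x, AddCommGroup (V x)] [∀ x, Module 𝕜 (V x)]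
  [∀ x, TopologicalSpace (V x)] [FiberBundle F V]

/-- `s` is a local `𝕜`-section of the bundle `V` over the set `U`: it is of class `C^∞` over `𝕜`
on `U`, that is smooth for `𝕜 = ℝ` and holomorphic for `𝕜 = ℂ`. A local section is represented
by a function on all of `M`; its values outside `U` play no role. -/
def IsSectionOn (U : Set M) (s : ∀ x, V x) : Prop :=
  ContMDiffOn I (I.prod 𝓘(𝕜, F)) ∞ (fun x => TotalSpace.mk' F x (s x)) U

/-- A (fiber preserving) commutative, associative multiplication `mul` on the fibers of a vector
bundle `V`, with unit section `e`. Multiplication and unit are smooth (`𝕜 = ℝ`) or holomorphic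
(`𝕜 = ℂ`). -/
structure IsMultiplication (mul : ∀ x, V x →ₗ[𝕜] V x →ₗ[𝕜] V x) (e : ∀ x, V x) : Prop where
  contMDiff_mul : ∀ U : Set M, IsOpen U → ∀ s t : ∀ x, V x,
    IsSectionOn I F U s → IsSectionOn I F U t → IsSectionOn I F U (fun x => mul x (s x) (t x))
  contMDiff_unit : IsSectionOn I F Set.univ e
  comm : ∀ x (a b : V x), mul x a b = mul x b a
  assoc : ∀ x (a b c : V x), mul x (mul x a b) c = mul x a (mul x b c)
  unit_mul : ∀ x (a : V x), mul x (e x) a = a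

/-- The Lie derivative of a multiplication on the tangent bundle:
`L_X(∘)(Y, Z) = [X, Y ∘ Z] - [X, Y] ∘ Z - Y ∘ [X, Z]`. -/
def lieDerivMul
    (mul : ∀ x : M, TangentSpace I x →ₗ[𝕜] TangentSpace I x →ₗ[𝕜] TangentSpace I x)
    (X Y Z : ∀ x : M, TangentSpace I x) (x : M) : TangentSpace I x :=
  mlieBracket I X (fun y => mul y (Y y) (Z y)) x
    - mul x (mlieBracket I X Y x) (Z x) - mul x (Y x) (mlieBracket I X Z x)

/-- `(M, ∘, e)` is an F-manifold: `∘` is a commutative, associative multiplication on `TM` with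
unit field `e`, and `L_{X ∘ Y}(∘) = X ∘ L_Y(∘) + Y ∘ L_X(∘)` for all (local) vector fields `X`, `Y`,
both sides being evaluated on arbitrary (local) vector fields `Z`, `W`. -/
structure IsFManifold [IsManifold I 1 M]
    (mul : ∀ x : M, TangentSpace I x →ₗ[𝕜] TangentSpace I x →ₗ[𝕜] TangentSpace I x)
    (e : ∀ x : M, TangentSpace I x) : Prop where
  isMultiplication : IsMultiplication I E mul e
  lieDeriv_mul : ∀ U : Set M, IsOpen U → ∀ X Y Z W : ∀ x : M, TangentSpace I x,
    IsSectionOn I E U X → IsSectionOn I E U Y → IsSectionOn I E U Z → IsSectionOn I E U W →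
    ∀ x ∈ U, lieDerivMul I mul (fun y => mul y (X y) (Y y)) Z W x
      = mul x (X x) (lieDerivMul I mul Y Z W x) + mul x (Y x) (lieDerivMul I mul X Z W x)

end Multiplications

section Connections

variable {𝕜 : Type*} [NontriviallyNormedField 𝕜]
  {E : Type*} [NormedAddCommGroup E] [NormedSpace 𝕜 E]
  {H : Type*} [TopologicalSpace H] {I : ModelWithCorners 𝕜 E H}
  {M : Type*} [TopologicalSpace M] [ChartedSpace H M]
  {F : Type*} [NormedAddCommGroup F] [NormedSpace 𝕜 F]
  {V : M → Type*} [TopologicalSpace (TotalSpace F V)]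
  [∀ x, AddCommGroup (V x)] [∀ x, Module 𝕜 (V x)]
  [∀ x, TopologicalSpace (V x)] [∀ x, IsTopologicalAddGroup (V x)]
  [∀ x, ContinuousSMul 𝕜 (V x)] [FiberBundle F V]

/-- The connection `D` is smooth (`𝕜 = ℝ`) or holomorphic (`𝕜 = ℂ`): over every open set it maps
local sections of `V` to local sections of `Hom(TM, V)`. -/
def IsSmoothConnection [IsManifold I 1 M] [VectorBundle 𝕜 F V]
    (D : CovariantDerivative I F V) : Prop :=
  ∀ U : Set M, IsOpen U → ContMDiffCovariantDerivativeOn F ∞ D U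

/-- The curvature `R^D(X, Y) s = D_X D_Y s - D_Y D_X s - D_[X, Y] s`. Recall that `D s x (X x)` is
`(D_X s)(x)`. -/
def curvature (D : CovariantDerivative I F V) (X Y : ∀ x : M, TangentSpace I x) (s : ∀ x, V x)
    (x : M) : V x :=
  D (fun y => D s y (Y y)) x (X x) - D (fun y => D s y (X y)) x (Y x)
    - D s x (mlieBracket I X Y x)

/-- The connection `D` is flat: its curvature vanishes. -/
def IsFlat [IsManifold I 1 M] (D : CovariantDerivative I F V) : Prop :=
  ∀ U : Set M, IsOpen U → ∀ X Y : ∀ x : M, TangentSpace I x, ∀ s : ∀ x, V x,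
    IsSectionOn I E U X → IsSectionOn I E U Y → IsSectionOn I F U s →
    ∀ x ∈ U, curvature D X Y s x = 0

/-- `s` is a `D`-parallel local section of `V` over `U`. -/
def IsParallelOn (D : CovariantDerivative I F V) (U : Set M) (s : ∀ x, V x) : Prop :=
  IsSectionOn I F U s ∧ ∀ x ∈ U, D s x = 0

end Connections

section TotalSpaceGeometry

variable {𝕜 : Type*} [NontriviallyNormedField 𝕜]
  {E : Type*} [NormedAddCommGroup E] [NormedSpace 𝕜 E]
  {H : Type*} [TopologicalSpace H] (I : ModelWithCorners 𝕜 E H)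
  {M : Type*} [TopologicalSpace M] [ChartedSpace H M]
  {F : Type*} [NormedAddCommGroup F] [NormedSpace 𝕜 F]
  {V : M → Type*} [TopologicalSpace (TotalSpace F V)]
  [∀ x, AddCommGroup (V x)] [∀ x, Module 𝕜 (V x)]
  [∀ x, TopologicalSpace (V x)] [∀ x, IsTopologicalAddGroup (V x)]
  [∀ x, ContinuousSMul 𝕜 (V x)] [FiberBundle F V] [VectorBundle 𝕜 F V]

/-- The differential `T_v V → T_p M` of the bundle projection `π : V → M`, at `v ∈ V_p`. -/
def dproj (v : TotalSpace F V) : TangentSpace (I.prod 𝓘(𝕜, F)) v →L[𝕜] TangentSpace I v.proj :=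
  mfderiv (I.prod 𝓘(𝕜, F)) I (fun w : TotalSpace F V => w.proj) v

/-- The vertical lift `V_p → T_v V`, at `v ∈ V_p`: the differential at `0` of the map
`w ↦ v + w` from `V_p` to the manifold `V`, where `V_p` is identified with the model fiber by the
linear trivialization. -/
def verticalLift (v : TotalSpace F V) :
    V v.proj →L[𝕜] TangentSpace (I.prod 𝓘(𝕜, F)) v :=
  (mfderiv 𝓘(𝕜, F) (I.prod 𝓘(𝕜, F))
      (fun f : F => (⟨v.proj, v.2 + (trivializationAt F V v.proj).symmL 𝕜 v.proj f⟩ :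
        TotalSpace F V)) 0 : F →L[𝕜] TangentSpace (I.prod 𝓘(𝕜, F)) v) ∘L
    (trivializationAt F V v.proj).continuousLinearMapAt 𝕜 v.proj

/-- The differential `T_p M → T_v V` at `p` of a local section `s` of `V` with `s(p) = v` (the one
that is constant in the trivialization around `p`). -/
def dsection (v : TotalSpace F V) : TangentSpace I v.proj →L[𝕜] TangentSpace (I.prod 𝓘(𝕜, F)) v :=
  mfderiv I (I.prod 𝓘(𝕜, F)) (fun x => TotalSpace.mk' F x (FiberBundle.extend F v.2 x)) v.proj

variable {I}

/-- The horizontal lift `T_p M → T_v V` determined by `D`, at `v ∈ V_p`: for a local section `s`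
with `s(p) = v`, the horizontal lift of `X` is `d_p s (X)` minus the vertical lift of `(D_X s)(p)`.
-/
def horizontalLift (D : CovariantDerivative I F V) (v : TotalSpace F V) :
    TangentSpace I v.proj →L[𝕜] TangentSpace (I.prod 𝓘(𝕜, F)) v :=
  dsection I v - verticalLift I v ∘L D (FiberBundle.extend F v.2) v.proj

/-- The fiber coordinate of a tangent vector in the trivialization around its base point. -/
def dfiber (v : TotalSpace F V) : TangentSpace (I.prod 𝓘(𝕜, F)) v →L[𝕜] F :=
  (mfderiv (I.prod 𝓘(𝕜, F)) 𝓘(𝕜, F)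
    (fun w : TotalSpace F V => (trivializationAt F V v.proj w).2) v :
      TangentSpace (I.prod 𝓘(𝕜, F)) v →L[𝕜] F)

/-- The vertical component `T_v V → V_p` in the decomposition `T_v V = T_p M ⊕ V_p` into
horizontal and vertical subspaces determined by `D`. -/
def verticalPart (D : CovariantDerivative I F V) (v : TotalSpace F V) :
    TangentSpace (I.prod 𝓘(𝕜, F)) v →L[𝕜] V v.proj :=
  (trivializationAt F V v.proj).symmL 𝕜 v.proj ∘L dfiber v ∘L
    (ContinuousLinearMap.id 𝕜 _ - horizontalLift D v ∘L dproj I v)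

/-- The multiplication on the tangent bundle of the manifold `V`, defined for `X, Y ∈ T_p M` and
`a, b ∈ V_p`, on horizontal lifts and vertical vectors at `v ∈ V_p`, by
`X~ ∘ Y~ = (X ∘_M Y)~`, `a ∘ b = a ∘_V b`, `a ∘ X~ = X~ ∘ a = (α(a) ∘_M X)~`. -/
def totalMul (D : CovariantDerivative I F V)
    (mulM : ∀ x : M, TangentSpace I x →ₗ[𝕜] TangentSpace I x →ₗ[𝕜] TangentSpace I x)
    (mulV : ∀ x, V x →ₗ[𝕜] V x →ₗ[𝕜] V x) (α : ∀ x, V x →ₗ[𝕜] TangentSpace I x)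
    (v : TotalSpace F V) :
    TangentSpace (I.prod 𝓘(𝕜, F)) v →ₗ[𝕜] TangentSpace (I.prod 𝓘(𝕜, F)) v →ₗ[𝕜]
      TangentSpace (I.prod 𝓘(𝕜, F)) v :=
  LinearMap.mk₂ 𝕜
    (fun ξ η =>
      horizontalLift D v
        (mulM v.proj (dproj I v ξ) (dproj I v η)
          + mulM v.proj (α v.proj (verticalPart D v ξ)) (dproj I v η)
          + mulM v.proj (α v.proj (verticalPart D v η)) (dproj I v ξ))
      + verticalLift I v (mulV v.proj (verticalPart D v ξ) (verticalPart D v η)))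
    (fun ξ₁ ξ₂ η => by simp only [map_add, LinearMap.add_apply]; abel)
    (fun c ξ η => by simp only [map_smul, LinearMap.smul_apply, smul_add, map_add])
    (fun ξ η₁ η₂ => by simp only [map_add, LinearMap.add_apply]; abel)
    (fun c ξ η => by simp only [map_smul, LinearMap.smul_apply, smul_add, map_add])

variable (I) in
/-- A section `s` of `V`, viewed as a vertical vector field on the manifold `V`. -/
def verticalField (s : ∀ x, V x) (v : TotalSpace F V) : TangentSpace (I.prod 𝓘(𝕜, F)) v :=
  verticalLift I v (s v.proj)

end TotalSpaceGeometry

/- Checks of the definitions above: `T_v V` is the direct sum of the horizontal and vertical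
subspaces, horizontal lifts do not depend on the section used to define them, and the multiplication
on `TV` is given by the expected formulas. -/

section Decomposition

set_option linter.unusedSectionVars false

variable {𝕜 : Type*} [NontriviallyNormedField 𝕜]
  {E : Type*} [NormedAddCommGroup E] [NormedSpace 𝕜 E]
  {H : Type*} [TopologicalSpace H] {I : ModelWithCorners 𝕜 E H}
  {M : Type*} [TopologicalSpace M] [ChartedSpace H M]
  {F : Type*} [NormedAddCommGroup F] [NormedSpace 𝕜 F]
  {V : M → Type*} [TopologicalSpace (TotalSpace F V)]
  [∀ x, AddCommGroup (V x)] [∀ x, Module 𝕜 (V x)]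
  [∀ x, TopologicalSpace (V x)] [∀ x, IsTopologicalAddGroup (V x)]
  [∀ x, ContinuousSMul 𝕜 (V x)] [FiberBundle F V] [VectorBundle 𝕜 F V]

theorem fiber_coord (v : TotalSpace F V) (f : F) :
    (trivializationAt F V v.proj (⟨v.proj, v.2 + (trivializationAt F V v.proj).symmL 𝕜 v.proj f⟩ :
        TotalSpace F V)).2 = (trivializationAt F V v.proj v).2 + f := by
  have hb := FiberBundle.mem_baseSet_trivializationAt' (F := F) (E := V) v.proj
  have := (trivializationAt F V v.proj).linear 𝕜 hb
  rw [this.map_add]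
  congr 1
  have h := (trivializationAt F V v.proj).continuousLinearMapAt_symmL (R := 𝕜) hb f
  rwa [Bundle.Trivialization.continuousLinearMapAt_apply,
    Bundle.Trivialization.coe_linearMapAt_of_mem _ hb] at h

theorem mdifferentiableAt_fiber (v : TotalSpace F V) :
    MDifferentiableAt 𝓘(𝕜, F) (I.prod 𝓘(𝕜, F))
      (fun f : F => (⟨v.proj, v.2 + (trivializationAt F V v.proj).symmL 𝕜 v.proj f⟩ :
        TotalSpace F V)) 0 := by
  rw [mdifferentiableAt_totalSpace]
  refine ⟨mdifferentiableAt_const, ?_⟩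
  simp only [fiber_coord]
  exact (differentiableAt_id.const_add _).mdifferentiableAt

theorem mdifferentiableAt_fiberCoord (v : TotalSpace F V) :
    MDifferentiableAt (I.prod 𝓘(𝕜, F)) 𝓘(𝕜, F)
      (fun w : TotalSpace F V => (trivializationAt F V v.proj w).2) v :=
  ((mdifferentiableAt_totalSpace I (f := fun w : TotalSpace F V => w) (x₀ := v)).1
    mdifferentiableAt_id).2


theorem hasMFDerivAt_of_eq {E' : Type*} [NormedAddCommGroup E'] [NormedSpace 𝕜 E']
    {H' : Type*} [TopologicalSpace H'] {I' : ModelWithCorners 𝕜 E' H'}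
    {M' : Type*} [TopologicalSpace M'] [ChartedSpace H' M'] {g : M → M'} {x y : M} (h : x = y)
    {L : E →L[𝕜] E'} (hg : HasMFDerivAt I I' g y L) : HasMFDerivAt I I' g x L := by
  subst h; exact hg

theorem fiber_zero (v : TotalSpace F V) :
   (⟨v.proj, v.2 + (trivializationAt F V v.proj).symmL 𝕜 v.proj 0⟩ : TotalSpace F V) = v := by
  simp

theorem dproj_verticalLift (v : TotalSpace F V) (w : V v.proj) :
    dproj I v (verticalLift I v w) = 0 := by
  have h1 : HasMFDerivAt (I.prod 𝓘(𝕜, F)) I (fun w : TotalSpace F V => w.proj)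
      (⟨v.proj, v.2 + (trivializationAt F V v.proj).symmL 𝕜 v.proj 0⟩ : TotalSpace F V)
      (dproj I v : E × F →L[𝕜] E) :=
    hasMFDerivAt_of_eq (fiber_zero v) (mdifferentiableAt_proj V).hasMFDerivAt
  have h := HasMFDerivAt.comp (0 : F) h1 (mdifferentiableAt_fiber (I := I) v).hasMFDerivAt
  have h0 := hasMFDerivAt_unique h (hasMFDerivAt_const v.proj (0 : F))
  exact congrArg (fun L : F →L[𝕜] E =>
    L ((trivializationAt F V v.proj).continuousLinearMapAt 𝕜 v.proj w)) h0

theorem dfiber_verticalLift (v : TotalSpace F V) (w : V v.proj) :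
    dfiber v (verticalLift I v w) =
      (trivializationAt F V v.proj).continuousLinearMapAt 𝕜 v.proj w := by
  have h1 : HasMFDerivAt (I.prod 𝓘(𝕜, F)) 𝓘(𝕜, F)
      (fun w : TotalSpace F V => (trivializationAt F V v.proj w).2)
      (⟨v.proj, v.2 + (trivializationAt F V v.proj).symmL 𝕜 v.proj 0⟩ : TotalSpace F V)
      (dfiber (I := I) v : E × F →L[𝕜] F) :=
    hasMFDerivAt_of_eq (fiber_zero v) (mdifferentiableAt_fiberCoord v).hasMFDerivAt
  have h := HasMFDerivAt.comp (0 : F) h1 (mdifferentiableAt_fiber (I := I) v).hasMFDerivAt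
  have h2 : HasMFDerivAt 𝓘(𝕜, F) 𝓘(𝕜, F) (fun f : F => (trivializationAt F V v.proj v).2 + f) 0
      (ContinuousLinearMap.id 𝕜 F) :=
    ((hasFDerivAt_id (𝕜 := 𝕜) (0 : F)).const_add _).hasMFDerivAt
  have h0 := hasMFDerivAt_unique h (h2.congr_of_eventuallyEq
    (Filter.Eventually.of_forall fun f => fiber_coord v f))
  exact congrArg (fun L : F →L[𝕜] F =>
    L ((trivializationAt F V v.proj).continuousLinearMapAt 𝕜 v.proj w)) h0

theorem extend_eq (v : TotalSpace F V) :
    TotalSpace.mk' F v.proj (FiberBundle.extend F v.2 v.proj) = v := by simp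

variable [ContMDiffVectorBundle 1 F V I]

theorem dproj_dsection (v : TotalSpace F V) (X : TangentSpace I v.proj) :
    dproj I v (dsection I v X) = X := by
  have h1 : HasMFDerivAt (I.prod 𝓘(𝕜, F)) I (fun w : TotalSpace F V => w.proj)
      (TotalSpace.mk' F v.proj (FiberBundle.extend F v.2 v.proj))
      (dproj I v : E × F →L[𝕜] E) :=
    hasMFDerivAt_of_eq (extend_eq v) (mdifferentiableAt_proj V).hasMFDerivAt
  have h := HasMFDerivAt.comp v.proj h1 (FiberBundle.mdifferentiableAt_extend I F v.2).hasMFDerivAt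
  have h0 := hasMFDerivAt_unique h (hasMFDerivAt_id v.proj)
  exact congrArg (fun L : E →L[𝕜] E => L X) h0

theorem dfiber_dsection (v : TotalSpace F V) (X : TangentSpace I v.proj) :
    dfiber v (dsection I v X) = 0 := by
  have h1 : HasMFDerivAt (I.prod 𝓘(𝕜, F)) 𝓘(𝕜, F)
      (fun w : TotalSpace F V => (trivializationAt F V v.proj w).2)
      (TotalSpace.mk' F v.proj (FiberBundle.extend F v.2 v.proj))
      (dfiber (I := I) v : E × F →L[𝕜] F) :=
    hasMFDerivAt_of_eq (extend_eq v) (mdifferentiableAt_fiberCoord v).hasMFDerivAt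
  have h := HasMFDerivAt.comp v.proj h1 (FiberBundle.mdifferentiableAt_extend I F v.2).hasMFDerivAt
  have h2 := (hasMFDerivAt_const (I := I) (I' := 𝓘(𝕜, F)) (trivializationAt F V v.proj v).2
    v.proj).congr_of_eventuallyEq (f₁ := (fun w : TotalSpace F V =>
      (trivializationAt F V v.proj w).2) ∘
        fun x => TotalSpace.mk' F x (FiberBundle.extend F v.2 x)) (by
    filter_upwards [(trivializationAt F V v.proj).open_baseSet.mem_nhds
      (FiberBundle.mem_baseSet_trivializationAt' v.proj)] with x hx
    simp [FiberBundle.extend, hx])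
  exact congrArg (fun L : E →L[𝕜] F => L X) (hasMFDerivAt_unique h h2)

variable (D : CovariantDerivative I F V)

theorem dproj_horizontalLift (v : TotalSpace F V) (X : TangentSpace I v.proj) :
    dproj I v (horizontalLift D v X) = X := by
  have : horizontalLift D v X = dsection I v X - verticalLift I v (D (FiberBundle.extend F v.2) v.proj X) := rfl
  rw [this, map_sub, dproj_dsection, dproj_verticalLift, sub_zero]

theorem verticalPart_horizontalLift (v : TotalSpace F V) (X : TangentSpace I v.proj) :
    verticalPart D v (horizontalLift D v X) = 0 := by
  simp [verticalPart, dproj_horizontalLift]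

theorem verticalPart_verticalLift (v : TotalSpace F V) (w : V v.proj) :
    verticalPart D v (verticalLift I v w) = w := by
  simp only [verticalPart, ContinuousLinearMap.comp_apply, sub_apply,
    ContinuousLinearMap.id_apply, dproj_verticalLift, map_zero, sub_zero, dfiber_verticalLift]
  exact (trivializationAt F V v.proj).symmL_continuousLinearMapAt (R := 𝕜)
    (FiberBundle.mem_baseSet_trivializationAt' v.proj) w

variable (mulM : ∀ x : M, TangentSpace I x →ₗ[𝕜] TangentSpace I x →ₗ[𝕜] TangentSpace I x)
    (mulV : ∀ x, V x →ₗ[𝕜] V x →ₗ[𝕜] V x) (α : ∀ x, V x →ₗ[𝕜] TangentSpace I x)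

theorem totalMul_horizontal_horizontal (v : TotalSpace F V) (X Y : TangentSpace I v.proj) :
    totalMul D mulM mulV α v (horizontalLift D v X) (horizontalLift D v Y)
      = horizontalLift D v (mulM v.proj X Y) := by
  simp [totalMul, dproj_horizontalLift, verticalPart_horizontalLift]

theorem totalMul_vertical_vertical (v : TotalSpace F V) (a b : V v.proj) :
    totalMul D mulM mulV α v (verticalLift I v a) (verticalLift I v b)
      = verticalLift I v (mulV v.proj a b) := by
  simp [totalMul, dproj_verticalLift, verticalPart_verticalLift]

theorem totalMul_vertical_horizontal (v : TotalSpace F V) (a : V v.proj)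
    (X : TangentSpace I v.proj) :
    totalMul D mulM mulV α v (verticalLift I v a) (horizontalLift D v X)
      = horizontalLift D v (mulM v.proj (α v.proj a) X) := by
  simp [totalMul, dproj_verticalLift, verticalPart_verticalLift, dproj_horizontalLift,
    verticalPart_horizontalLift]

theorem totalMul_horizontal_vertical (v : TotalSpace F V) (a : V v.proj)
    (X : TangentSpace I v.proj) :
    totalMul D mulM mulV α v (horizontalLift D v X) (verticalLift I v a)
      = horizontalLift D v (mulM v.proj (α v.proj a) X) := by
  simp [totalMul, dproj_verticalLift, verticalPart_verticalLift, dproj_horizontalLift,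
    verticalPart_horizontalLift]


theorem ext_tangent [IsManifold I 1 M] (v : TotalSpace F V) (ξ : TangentSpace (I.prod 𝓘(𝕜, F)) v)
    (h1 : dproj I v ξ = 0) (h2 : dfiber v ξ = 0) : ξ = 0 := by
  have hb := FiberBundle.mem_baseSet_trivializationAt' (F := F) (E := V) v.proj
  have he := (trivializationAt F V v.proj).mdifferentiable (I := I)
  have hs : v ∈ (trivializationAt F V v.proj).toOpenPartialHomeomorph.source := by
    simp
  have hsymm := (he.mdifferentiableAt_symm
    ((trivializationAt F V v.proj).toOpenPartialHomeomorph.map_source hs)).hasMFDerivAt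
  have hprod : HasMFDerivAt (I.prod 𝓘(𝕜, F)) (I.prod 𝓘(𝕜, F))
      (fun w : TotalSpace F V => (w.proj, (trivializationAt F V v.proj w).2)) v
      ((dproj I v : E × F →L[𝕜] E).prod (dfiber (I := I) v : E × F →L[𝕜] F)) :=
    (mdifferentiableAt_proj V).hasMFDerivAt.prodMk (mdifferentiableAt_fiberCoord v).hasMFDerivAt
  have hnear : ∀ᶠ w in 𝓝 v, w ∈ (trivializationAt F V v.proj).source :=
    (trivializationAt F V v.proj).open_source.mem_nhds hs
  have hprod' := hprod.congr_of_eventuallyEq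
    (f₁ := (trivializationAt F V v.proj).toOpenPartialHomeomorph) (by
      filter_upwards [hnear] with w hw
      exact Prod.ext ((trivializationAt F V v.proj).coe_fst hw) rfl)
  have hc := hsymm.comp v hprod'
  have hid := hc.congr_of_eventuallyEq (f₁ := id) (by
      filter_upwards [hnear] with w hw
      exact ((trivializationAt F V v.proj).toOpenPartialHomeomorph.left_inv hw).symm)
  have hu := hasMFDerivAt_unique hid (hasMFDerivAt_id v)
  have := congrArg (fun L : E × F →L[𝕜] E × F => L ξ) hu
  refine this.symm.trans ?_
  have hz : ((dproj I v : E × F →L[𝕜] E).prod (dfiber (I := I) v : E × F →L[𝕜] F)) ξ = 0 :=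
    Prod.ext h1 h2
  exact (congrArg (mfderiv (I.prod 𝓘(𝕜, F)) (I.prod 𝓘(𝕜, F))
    (trivializationAt F V v.proj).toOpenPartialHomeomorph.symm
    ((trivializationAt F V v.proj).toOpenPartialHomeomorph v) : E × F →L[𝕜] E × F) hz).trans
    (map_zero (mfderiv (I.prod 𝓘(𝕜, F)) (I.prod 𝓘(𝕜, F))
    (trivializationAt F V v.proj).toOpenPartialHomeomorph.symm
    ((trivializationAt F V v.proj).toOpenPartialHomeomorph v) : E × F →L[𝕜] E × F))

theorem horizontal_add_vertical [IsManifold I 1 M] (v : TotalSpace F V)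
    (ξ : TangentSpace (I.prod 𝓘(𝕜, F)) v) :
    horizontalLift D v (dproj I v ξ) + verticalLift I v (verticalPart D v ξ) = ξ := by
  rw [← sub_eq_zero]
  apply ext_tangent
  · simp [dproj_horizontalLift, dproj_verticalLift]
  · simp only [map_sub, map_add, dfiber_verticalLift, verticalPart, ContinuousLinearMap.comp_apply,
      sub_apply, ContinuousLinearMap.id_apply]
    have hs := (trivializationAt F V v.proj).continuousLinearMapAt_symmL (R := 𝕜)
      (FiberBundle.mem_baseSet_trivializationAt' v.proj)
    rw [hs, hs]
    abel

theorem tensorialAt_aux (p : M) (X : TangentSpace I p) :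
    TensorialAt I F (fun s : ∀ x, V x =>
      mvfderiv I (fun x => (trivializationAt F V p (TotalSpace.mk' F x (s x))).2) p X
        - (trivializationAt F V p).continuousLinearMapAt 𝕜 p (D s p X)) p where
  smul {f σ} hf hσ := by
    have hσ' := (mdifferentiableAt_section I σ).1 hσ
    have hnear : (fun x => (trivializationAt F V p (TotalSpace.mk' F x ((f • σ) x))).2) =ᶠ[𝓝 p]
        fun x => f x • (trivializationAt F V p (TotalSpace.mk' F x (σ x))).2 := by
      filter_upwards [(trivializationAt F V p).open_baseSet.mem_nhds
        (FiberBundle.mem_baseSet_trivializationAt' p)] with x hx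
      exact ((trivializationAt F V p).linear 𝕜 hx).map_smul (f x) (σ x)
    have h1 : mvfderiv I (fun x => (trivializationAt F V p
        (TotalSpace.mk' F x ((f • σ) x))).2) p X = mvfderiv I (fun x => f x •
          (trivializationAt F V p (TotalSpace.mk' F x (σ x))).2) p X :=
      congrArg (fun L : E →L[𝕜] F => L X) hnear.mfderiv_eq
    rw [h1, mvfderiv_fun_smul hf hσ', D.isCovariantDerivativeOn.leibniz hσ hf]
    have h2 : (trivializationAt F V p).continuousLinearMapAt 𝕜 p (σ p)
        = (trivializationAt F V p (TotalSpace.mk' F p (σ p))).2 :=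
      congrFun ((trivializationAt F V p).coe_linearMapAt_of_mem (R := 𝕜)
        (FiberBundle.mem_baseSet_trivializationAt' (F := F) (E := V) p)) (σ p)
    rw [← h2]
    simp only [add_apply, smul_apply, ContinuousLinearMap.smulRight_apply, map_add, map_smul,
      smul_sub]
    abel
  add {σ τ} hσ hτ := by
    have hσ' := (mdifferentiableAt_section I σ).1 hσ
    have hτ' := (mdifferentiableAt_section I τ).1 hτ
    have hnear : (fun x => (trivializationAt F V p (TotalSpace.mk' F x ((σ + τ) x))).2) =ᶠ[𝓝 p]
        fun x => (trivializationAt F V p (TotalSpace.mk' F x (σ x))).2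
          + (trivializationAt F V p (TotalSpace.mk' F x (τ x))).2 := by
      filter_upwards [(trivializationAt F V p).open_baseSet.mem_nhds
        (FiberBundle.mem_baseSet_trivializationAt' p)] with x hx
      exact ((trivializationAt F V p).linear 𝕜 hx).map_add (σ x) (τ x)
    have h1 : mvfderiv I (fun x => (trivializationAt F V p
        (TotalSpace.mk' F x ((σ + τ) x))).2) p X = mvfderiv I (fun x =>
          (trivializationAt F V p (TotalSpace.mk' F x (σ x))).2
          + (trivializationAt F V p (TotalSpace.mk' F x (τ x))).2) p X :=
      congrArg (fun L : E →L[𝕜] F => L X) hnear.mfderiv_eq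
    rw [h1, mvfderiv_fun_add hσ' hτ', D.isCovariantDerivativeOn.add hσ hτ]
    simp only [add_apply, map_add]
    abel

/-- For every section `s` that is differentiable at `p`, the differential `d_p s (X)` is the sum of
the horizontal lift of `X` and of the vertical lift of `D_X s`, at `v = s(p)`. -/
theorem mfderiv_section [IsManifold I 1 M] [CompleteSpace 𝕜] [FiniteDimensional 𝕜 F]
    (s : ∀ x, V x) (p : M)
    (hs : MDifferentiableAt I (I.prod 𝓘(𝕜, F)) (fun x => TotalSpace.mk' F x (s x)) p)
    (X : TangentSpace I p) :
    mfderiv I (I.prod 𝓘(𝕜, F)) (fun x => TotalSpace.mk' F x (s x)) p X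
      = horizontalLift D ⟨p, s p⟩ X + verticalLift I ⟨p, s p⟩ (D s p X) := by
  have hb := FiberBundle.mem_baseSet_trivializationAt' (F := F) (E := V) p
  have ht := (tensorialAt_aux D p X).pointwise hs
    (FiberBundle.mdifferentiableAt_extend I F (s p)) (by simp)
  have h0 : mvfderiv I (fun x => (trivializationAt F V p
      (TotalSpace.mk' F x (FiberBundle.extend F (s p) x))).2) p X = 0 := by
    have hnear : (fun x => (trivializationAt F V p
        (TotalSpace.mk' F x (FiberBundle.extend F (s p) x))).2) =ᶠ[𝓝 p]
        fun x => (trivializationAt F V p (TotalSpace.mk' F p (s p))).2 := by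
      filter_upwards [(trivializationAt F V p).open_baseSet.mem_nhds hb] with x hx
      simp [FiberBundle.extend, hx]
    exact (congrArg (fun L : E →L[𝕜] F => L X) hnear.mfderiv_eq).trans
      (congrArg (fun L : E →L[𝕜] F => L X) mfderiv_const)
  have h1 : dproj I (⟨p, s p⟩ : TotalSpace F V)
      (mfderiv I (I.prod 𝓘(𝕜, F)) (fun x => TotalSpace.mk' F x (s x)) p X) = X := by
    have h := HasMFDerivAt.comp p (mdifferentiableAt_proj V).hasMFDerivAt hs.hasMFDerivAt
    exact congrArg (fun L : E →L[𝕜] E => L X) (hasMFDerivAt_unique h (hasMFDerivAt_id p))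
  have h2 : dfiber (⟨p, s p⟩ : TotalSpace F V)
      (mfderiv I (I.prod 𝓘(𝕜, F)) (fun x => TotalSpace.mk' F x (s x)) p X)
      = mvfderiv I (fun x => (trivializationAt F V p (TotalSpace.mk' F x (s x))).2) p X := by
    have h := HasMFDerivAt.comp p
      (mdifferentiableAt_fiberCoord (I := I) (⟨p, s p⟩ : TotalSpace F V)).hasMFDerivAt
      hs.hasMFDerivAt
    exact congrArg (fun L : E →L[𝕜] F => L X) h.mfderiv.symm
  have h3 : horizontalLift D (⟨p, s p⟩ : TotalSpace F V) X
      = dsection I ⟨p, s p⟩ X - verticalLift I ⟨p, s p⟩ (D (FiberBundle.extend F (s p)) p X) := rfl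
  have h4 := dfiber_dsection (I := I) (⟨p, s p⟩ : TotalSpace F V) X
  have h5 := dfiber_verticalLift (I := I) (⟨p, s p⟩ : TotalSpace F V) (D s p X)
  have h6 := dfiber_verticalLift (I := I) (⟨p, s p⟩ : TotalSpace F V)
    (D (FiberBundle.extend F (s p)) p X)
  rw [h0] at ht
  refine sub_eq_zero.1 (ext_tangent (⟨p, s p⟩ : TotalSpace F V) _ ?_ ?_)
  · refine (map_sub (dproj I (⟨p, s p⟩ : TotalSpace F V)) _ _).trans ?_
    rw [h1, map_add, dproj_horizontalLift, dproj_verticalLift, add_zero, sub_self]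
  · refine (map_sub (dfiber (I := I) (⟨p, s p⟩ : TotalSpace F V)) _ _).trans ?_
    rw [h2, map_add, h3, map_sub, h4, h5, h6, sub_eq_iff_eq_add.1 ht]
    abel

end Decomposition
end TotalSpaceFManifold

end

noncomputable section

namespace TotalSpaceFManifold

/-! Call X~ + a a lift, for a vector field X on M and a section a of V. Lifts fill every tangent
space of V and are closed under the operations involved. The product of X~ + a and Y~ + b has
horizontal part X∘Y + α(a)∘Y + α(b)∘X and vertical part a∘b (`totalMul_liftField`). At the points of
a section s their bracket has horizontal part [X,Y] and vertical part D_X b − D_Y a − R(X,Y)s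
(`mlieBracket_liftField`). So the F-manifold identity for four lifts becomes an identity on M with a
horizontal and a vertical component (`integrabilityDefect_liftField_eq_zero_iff`). The failure of
the identity is a tensor in all four fields (`integrabilityDefect_congr`), hence testing it on any
family of lifts that fills the tangent spaces is enough.

Necessity is a choice of test lifts, in which e_M~ multiplies horizontal lifts trivially and turns a
vertical a into α(a)~. The fields X~, e_M~, Y~, e_M~ give R(X,Y)s = 0 in the vertical component;
horizontal lifts along the zero section give the F-manifold identity on M; a parallel s, e_M~, Y~,
Z~ give L_{α(s)}(∘) = 0; finally X~, e_M~, a, b and a, e_M~, b, e_M~ with a, b parallel give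
D_X(a∘b) = 0 and [α(a),α(b)] = 0.

For sufficiency, flatness provides a parallel local section through every vector of V
(`exists_isParallelOn`), so it suffices to test lifts with parallel vertical parts. All vertical
parts of brackets then vanish. With c, d the vertical parts of the two arguments, the horizontal
component only involves Λ(X), the Lie derivative along X of (Z,W) ↦ Z∘W + α(c)∘W + α(d)∘Z. This
operator is additive, satisfies Λ(X∘Y) = X∘Λ(Y) + Y∘Λ(X) by conditions 1 and 3, and kills α(a) for
parallel a by conditions 3 and 4. Hence Λ(X∘Y + α(a)∘Y + α(b)∘X) = (X+α(a))∘Λ(Y) + (Y+α(b))∘Λ(X),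
which is what is required (`integrabilityDefect_liftField_parallel`).

In coordinates, parallel sections solve dS = −A S, and flatness is the integrability condition on A.
The solution is built by linear ODEs along rays, and a Gronwall estimate shows that it has the
prescribed derivative in every direction (`norm_radial_sub_le`). The argument treats ℝ and ℂ
uniformly: only the radial parameter is real. -/

theorem mvfderiv_congr {𝕜 : Type*} [NontriviallyNormedField 𝕜]
    {E : Type*} [NormedAddCommGroup E] [NormedSpace 𝕜 E]
    {H : Type*} [TopologicalSpace H] {I : ModelWithCorners 𝕜 E H}
    {M : Type*} [TopologicalSpace M] [ChartedSpace H M]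
    {G : Type*} [NormedAddCommGroup G] [NormedSpace 𝕜 G] {f g : M → G} {x : M} (h : f =ᶠ[𝓝 x] g) :
    mvfderiv I f x = mvfderiv I g x :=
  h.mfderiv_eq (I := I) (I' := 𝓘(𝕜, G))

/-! ### Lie brackets as commutators of derivations. -/

section VectorFieldsActingOnFunctions

set_option linter.unusedSectionVars false

variable {𝕜 : Type*} [RCLike 𝕜]
  {E : Type*} [NormedAddCommGroup E] [NormedSpace 𝕜 E] [CompleteSpace E]
  {H : Type*} [TopologicalSpace H] {I : ModelWithCorners 𝕜 E H} [I.Boundaryless]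
  {M : Type*} [TopologicalSpace M] [ChartedSpace H M]
  {G : Type*} [NormedAddCommGroup G] [NormedSpace 𝕜 G]

theorem mvfderiv_eq_fderiv {f : M → G} {x : M} (hf : MDifferentiableAt I 𝓘(𝕜, G) f x)
    (X : TangentSpace I x) :
    mvfderiv I f x X = fderiv 𝕜 (f ∘ (extChartAt I x).symm) (extChartAt I x x) X := by
  rw [hf.mvfderiv, I.range_eq_univ, fderivWithin_univ]
  rfl

theorem mfderivWithin_range_eq {f : E → M} (z : E) :
    mfderivWithin 𝓘(𝕜, E) I f (Set.range I) z = mfderiv 𝓘(𝕜, E) I f z := by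
  rw [I.range_eq_univ, mfderivWithin_univ]

variable (I) in
/-- The vector field `X`, written in the chart at `x`. -/
def chartField (x : M) (X : ∀ y : M, TangentSpace I y) (z : E) : E :=
  mpullbackWithin 𝓘(𝕜, E) I (extChartAt I x).symm X (Set.range I) z

/-- Differentiation of a function along a vector field, in the chart at `x`. -/
theorem fderiv_chartField [IsManifold I 1 M] {f : M → G} {x : M} {z : E}
    (hz : z ∈ (extChartAt I x).target)
    (hf : MDifferentiableAt I 𝓘(𝕜, G) f ((extChartAt I x).symm z))
    (Y : ∀ y : M, TangentSpace I y) :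
    fderiv 𝕜 (f ∘ (extChartAt I x).symm) z (chartField I x Y z)
      = mvfderiv I f ((extChartAt I x).symm z) (Y ((extChartAt I x).symm z)) := by
  have hinv := isInvertible_mfderivWithin_extChartAt_symm (I := I) hz
  have hd : MDifferentiableAt 𝓘(𝕜, E) I (extChartAt I x).symm z := by
    have := mdifferentiableWithinAt_extChartAt_symm (I := I) hz
    rwa [I.range_eq_univ, mdifferentiableWithinAt_univ] at this
  obtain ⟨A, hA⟩ : ∃ A : E →L[𝕜] G, A = mfderiv I 𝓘(𝕜, G) f ((extChartAt I x).symm z) := ⟨_, rfl⟩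
  obtain ⟨B, hB⟩ : ∃ B : E →L[𝕜] E, B = mfderiv 𝓘(𝕜, E) I (extChartAt I x).symm z := ⟨_, rfl⟩
  have hc : HasFDerivAt (𝕜 := 𝕜) (f ∘ (extChartAt I x).symm) (A ∘L B) z := by
    rw [hA, hB]
    exact (HasMFDerivAt.comp z hf.hasMFDerivAt hd.hasMFDerivAt).hasFDerivAt
  rw [hc.fderiv, ContinuousLinearMap.comp_apply, hA, hB]
  rw [mfderivWithin_range_eq] at hinv
  refine congrArg (mvfderiv I f ((extChartAt I x).symm z)) ?_
  rw [chartField, mpullbackWithin_apply, mfderivWithin_range_eq]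
  obtain ⟨e, he⟩ := hinv
  rw [← he, ContinuousLinearMap.inverse_equiv]
  exact e.apply_symm_apply _

theorem chartField_self [IsManifold I 1 M] (x : M) (X : ∀ y : M, TangentSpace I y) :
    chartField I x X (extChartAt I x x) = (X x : E) := by
  have h := mfderivWithin_extChartAt_symm_inverse_apply (I := I) (X x)
  rw [chartField, mpullbackWithin_apply]
  refine Eq.trans ?_ h
  exact congrArg (fun y : M => ((mfderivWithin 𝓘(𝕜, E) I (extChartAt I x).symm (Set.range I)
    (extChartAt I x x) : E →L[𝕜] E).inverse (X y : E) : E)) (extChartAt_to_inv x)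

theorem mlieBracket_eq_lieBracket [IsManifold I 1 M] (X Y : ∀ y : M, TangentSpace I y) (x : M) :
    mlieBracket I X Y x = lieBracket 𝕜 (chartField I x X) (chartField I x Y) (extChartAt I x x) := by
  rw [← mlieBracketWithin_univ, mlieBracketWithin_apply, mfderiv_extChartAt_self]
  refine (congrArg (fun L : E →L[𝕜] E => L _)
    (ContinuousLinearMap.inverse_id (R := 𝕜) (M := E))).trans ?_
  change lieBracketWithin 𝕜 (chartField I x X) (chartField I x Y)
    (_ ∩ Set.range I) (extChartAt I x x) = _
  rw [Set.preimage_univ, Set.univ_inter, I.range_eq_univ, lieBracketWithin_univ]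

theorem differentiableAt_chartField [IsManifold I 2 M] {x : M} {X : ∀ y : M, TangentSpace I y}
    (hX : MDifferentiableAt I I.tangent (fun y => (X y : TangentBundle I M)) x) :
    DifferentiableAt 𝕜 (chartField I x X) (extChartAt I x x) := by
  have h : DifferentiableWithinAt 𝕜 (chartField I x X)
      ((extChartAt I x).symm ⁻¹' Set.univ ∩ Set.range I) (extChartAt I x x) :=
    (hX.mdifferentiableWithinAt (s := Set.univ)).differentiableWithinAt_mpullbackWithin_vectorField
  rwa [Set.preimage_univ, Set.univ_inter, I.range_eq_univ, differentiableWithinAt_univ] at h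

/-- The Lie bracket of vector fields acts on functions as the commutator. -/
theorem mvfderiv_mlieBracket [IsManifold I 2 M] {f : M → G} {x : M}
    {X Y : ∀ y : M, TangentSpace I y} (hf : ContMDiffAt I 𝓘(𝕜, G) 2 f x)
    (hX : MDifferentiableAt I I.tangent (fun y => (X y : TangentBundle I M)) x)
    (hY : MDifferentiableAt I I.tangent (fun y => (Y y : TangentBundle I M)) x) :
    mvfderiv I f x (mlieBracket I X Y x)
      = mvfderiv I (fun y => mvfderiv I f y (Y y)) x (X x)
        - mvfderiv I (fun y => mvfderiv I f y (X y)) x (Y x) := by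
  have : IsManifold I 1 M := .of_le (n := 2) (by norm_num)
  have hfc : ContDiffAt 𝕜 2 (f ∘ (extChartAt I x).symm) (extChartAt I x x) := by
    have h := (contMDiffAt_iff.1 hf).2
    rw [I.range_eq_univ, contDiffWithinAt_univ] at h
    exact h
  have hnear : ∀ᶠ z in 𝓝 (extChartAt I x x), z ∈ (extChartAt I x).target ∧
      MDifferentiableAt I 𝓘(𝕜, G) f ((extChartAt I x).symm z) := by
    have h1 : ∀ᶠ y in 𝓝 x, MDifferentiableAt I 𝓘(𝕜, G) f y := by
      obtain ⟨u, hu, hfu⟩ := (contMDiffAt_iff_contMDiffOn_nhds (by norm_num)).1 hf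
      filter_upwards [eventually_mem_nhds_iff.2 hu] with y hy
      exact (hfu.contMDiffAt hy).mdifferentiableAt (by norm_num)
    have h2 : Filter.Tendsto (extChartAt I x).symm (𝓝 (extChartAt I x x)) (𝓝 x) := by
      have := continuousAt_extChartAt_symm (I := I) x
      rwa [ContinuousAt, extChartAt_to_inv] at this
    exact Filter.Eventually.and (extChartAt_target_mem_nhds x) (h2.eventually h1)
  -- Iterated derivatives are moved to the chart. Differentiability of the inner derivative is first
  -- proved there, because comparing the two outer derivatives needs it.
  have key : ∀ (Z : ∀ y : M, TangentSpace I y) (v : TangentSpace I x),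
      DifferentiableAt 𝕜 (chartField I x Z) (extChartAt I x x) →
      mvfderiv I (fun y => mvfderiv I f y (Z y)) x v
        = fderiv 𝕜 (fun z => fderiv 𝕜 (f ∘ (extChartAt I x).symm) z (chartField I x Z z))
            (extChartAt I x x) v := by
    intro Z v hZ
    have hev : (fun z => fderiv 𝕜 (f ∘ (extChartAt I x).symm) z (chartField I x Z z))
        =ᶠ[𝓝 (extChartAt I x x)] (fun y => mvfderiv I f y (Z y)) ∘ (extChartAt I x).symm := by
      filter_upwards [hnear] with z hz
      exact fderiv_chartField hz.1 hz.2 Z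
    have hdiff : DifferentiableAt 𝕜 ((fun y => mvfderiv I f y (Z y)) ∘ (extChartAt I x).symm)
        (extChartAt I x x) :=
      (((hfc.fderiv_right (m := 1) (by norm_num)).differentiableAt (by norm_num)).clm_apply
        hZ).congr_of_eventuallyEq hev.symm
    have hmd : MDifferentiableAt I 𝓘(𝕜, G) (fun y => mvfderiv I f y (Z y)) x := by
      rw [← mdifferentiableWithinAt_univ]
      apply DifferentiableWithinAt.mdifferentiableWithinAt_of_comp_extChartAt_symm
      exact hdiff.differentiableWithinAt
    rw [mvfderiv_eq_fderiv hmd, hev.fderiv_eq]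
  have hdX := differentiableAt_chartField hX
  have hdY := differentiableAt_chartField hY
  -- The second derivative of `f` in the chart is symmetric; over ℝ and ℂ class C² is enough for
  -- this.
  have h := fderiv_apply_lieBracket hfc (by simp) hdY hdX
  rw [key X _ hdX, key Y _ hdY, mvfderiv_eq_fderiv (hf.mdifferentiableAt (by norm_num)),
    mlieBracket_eq_lieBracket, h, chartField_self, chartField_self]

end VectorFieldsActingOnFunctions

/-! ### Smoothness of vector fields and sections. -/

section Smoothness

set_option linter.unusedSectionVars false

variable {𝕜 : Type*} [RCLike 𝕜]
  {E : Type*} [NormedAddCommGroup E] [NormedSpace 𝕜 E]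
  {H : Type*} [TopologicalSpace H] {I : ModelWithCorners 𝕜 E H}
  {M : Type*} [TopologicalSpace M] [ChartedSpace H M]
  {G : Type*} [NormedAddCommGroup G] [NormedSpace 𝕜 G]

/-- A vector field is smooth at `x` iff its expression in the chart at `x` is. -/
theorem contMDiffAt_vectorField_iff [IsManifold I 1 M] {n : ℕ∞ω} {X : ∀ y : M, TangentSpace I y}
    {x : M} :
    ContMDiffAt I (I.prod 𝓘(𝕜, E)) n (fun y => TotalSpace.mk' E y (X y)) x ↔
      ContMDiffAt I 𝓘(𝕜, E) n (fun y => mvfderiv I (extChartAt I x) y (X y)) x := by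
  rw [contMDiffAt_section]
  refine Filter.EventuallyEq.contMDiffAt_iff ?_
  filter_upwards [(chartAt H x).open_source.mem_nhds (mem_chart_source H x)] with y hy
  -- Over the chart domain, the trivialization of the tangent bundle is the differential of the
  -- chart.
  have h := TangentBundle.continuousLinearMapAt_trivializationAt (I := I) hy
  have h' := (trivializationAt E (TangentSpace I) x).continuousLinearMapAt_apply_of_mem (R := 𝕜)
    (b := y) hy (X y)
  exact h'.symm.trans (congrArg (fun L : E →L[𝕜] E => L (X y)) h)

theorem IsSectionOn.mono {F : Type*} [NormedAddCommGroup F] [NormedSpace 𝕜 F]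
    {V : M → Type*} [TopologicalSpace (TotalSpace F V)]
    [∀ x, AddCommGroup (V x)] [∀ x, Module 𝕜 (V x)]
    [∀ x, TopologicalSpace (V x)] [FiberBundle F V] {U U' : Set M} {s : ∀ x, V x}
    (h : IsSectionOn I F U s) (hU : U' ⊆ U) : IsSectionOn I F U' s :=
  ContMDiffOn.mono h hU

theorem IsSectionOn.mdifferentiableAt {F : Type*} [NormedAddCommGroup F] [NormedSpace 𝕜 F]
    {V : M → Type*} [TopologicalSpace (TotalSpace F V)]
    [∀ x, AddCommGroup (V x)] [∀ x, Module 𝕜 (V x)]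
    [∀ x, TopologicalSpace (V x)] [FiberBundle F V] {U : Set M} {s : ∀ x, V x}
    (h : IsSectionOn I F U s) (hU : IsOpen U) {x : M} (hx : x ∈ U) :
    MDifferentiableAt I (I.prod 𝓘(𝕜, F)) (fun y => TotalSpace.mk' F y (s y)) x :=
  (ContMDiffOn.contMDiffAt h (hU.mem_nhds hx)).mdifferentiableAt (by simp)

end Smoothness

/-! ### Connection forms, and the fiber coordinate differentiated along lifts. -/

section Lifts

set_option linter.unusedSectionVars false

variable {𝕜 : Type*} [RCLike 𝕜]
  {E : Type*} [NormedAddCommGroup E] [NormedSpace 𝕜 E]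
  {H : Type*} [TopologicalSpace H] {I : ModelWithCorners 𝕜 E H}
  {M : Type*} [TopologicalSpace M] [ChartedSpace H M]
  {F : Type*} [NormedAddCommGroup F] [NormedSpace 𝕜 F]
  {V : M → Type*} [TopologicalSpace (TotalSpace F V)]
  [∀ x, AddCommGroup (V x)] [∀ x, Module 𝕜 (V x)]
  [∀ x, TopologicalSpace (V x)] [∀ x, IsTopologicalAddGroup (V x)]
  [∀ x, ContinuousSMul 𝕜 (V x)] [FiberBundle F V] [VectorBundle 𝕜 F V]
  [IsManifold I ∞ M] [ContMDiffVectorBundle ∞ F V I] [FiniteDimensional 𝕜 F]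
  (D : CovariantDerivative I F V)
  (e : Trivialization F (TotalSpace.proj : TotalSpace F V → M)) [MemTrivializationAtlas e]

/-- The connection form of `D` in the trivialization `e`: it maps a tangent vector `X` to the
fiber coordinate of `D_X s`, where `s` is the section with constant fiber coordinate `c`. -/
def connectionForm (c : F) (x : M) : TangentSpace I x →L[𝕜] F :=
  e.continuousLinearMapAt 𝕜 x ∘L D (fun y => e.symm y c) x

theorem fiberCoord_symm {x : M} (hx : x ∈ e.baseSet) (c : F) :
    (e (TotalSpace.mk' F x (e.symm x c))).2 = c :=
  congrArg Prod.snd (e.apply_mk_symm hx c)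

theorem isSectionOn_const (c : F) : IsSectionOn I F e.baseSet (fun y => e.symm y c) := by
  rw [IsSectionOn, e.contMDiffOn_section_baseSet_iff]
  exact (contMDiffOn_const (c := c)).congr fun y hy => fiberCoord_symm e hy c

theorem mdifferentiableAt_const_section (c : F) {x : M} (hx : x ∈ e.baseSet) :
    MDifferentiableAt I (I.prod 𝓘(𝕜, F)) (fun y => TotalSpace.mk' F y (e.symm y c)) x :=
  (isSectionOn_const e c).mdifferentiableAt e.open_baseSet hx

theorem connectionForm_add {x : M} (hx : x ∈ e.baseSet) (c d : F) :
    connectionForm D e (c + d) x = connectionForm D e c x + connectionForm D e d x := by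
  have h : D (fun y => e.symm y (c + d)) x
      = D ((fun y => e.symm y c) + fun y => e.symm y d) x := by
    refine D.isCovariantDerivativeOn.congr_of_eqOn (mdifferentiableAt_const_section e _ hx)
      (mdifferentiableAt_add_section (mdifferentiableAt_const_section e _ hx)
        (mdifferentiableAt_const_section e _ hx)) (e.open_baseSet.mem_nhds hx) fun y hy => ?_
    rw [Pi.add_apply, ← e.symmL_apply (R := 𝕜) hy, map_add, e.symmL_apply hy, e.symmL_apply hy]
  rw [connectionForm, h, D.isCovariantDerivativeOn.add (mdifferentiableAt_const_section e _ hx)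
        (mdifferentiableAt_const_section e _ hx), ContinuousLinearMap.comp_add]
  rfl

theorem connectionForm_smul {x : M} (hx : x ∈ e.baseSet) (r : 𝕜) (c : F) :
    connectionForm D e (r • c) x = r • connectionForm D e c x := by
  have h : D (fun y => e.symm y (r • c)) x = D (r • fun y => e.symm y c) x := by
    refine D.isCovariantDerivativeOn.congr_of_eqOn (mdifferentiableAt_const_section e _ hx)
      ?_ (e.open_baseSet.mem_nhds hx) fun y hy => ?_
    · exact mdifferentiableAt_const.smul_section (mdifferentiableAt_const_section e _ hx)
    rw [Pi.smul_apply, ← e.symmL_apply (R := 𝕜) hy, map_smul, e.symmL_apply hy]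
  rw [connectionForm, h, D.isCovariantDerivativeOn.smul_const _
    (mdifferentiableAt_const_section e _ hx), ContinuousLinearMap.comp_smul]
  rfl

/-- Used when `c` depends on the point of the total space: only finitely many forms with fixed
coefficient remain, and for these smoothness is known. -/
theorem connectionForm_eq_sum {ι : Type*} [Fintype ι] (b : Module.Basis ι 𝕜 F) {x : M}
    (hx : x ∈ e.baseSet) (c : F) :
    connectionForm D e c x = ∑ i, b.repr c i • connectionForm D e (b i) x := by
  let L : F →ₗ[𝕜] (TangentSpace I x →L[𝕜] F) :=
    { toFun := fun c => connectionForm D e c x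
      map_add' := connectionForm_add D e hx
      map_smul' := connectionForm_smul D e hx }
  change L c = ∑ i, b.repr c i • L (b i)
  calc L c = L (∑ i, b.repr c i • b i) := by rw [b.sum_repr c]
    _ = _ := by simp only [map_sum, map_smul]

/-- The covariant derivative of a section in a trivialization. -/
theorem continuousLinearMapAt_covariantDerivative {x : M} (hx : x ∈ e.baseSet) {s : ∀ y, V y}
    (hs : MDifferentiableAt I (I.prod 𝓘(𝕜, F)) (fun y => TotalSpace.mk' F y (s y)) x)
    (X : TangentSpace I x) :
    e.continuousLinearMapAt 𝕜 x (D s x X)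
      = mvfderiv I (fun y => (e (TotalSpace.mk' F y (s y))).2) x X
        + connectionForm D e (e (TotalSpace.mk' F x (s x))).2 x X := by
  -- `D` and the derivative of the coordinate obey the same Leibniz rule, so their difference is
  -- tensorial in `s` and may be evaluated on the section with constant fiber coordinate, whose
  -- coordinate derivative is zero.
  have ht : TensorialAt I F (fun s : ∀ x, V x =>
      e.continuousLinearMapAt 𝕜 x (D s x X)
        - mvfderiv I (fun y => (e (TotalSpace.mk' F y (s y))).2) x X) x := by
    have hd : ∀ {σ : ∀ y, V y}, MDifferentiableAt I (I.prod 𝓘(𝕜, F))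
        (fun y => TotalSpace.mk' F y (σ y)) x →
        MDifferentiableAt I 𝓘(𝕜, F) (fun y => (e (TotalSpace.mk' F y (σ y))).2) x :=
      fun h => (e.mdifferentiableAt_section_iff I _ hx).1 h
    constructor
    · intro f σ hf hσ
      have hnear : (fun y => (e (TotalSpace.mk' F y ((f • σ) y))).2) =ᶠ[𝓝 x]
          fun y => f y • (e (TotalSpace.mk' F y (σ y))).2 := by
        filter_upwards [e.open_baseSet.mem_nhds hx] with y hy
        exact (e.linear 𝕜 hy).map_smul (f y) (σ y)
      rw [mvfderiv_congr hnear, mvfderiv_fun_smul hf (hd hσ),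
        D.isCovariantDerivativeOn.leibniz hσ hf]
      have h2 := e.continuousLinearMapAt_apply_of_mem (R := 𝕜) hx (σ x)
      simp only [add_apply, smul_apply, ContinuousLinearMap.smulRight_apply, map_add, map_smul,
        smul_sub, h2]
      abel
    · intro σ τ hσ hτ
      have hnear : (fun y => (e (TotalSpace.mk' F y ((σ + τ) y))).2) =ᶠ[𝓝 x]
          fun y => (e (TotalSpace.mk' F y (σ y))).2 + (e (TotalSpace.mk' F y (τ y))).2 := by
        filter_upwards [e.open_baseSet.mem_nhds hx] with y hy
        exact (e.linear 𝕜 hy).map_add (σ y) (τ y)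
      rw [mvfderiv_congr hnear, mvfderiv_fun_add (hd hσ) (hd hτ),
        D.isCovariantDerivativeOn.add hσ hτ]
      simp only [add_apply, map_add]
      abel
  have h := ht.pointwise hs
    (mdifferentiableAt_const_section e (e (TotalSpace.mk' F x (s x))).2 hx)
    (e.symm_apply_apply_mk hx (s x)).symm
  have hnear : (fun y => (e (TotalSpace.mk' F y
      (e.symm y (e (TotalSpace.mk' F x (s x))).2))).2) =ᶠ[𝓝 x]
      fun _ => (e (TotalSpace.mk' F x (s x))).2 := by
    filter_upwards [e.open_baseSet.mem_nhds hx] with y hy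
    exact fiberCoord_symm e hy _
  simp only [mvfderiv_congr hnear, mvfderiv_const, zero_apply, sub_zero] at h
  rw [← sub_eq_iff_eq_add']
  exact h

theorem mdifferentiableAt_fiberCoord' {w : TotalSpace F V} (hw : w.proj ∈ e.baseSet) :
    MDifferentiableAt (I.prod 𝓘(𝕜, F)) 𝓘(𝕜, F) (fun w : TotalSpace F V => (e w).2) w := by
  have h := (e.contMDiffAt_iff (IM := I.prod 𝓘(𝕜, F)) (IB := I) (n := 1)
    (f := fun w : TotalSpace F V => w) (x₀ := w) (e.mem_source.2 hw)).1 contMDiffAt_id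
  exact h.2.mdifferentiableAt (by norm_num)

/-- The sum of the two vectors is the differential of the section through `w` with constant fiber
coordinate, by `mfderiv_section`, and along that section the coordinate does not change. -/
theorem mvfderiv_fiberCoord_horizontalLift (w : TotalSpace F V) (hw : w.proj ∈ e.baseSet)
    (X : TangentSpace I w.proj) :
    mvfderiv (I.prod 𝓘(𝕜, F)) (fun w : TotalSpace F V => (e w).2) w (horizontalLift D w X)
      + mvfderiv (I.prod 𝓘(𝕜, F)) (fun w : TotalSpace F V => (e w).2) w
          (verticalLift I w (D (fun y => e.symm y (e w).2) w.proj X)) = 0 := by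
  obtain ⟨p, v⟩ := w
  obtain ⟨c, rfl⟩ : ∃ c, e.symm p c = v := ⟨_, e.symm_apply_apply_mk hw v⟩
  have hc : (e (TotalSpace.mk' F p (e.symm p c))).2 = c := fiberCoord_symm e hw c
  rw [← map_add]
  have h := mfderiv_section D (fun y => e.symm y c) p (mdifferentiableAt_const_section e c hw) X
  change mvfderiv (I.prod 𝓘(𝕜, F)) (fun w : TotalSpace F V => (e w).2)
    (TotalSpace.mk' F p (e.symm p c)) (horizontalLift D (TotalSpace.mk' F p (e.symm p c)) X
      + verticalLift I (TotalSpace.mk' F p (e.symm p c))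
        (D (fun y => e.symm y (e (TotalSpace.mk' F p (e.symm p c))).2) p X)) = 0
  rw [hc]
  refine (congrArg _ h.symm).trans ?_
  have hcomp := HasMFDerivAt.comp p
    (mdifferentiableAt_fiberCoord' (I := I) e (w := TotalSpace.mk' F p (e.symm p c)) hw).hasMFDerivAt
    (mdifferentiableAt_const_section (I := I) e c hw).hasMFDerivAt
  have hnear : ((fun w : TotalSpace F V => (e w).2) ∘ fun y => TotalSpace.mk' F y (e.symm y c))
      =ᶠ[𝓝 p] fun _ => c := by
    filter_upwards [e.open_baseSet.mem_nhds hw] with y hy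
    exact fiberCoord_symm e hy _
  have h0 := hasMFDerivAt_unique (hcomp.congr_of_eventuallyEq hnear.symm) (hasMFDerivAt_const c p)
  exact congrArg (fun L : E →L[𝕜] F => L X) h0

/-- On a fiber the coordinate given by `e` is affine in the displacement. The preferred
trivialization that enters the vertical lift cancels against its own inverse, so any `e` is allowed.
-/
theorem mvfderiv_fiberCoord_verticalLift (w : TotalSpace F V) (hw : w.proj ∈ e.baseSet)
    (a : V w.proj) :
    mvfderiv (I.prod 𝓘(𝕜, F)) (fun w : TotalSpace F V => (e w).2) w (verticalLift I w a)
      = e.continuousLinearMapAt 𝕜 w.proj a := by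
  have h1 : HasMFDerivAt (I.prod 𝓘(𝕜, F)) 𝓘(𝕜, F) (fun w : TotalSpace F V => (e w).2)
      (⟨w.proj, w.2 + (trivializationAt F V w.proj).symmL 𝕜 w.proj 0⟩ : TotalSpace F V)
      (mvfderiv (I.prod 𝓘(𝕜, F)) (fun w : TotalSpace F V => (e w).2) w : E × F →L[𝕜] F) :=
    hasMFDerivAt_of_eq (fiber_zero w) (mdifferentiableAt_fiberCoord' e hw).hasMFDerivAt
  have h := HasMFDerivAt.comp (0 : F) h1 (mdifferentiableAt_fiber (I := I) w).hasMFDerivAt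
  have h2 : HasMFDerivAt 𝓘(𝕜, F) 𝓘(𝕜, F) (fun f : F => (e w).2 +
      (e.continuousLinearMapAt 𝕜 w.proj ∘L (trivializationAt F V w.proj).symmL 𝕜 w.proj) f) 0
      (e.continuousLinearMapAt 𝕜 w.proj ∘L (trivializationAt F V w.proj).symmL 𝕜 w.proj) :=
    ((ContinuousLinearMap.hasFDerivAt _).const_add _).hasMFDerivAt
  have h0 := hasMFDerivAt_unique h (h2.congr_of_eventuallyEq
    (Filter.Eventually.of_forall fun f => by
      have := (e.linear 𝕜 hw).map_add w.2 ((trivializationAt F V w.proj).symmL 𝕜 w.proj f)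
      exact this.trans (congrArg _ (e.continuousLinearMapAt_apply_of_mem (R := 𝕜) hw _).symm)))
  refine (congrArg (fun L : F →L[𝕜] F =>
    L ((trivializationAt F V w.proj).continuousLinearMapAt 𝕜 w.proj a)) h0).trans ?_
  exact congrArg (e.continuousLinearMapAt 𝕜 w.proj)
    ((trivializationAt F V w.proj).symmL_continuousLinearMapAt (R := 𝕜)
    (FiberBundle.mem_baseSet_trivializationAt' w.proj) a)

/-- The vector field on the total space of `V` with horizontal part `X` and vertical part `a`. -/
def liftField (X : ∀ x : M, TangentSpace I x) (a : ∀ x, V x) (w : TotalSpace F V) :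
    TangentSpace (I.prod 𝓘(𝕜, F)) w :=
  horizontalLift D w (X w.proj) + verticalLift I w (a w.proj)

theorem mvfderiv_fiberCoord_add (w : TotalSpace F V) (hw : w.proj ∈ e.baseSet)
    (X : TangentSpace I w.proj) (a : V w.proj) :
    mvfderiv (I.prod 𝓘(𝕜, F)) (fun w : TotalSpace F V => (e w).2) w
        (horizontalLift D w X + verticalLift I w a)
      = (e (TotalSpace.mk' F w.proj a)).2 - connectionForm D e (e w).2 w.proj X := by
  have h := mvfderiv_fiberCoord_horizontalLift D e w hw X
  rw [mvfderiv_fiberCoord_verticalLift e w hw] at h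
  rw [map_add, mvfderiv_fiberCoord_verticalLift e w hw, eq_neg_of_add_eq_zero_left h,
    e.continuousLinearMapAt_apply_of_mem (R := 𝕜) hw a, neg_add_eq_sub]
  rfl

theorem mvfderiv_fiberCoord_liftField (X : ∀ x : M, TangentSpace I x) (a : ∀ x, V x)
    (w : TotalSpace F V) (hw : w.proj ∈ e.baseSet) :
    mvfderiv (I.prod 𝓘(𝕜, F)) (fun w : TotalSpace F V => (e w).2) w (liftField D X a w)
      = (e (TotalSpace.mk' F w.proj (a w.proj))).2
        - connectionForm D e (e w).2 w.proj (X w.proj) :=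
  mvfderiv_fiberCoord_add D e w hw _ _

theorem dproj_liftField (X : ∀ x : M, TangentSpace I x) (a : ∀ x, V x) (w : TotalSpace F V) :
    dproj I w (liftField D X a w) = X w.proj := by
  rw [liftField, map_add, dproj_horizontalLift, dproj_verticalLift, add_zero]

theorem mvfderiv_comp_proj {G : Type*} [NormedAddCommGroup G] [NormedSpace 𝕜 G] {g : M → G}
    {w : TotalSpace F V} (hg : MDifferentiableAt I 𝓘(𝕜, G) g w.proj)
    (ξ : TangentSpace (I.prod 𝓘(𝕜, F)) w) :
    mvfderiv (I.prod 𝓘(𝕜, F)) (fun w : TotalSpace F V => g w.proj) w ξ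
      = mvfderiv I g w.proj (dproj I w ξ) := by
  have h := HasMFDerivAt.comp w hg.hasMFDerivAt (mdifferentiableAt_proj V (IB := I)).hasMFDerivAt
  exact congrArg (fun L : E × F →L[𝕜] G => L ξ) h.mfderiv

end Lifts

/-! ### Smoothness of lifts in the charts of the total space. -/

section Lifts

set_option linter.unusedSectionVars false

variable {𝕜 : Type*} [RCLike 𝕜]
  {E : Type*} [NormedAddCommGroup E] [NormedSpace 𝕜 E]
  {H : Type*} [TopologicalSpace H] {I : ModelWithCorners 𝕜 E H}
  {M : Type*} [TopologicalSpace M] [ChartedSpace H M]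
  {F : Type*} [NormedAddCommGroup F] [NormedSpace 𝕜 F]
  {V : M → Type*} [TopologicalSpace (TotalSpace F V)]
  [∀ x, AddCommGroup (V x)] [∀ x, Module 𝕜 (V x)]
  [∀ x, TopologicalSpace (V x)] [∀ x, IsTopologicalAddGroup (V x)]
  [∀ x, ContinuousSMul 𝕜 (V x)] [FiberBundle F V] [VectorBundle 𝕜 F V]
  [IsManifold I ∞ M] [ContMDiffVectorBundle ∞ F V I] [FiniteDimensional 𝕜 F]
  {D : CovariantDerivative I F V}
  (e : Trivialization F (TotalSpace.proj : TotalSpace F V → M)) [MemTrivializationAtlas e]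

theorem isOpen_proj_preimage {U : Set M} (hU : IsOpen U) :
    IsOpen (TotalSpace.proj ⁻¹' U : Set (TotalSpace F V)) :=
  hU.preimage (FiberBundle.continuous_proj F V)

theorem IsSmoothConnection.isSectionOn (hD : IsSmoothConnection D) {U : Set M} (hU : IsOpen U)
    {X : ∀ x : M, TangentSpace I x} {s : ∀ x, V x} (hX : IsSectionOn I E U X)
    (hs : IsSectionOn I F U s) : IsSectionOn I F U (fun x => D s x (X x)) :=
  ((hD U hU).contMDiff (σ := s) hs).clm_bundle_apply hX

theorem contMDiffOn_connectionForm (hD : IsSmoothConnection D) {U : Set M} (hU : IsOpen U)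
    (hUe : U ⊆ e.baseSet) {X : ∀ x : M, TangentSpace I x} (hX : IsSectionOn I E U X) (c : F) :
    ContMDiffOn I 𝓘(𝕜, F) ∞ (fun x => connectionForm D e c x (X x)) U := by
  have h := hD.isSectionOn hU hX ((isSectionOn_const e c).mono hUe)
  refine ((e.contMDiffOn_section_iff hU hUe).1 h).congr fun y hy => ?_
  exact e.continuousLinearMapAt_apply_of_mem (R := 𝕜) (hUe hy) _

theorem contMDiffAt_fiberCoord (n : ℕ∞) {w : TotalSpace F V} (hw : w.proj ∈ e.baseSet) :
    ContMDiffAt (I.prod 𝓘(𝕜, F)) 𝓘(𝕜, F) n (fun w : TotalSpace F V => (e w).2) w :=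
  ((e.contMDiffAt_iff (IM := I.prod 𝓘(𝕜, F)) (IB := I) (n := n)
    (f := fun w : TotalSpace F V => w) (x₀ := w) (e.mem_source.2 hw)).1 contMDiffAt_id).2

theorem IsSectionOn.contMDiffAt_mvfderiv_extChartAt {X : ∀ x : M, TangentSpace I x} {U : Set M}
    (hU : IsOpen U) (hX : IsSectionOn I E U X) {x : M} (hx : x ∈ U) :
    ContMDiffAt I 𝓘(𝕜, E) ∞ (fun y => mvfderiv I (extChartAt I x) y (X y)) x :=
  contMDiffAt_vectorField_iff.1 (ContMDiffOn.contMDiffAt hX (hU.mem_nhds hx))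

theorem extChartAt_totalSpace_apply (v w : TotalSpace F V)
    (hw : w.proj ∈ (trivializationAt F V v.proj).baseSet) :
    extChartAt (I.prod 𝓘(𝕜, F)) v w
      = (extChartAt I v.proj w.proj, (trivializationAt F V v.proj w).2) := by
  rw [FiberBundle.extChartAt]
  have : (trivializationAt F V v.proj w).1 = w.proj :=
    (trivializationAt F V v.proj).coe_fst' hw
  simp [this]

theorem mvfderiv_extChartAt_totalSpace (v w : TotalSpace F V)
    (hw : w.proj ∈ (trivializationAt F V v.proj).baseSet)
    (hw' : w.proj ∈ (chartAt H v.proj).source) (ξ : TangentSpace (I.prod 𝓘(𝕜, F)) w) :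
    mvfderiv (I.prod 𝓘(𝕜, F)) (extChartAt (I.prod 𝓘(𝕜, F)) v) w ξ
      = (mvfderiv I (extChartAt I v.proj) w.proj (dproj I w ξ),
        mvfderiv (I.prod 𝓘(𝕜, F)) (fun w : TotalSpace F V => (trivializationAt F V v.proj w).2)
          w ξ) := by
  have hd := mdifferentiableAt_extChartAt (I := I) hw'
  have h1 : MDifferentiableAt (I.prod 𝓘(𝕜, F)) 𝓘(𝕜, E)
      (fun w : TotalSpace F V => extChartAt I v.proj w.proj) w :=
    hd.comp w (mdifferentiableAt_proj V)
  have h2 := mdifferentiableAt_fiberCoord' (I := I) (trivializationAt F V v.proj) hw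
  have hnear : extChartAt (I.prod 𝓘(𝕜, F)) v =ᶠ[𝓝 w] fun w : TotalSpace F V =>
      (extChartAt I v.proj w.proj, (trivializationAt F V v.proj w).2) := by
    filter_upwards [(isOpen_proj_preimage (trivializationAt F V v.proj).open_baseSet).mem_nhds hw]
      with y hy
    exact extChartAt_totalSpace_apply v y hy
  have h3 : HasMFDerivAt (I.prod 𝓘(𝕜, F)) 𝓘(𝕜, E × F) (fun w : TotalSpace F V =>
      (extChartAt I v.proj w.proj, (trivializationAt F V v.proj w).2)) w
      ((mfderiv (I.prod 𝓘(𝕜, F)) 𝓘(𝕜, E) (fun w : TotalSpace F V => extChartAt I v.proj w.proj) w :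
        E × F →L[𝕜] E).prod (mfderiv (I.prod 𝓘(𝕜, F)) 𝓘(𝕜, F)
          (fun w : TotalSpace F V => (trivializationAt F V v.proj w).2) w : E × F →L[𝕜] F)) :=
    ⟨h1.hasMFDerivAt.1.prodMk h2.hasMFDerivAt.1, h1.hasMFDerivAt.2.prodMk h2.hasMFDerivAt.2⟩
  have h4 := congrArg (fun L : E × F →L[𝕜] E × F => L ξ) (h3.congr_of_eventuallyEq hnear).mfderiv
  refine Eq.trans h4 ?_
  exact Prod.ext (mvfderiv_comp_proj hd ξ) rfl

/-- In a product chart the base component is that of X, and the fiber component is the coordinate of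
a minus the connection form of X, which is linear in the fiber coordinate. Expanding the latter in a
basis of the model fiber leaves products of smooth functions. -/
theorem isSectionOn_liftField (hD : IsSmoothConnection D) {U : Set M} (hU : IsOpen U)
    {X : ∀ x : M, TangentSpace I x} {a : ∀ x, V x} (hX : IsSectionOn I E U X)
    (ha : IsSectionOn I F U a) :
    IsSectionOn (I.prod 𝓘(𝕜, F)) (E × F) (TotalSpace.proj ⁻¹' U : Set (TotalSpace F V))
      (liftField D X a) := by
  intro v hv
  refine ContMDiffAt.contMDiffWithinAt (contMDiffAt_vectorField_iff.2 ?_)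
  set e := trivializationAt F V v.proj
  have hve : v.proj ∈ e.baseSet := FiberBundle.mem_baseSet_trivializationAt' _
  have hproj : ContMDiffAt (I.prod 𝓘(𝕜, F)) I ∞ (fun w : TotalSpace F V => w.proj) v :=
    contMDiffAt_proj V
  let b := Module.finBasis 𝕜 F
  have hUe := hU.inter e.open_baseSet
  have hnear : (fun w => mvfderiv (I.prod 𝓘(𝕜, F)) (extChartAt (I.prod 𝓘(𝕜, F)) v) w
      (liftField D X a w)) =ᶠ[𝓝 v] fun w => (mvfderiv I (extChartAt I v.proj) w.proj (X w.proj),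
        (e (TotalSpace.mk' F w.proj (a w.proj))).2
          - ∑ i, b.repr (e w).2 i • connectionForm D e (b i) w.proj (X w.proj)) := by
    filter_upwards [(isOpen_proj_preimage e.open_baseSet).mem_nhds hve,
      (isOpen_proj_preimage (chartAt H v.proj).open_source).mem_nhds (mem_chart_source H v.proj)]
      with w hw hw'
    rw [mvfderiv_extChartAt_totalSpace v w hw hw', dproj_liftField,
      mvfderiv_fiberCoord_liftField D e X a w hw, connectionForm_eq_sum D e b hw]
    simp
  refine ContMDiffAt.congr_of_eventuallyEq ?_ hnear
  refine ContMDiffAt.prodMk_space ?_ (ContMDiffAt.sub ?_ ?_)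
  · exact (hX.contMDiffAt_mvfderiv_extChartAt hU hv).comp v hproj
  · have h := (e.contMDiffAt_section_iff hve).1 (ContMDiffOn.contMDiffAt ha (hU.mem_nhds hv))
    exact h.comp v hproj
  · refine ContMDiffAt.sum fun i _ => ?_
    have h1 : ContMDiffAt (I.prod 𝓘(𝕜, F)) 𝓘(𝕜, 𝕜) ∞
        (fun w : TotalSpace F V => b.repr (e w).2 i) v := by
      have h := (LinearMap.toContinuousLinearMap (b.coord i)).contDiff (n := ∞)
      exact (h.contMDiff.contMDiffAt).comp v (contMDiffAt_fiberCoord e ⊤ hve)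
    have h2 : ContMDiffAt (I.prod 𝓘(𝕜, F)) 𝓘(𝕜, F) ∞
        (fun w : TotalSpace F V => connectionForm D e (b i) w.proj (X w.proj)) v := by
      have h := contMDiffOn_connectionForm e hD hUe Set.inter_subset_right
        (hX.mono Set.inter_subset_left) (b i)
      exact (h.contMDiffAt (hUe.mem_nhds ⟨hv, hve⟩)).comp v hproj
    exact h1.smul h2

end Lifts

/-! ### The Lie bracket of two lifts. -/

section Bracket

set_option linter.unusedSectionVars false

variable {𝕜 : Type*} [RCLike 𝕜]
  {E : Type*} [NormedAddCommGroup E] [NormedSpace 𝕜 E]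
  {H : Type*} [TopologicalSpace H] {I : ModelWithCorners 𝕜 E H}
  {M : Type*} [TopologicalSpace M] [ChartedSpace H M]
  {F : Type*} [NormedAddCommGroup F] [NormedSpace 𝕜 F]
  {V : M → Type*} [TopologicalSpace (TotalSpace F V)]
  [∀ x, AddCommGroup (V x)] [∀ x, Module 𝕜 (V x)]
  [∀ x, TopologicalSpace (V x)] [∀ x, IsTopologicalAddGroup (V x)]
  [∀ x, ContinuousSMul 𝕜 (V x)] [FiberBundle F V] [VectorBundle 𝕜 F V]
  [IsManifold I ∞ M] [ContMDiffVectorBundle ∞ F V I] [FiniteDimensional 𝕜 F]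
  {D : CovariantDerivative I F V}
  (e : Trivialization F (TotalSpace.proj : TotalSpace F V → M)) [MemTrivializationAtlas e]

/-- The differential of the chart is a trivialization of the tangent bundle, hence injective.
Vectors can thus be compared through their action on coordinates. -/
theorem eq_of_mvfderiv_extChartAt_eq {x : M} {X Y : TangentSpace I x}
    (h : mvfderiv I (extChartAt I x) x X = mvfderiv I (extChartAt I x) x Y) : X = Y := by
  have h1 := TangentBundle.continuousLinearMapAt_trivializationAt (I := I) (mem_chart_source H x)
  have h2 : (trivializationAt E (TangentSpace I) x).continuousLinearMapAt 𝕜 x X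
      = (trivializationAt E (TangentSpace I) x).continuousLinearMapAt 𝕜 x Y :=
    (congrArg (fun L : E →L[𝕜] E => L X) h1).trans (h.trans
      (congrArg (fun L : E →L[𝕜] E => L Y) h1.symm))
  have hx := FiberBundle.mem_baseSet_trivializationAt' (F := E) (E := TangentSpace I) x
  rw [← (trivializationAt E (TangentSpace I) x).symmL_continuousLinearMapAt (R := 𝕜) hx X, h2,
    (trivializationAt E (TangentSpace I) x).symmL_continuousLinearMapAt (R := 𝕜) hx Y]

theorem mdifferentiableAt_finset_sum {N : Type*} [TopologicalSpace N] [ChartedSpace H N]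
    {G : Type*} [NormedAddCommGroup G] [NormedSpace 𝕜 G] {ι : Type*} (t : Finset ι)
    {f : ι → N → G} {x : N} (h : ∀ i ∈ t, MDifferentiableAt I 𝓘(𝕜, G) (f i) x) :
    MDifferentiableAt I 𝓘(𝕜, G) (fun y => ∑ i ∈ t, f i y) x := by
  classical
  induction t using Finset.induction_on with
  | empty => simpa using mdifferentiableAt_const
  | insert i t hi ih =>
    simp only [Finset.sum_insert hi]
    exact (h i (Finset.mem_insert_self i t)).add
      (ih fun j hj => h j (Finset.mem_insert_of_mem hj))

theorem mvfderiv_finset_sum {N : Type*} [TopologicalSpace N] [ChartedSpace H N]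
    {G : Type*} [NormedAddCommGroup G] [NormedSpace 𝕜 G] {ι : Type*} (t : Finset ι)
    {f : ι → N → G} {x : N} (h : ∀ i ∈ t, MDifferentiableAt I 𝓘(𝕜, G) (f i) x) :
    mvfderiv I (fun y => ∑ i ∈ t, f i y) x = ∑ i ∈ t, mvfderiv I (f i) x := by
  classical
  induction t using Finset.induction_on with
  | empty => simpa using mvfderiv_const (I := I) (c := (0 : G)) (x := x)
  | insert i t hi ih =>
    have ht := fun j hj => h j (Finset.mem_insert_of_mem hj)
    simp only [Finset.sum_insert hi]
    rw [mvfderiv_fun_add (h i (Finset.mem_insert_self i t)) (mdifferentiableAt_finset_sum t ht),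
      ih ht]

variable [I.Boundaryless] [CompleteSpace E]

/-- Lifts are related by the projection to their horizontal parts, so on functions pulled back from
the base they act as X and Y do. The claim follows by letting both brackets act on the coordinates
of the base. -/
theorem dproj_mlieBracket_liftField (hD : IsSmoothConnection D) {U : Set M} (hU : IsOpen U)
    {X Y : ∀ x : M, TangentSpace I x} {a b : ∀ x, V x} (hX : IsSectionOn I E U X)
    (hY : IsSectionOn I E U Y) (ha : IsSectionOn I F U a) (hb : IsSectionOn I F U b)
    (v : TotalSpace F V) (hv : v.proj ∈ U) :
    dproj I v (mlieBracket (I.prod 𝓘(𝕜, F)) (liftField D X a) (liftField D Y b) v)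
      = mlieBracket I X Y v.proj := by
  have : CompleteSpace F := FiniteDimensional.complete 𝕜 F
  have hUV := isOpen_proj_preimage (F := F) (V := V) hU
  have hg : ContMDiffAt I 𝓘(𝕜, E) 2 (extChartAt I v.proj) v.proj :=
    contMDiffAt_extChartAt.of_le le_top
  have key : ∀ {Z : ∀ x : M, TangentSpace I x} {c : ∀ x, V x} {Z' : ∀ x : M, TangentSpace I x}
      {c' : ∀ x, V x}, IsSectionOn I E U Z →
      mvfderiv (I.prod 𝓘(𝕜, F)) (fun w : TotalSpace F V => mvfderiv (I.prod 𝓘(𝕜, F))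
        (fun w : TotalSpace F V => extChartAt I v.proj w.proj) w (liftField D Z c w)) v
          (liftField D Z' c' v)
        = mvfderiv I (fun y => mvfderiv I (extChartAt I v.proj) y (Z y)) v.proj (Z' v.proj) := by
    intro Z c Z' c' hZ
    have hnear : (fun w : TotalSpace F V => mvfderiv (I.prod 𝓘(𝕜, F))
        (fun w : TotalSpace F V => extChartAt I v.proj w.proj) w (liftField D Z c w)) =ᶠ[𝓝 v]
        fun w => mvfderiv I (extChartAt I v.proj) w.proj (Z w.proj) := by
      filter_upwards [(isOpen_proj_preimage (chartAt H v.proj).open_source).mem_nhds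
        (mem_chart_source H v.proj)] with w hw
      rw [mvfderiv_comp_proj (mdifferentiableAt_extChartAt (I := I) hw), dproj_liftField]
    rw [mvfderiv_congr hnear]
    have hd := (hZ.contMDiffAt_mvfderiv_extChartAt hU hv).mdifferentiableAt (by simp)
    refine (mvfderiv_comp_proj hd _).trans ?_
    rw [dproj_liftField]
  apply eq_of_mvfderiv_extChartAt_eq
  have hgv : ContMDiffAt (I.prod 𝓘(𝕜, F)) 𝓘(𝕜, E) 2
      (fun w : TotalSpace F V => extChartAt I v.proj w.proj) v := hg.comp v (contMDiffAt_proj V)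
  have h1 := mvfderiv_mlieBracket (I := I.prod 𝓘(𝕜, F)) hgv
    ((isSectionOn_liftField hD hU hX ha).mdifferentiableAt hUV hv)
    ((isSectionOn_liftField hD hU hY hb).mdifferentiableAt hUV hv)
  have h2 := mvfderiv_mlieBracket hg (hX.mdifferentiableAt hU hv) (hY.mdifferentiableAt hU hv)
  rw [key hY, key hX] at h1
  rw [← mvfderiv_comp_proj (mdifferentiableAt_extChartAt (I := I) (mem_chart_source H v.proj)), h1,
    h2]

/-- The fiber coordinate relative to a section `s` in the trivialization `e`. -/
def relFiberCoord (s : ∀ x, V x) (w : TotalSpace F V) : F :=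
  (e w).2 - (e (TotalSpace.mk' F w.proj (s w.proj))).2

theorem contMDiffAt_relFiberCoord {U : Set M} (hU : IsOpen U) {s : ∀ x, V x}
    (hs : IsSectionOn I F U s) {w : TotalSpace F V} (hw : w.proj ∈ U) (hwe : w.proj ∈ e.baseSet) :
    ContMDiffAt (I.prod 𝓘(𝕜, F)) 𝓘(𝕜, F) ∞ (relFiberCoord e s) w := by
  refine (contMDiffAt_fiberCoord e ⊤ hwe).sub ?_
  have h := (e.contMDiffAt_section_iff hwe).1 (ContMDiffOn.contMDiffAt hs (hU.mem_nhds hw))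
  exact h.comp w (contMDiffAt_proj V)

/-- Passing to the coordinate relative to `s` completes the derivative of the coordinate of `s` to
the covariant derivative; the connection form is then applied to the relative coordinate alone,
which vanishes on the image of `s`. -/
theorem mvfderiv_relFiberCoord_liftField {U : Set M} (hU : IsOpen U) {s : ∀ x, V x}
    (hs : IsSectionOn I F U s) (X : ∀ x : M, TangentSpace I x) (a : ∀ x, V x)
    {w : TotalSpace F V} (hw : w.proj ∈ U) (hwe : w.proj ∈ e.baseSet) :
    mvfderiv (I.prod 𝓘(𝕜, F)) (relFiberCoord e s) w (liftField D X a w)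
      = (e (TotalSpace.mk' F w.proj (a w.proj))).2
        - e.continuousLinearMapAt 𝕜 w.proj (D s w.proj (X w.proj))
        - connectionForm D e (relFiberCoord e s w) w.proj (X w.proj) := by
  have hsd := hs.mdifferentiableAt hU hw
  have hsd' := (e.mdifferentiableAt_section_iff I _ hwe).1 hsd
  have h1 : MDifferentiableAt (I.prod 𝓘(𝕜, F)) 𝓘(𝕜, F)
      (fun w : TotalSpace F V => (e (TotalSpace.mk' F w.proj (s w.proj))).2) w :=
    hsd'.comp w (mdifferentiableAt_proj V)
  have h2 := mdifferentiableAt_fiberCoord' (I := I) e hwe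
  have h3 := mvfderiv_fun_sub h2 h1
  have h4 : connectionForm D e (relFiberCoord e s w) w.proj (X w.proj)
      = connectionForm D e (e w).2 w.proj (X w.proj) - connectionForm D e
        (e (TotalSpace.mk' F w.proj (s w.proj))).2 w.proj (X w.proj) := by
    have := connectionForm_add D e hwe (relFiberCoord e s w)
      (e (TotalSpace.mk' F w.proj (s w.proj))).2
    rw [relFiberCoord, sub_add_cancel] at this
    rw [this, add_apply, ← relFiberCoord, add_sub_cancel_right]
  have h5 := congrArg (fun L => L (liftField D X a w)) h3
  refine h5.trans ?_
  simp only [sub_apply]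
  rw [mvfderiv_fiberCoord_liftField D e X a w hwe]
  have h6 := mvfderiv_comp_proj hsd' (liftField D X a w)
  rw [dproj_liftField] at h6
  rw [h6, h4, continuousLinearMapAt_covariantDerivative D e hwe hsd]
  abel

/-- The terms are grouped by their symmetry: each parenthesis with connection forms is invariant
under exchanging (X, a) with (Y, b), and so will cancel in a commutator. -/
theorem mvfderiv_mvfderiv_relFiberCoord (hD : IsSmoothConnection D) {U : Set M} (hU : IsOpen U)
    {X Y : ∀ x : M, TangentSpace I x} {a b s : ∀ x, V x}
    (hY : IsSectionOn I E U Y) (hb : IsSectionOn I F U b)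
    (hs : IsSectionOn I F U s) {x : M} (hx : x ∈ U) (hxe : x ∈ e.baseSet) :
    mvfderiv (I.prod 𝓘(𝕜, F)) (fun w : TotalSpace F V => mvfderiv (I.prod 𝓘(𝕜, F))
        (relFiberCoord e s) w (liftField D Y b w)) (TotalSpace.mk' F x (s x))
          (liftField D X a (TotalSpace.mk' F x (s x)))
      = e.continuousLinearMapAt 𝕜 x (D b x (X x))
        - e.continuousLinearMapAt 𝕜 x (D (fun y => D s y (Y y)) x (X x))
        + (connectionForm D e (e.continuousLinearMapAt 𝕜 x (D s x (Y x))) x (X x)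
          + connectionForm D e (e.continuousLinearMapAt 𝕜 x (D s x (X x))) x (Y x))
        - (connectionForm D e (e.continuousLinearMapAt 𝕜 x (a x)) x (Y x)
          + connectionForm D e (e.continuousLinearMapAt 𝕜 x (b x)) x (X x)) := by
  let β := Module.finBasis 𝕜 F
  set v : TotalSpace F V := TotalSpace.mk' F x (s x)
  have hv : v.proj ∈ U := hx
  have hve : v.proj ∈ e.baseSet := hxe
  have hUe := hU.inter e.open_baseSet
  have hDs := hD.isSectionOn hU hY hs
  have hbd := hb.mdifferentiableAt hU hx
  have hDsd := hDs.mdifferentiableAt hU hx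
  have hbd' := (e.mdifferentiableAt_section_iff I _ hxe).1 hbd
  have hDsd' := (e.mdifferentiableAt_section_iff I _ hxe).1 hDsd
  have hf0 : relFiberCoord e s v = 0 := sub_self _
  have hfd := (contMDiffAt_relFiberCoord e hU hs hv hve).mdifferentiableAt (by simp)
  have hnear : (fun w : TotalSpace F V => mvfderiv (I.prod 𝓘(𝕜, F))
        (relFiberCoord e s) w (liftField D Y b w)) =ᶠ[𝓝 v] fun w =>
      ((e (TotalSpace.mk' F w.proj (b w.proj))).2
        - (e (TotalSpace.mk' F w.proj (D s w.proj (Y w.proj)))).2)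
        - ∑ i, LinearMap.toContinuousLinearMap (β.coord i) (relFiberCoord e s w) •
          connectionForm D e (β i) w.proj (Y w.proj) := by
    filter_upwards [(isOpen_proj_preimage hUe).mem_nhds ⟨hv, hve⟩] with w hw
    rw [mvfderiv_relFiberCoord_liftField e hU hs Y b hw.1 hw.2,
      e.continuousLinearMapAt_apply_of_mem (R := 𝕜) hw.2,
      connectionForm_eq_sum D e β hw.2 (relFiberCoord e s w)]
    simp
  have hA : ∀ i, MDifferentiableAt I 𝓘(𝕜, F) (fun y => connectionForm D e (β i) y (Y y)) x := by
    intro i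
    have h := contMDiffOn_connectionForm e hD hUe Set.inter_subset_right
        (hY.mono Set.inter_subset_left) (β i)
    exact (h.contMDiffAt (hUe.mem_nhds ⟨hx, hxe⟩)).mdifferentiableAt (by simp)
  have hA' : ∀ i, MDifferentiableAt (I.prod 𝓘(𝕜, F)) 𝓘(𝕜, F)
      (fun w : TotalSpace F V => connectionForm D e (β i) w.proj (Y w.proj)) v := fun i =>
    MDifferentiableAt.comp v (hA i) (mdifferentiableAt_proj V)
  have hcd : ∀ i, MDifferentiableAt (I.prod 𝓘(𝕜, F)) 𝓘(𝕜, 𝕜)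
      (fun w : TotalSpace F V =>
        LinearMap.toContinuousLinearMap (β.coord i) (relFiberCoord e s w)) v := fun i =>
    (ContinuousLinearMap.mdifferentiableAt _).comp v hfd
  have hcv : ∀ i, mvfderiv (I.prod 𝓘(𝕜, F)) (fun w : TotalSpace F V =>
        LinearMap.toContinuousLinearMap (β.coord i) (relFiberCoord e s w)) v (liftField D X a v)
      = β.repr (e.continuousLinearMapAt 𝕜 x (a x) - e.continuousLinearMapAt 𝕜 x (D s x (X x))) i := by
    intro i
    have h := (HasMFDerivAt.comp v (ContinuousLinearMap.hasMFDerivAt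
      (LinearMap.toContinuousLinearMap (β.coord i))) hfd.hasMFDerivAt).mfderiv
    refine (congrArg (fun L : E × F →L[𝕜] 𝕜 => L (liftField D X a v)) h).trans ?_
    have h2 := mvfderiv_relFiberCoord_liftField (D := D) e hU hs X a hv hve
    rw [hf0] at h2
    have hz : connectionForm D e (0 : F) v.proj (X v.proj) = 0 := by
      have h := connectionForm_smul D e hxe (0 : 𝕜) (0 : F)
      rw [zero_smul, zero_smul] at h
      exact congrArg (fun L : E →L[𝕜] F => L (X x)) h
    rw [hz, sub_zero] at h2
    have h3 := e.continuousLinearMapAt_apply_of_mem (R := 𝕜) hxe (a x)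
    exact (congrArg (LinearMap.toContinuousLinearMap (β.coord i)) h2).trans
      (congrArg (fun c => β.coord i (c - _)) h3.symm)
  have hcA : ∀ i, MDifferentiableAt (I.prod 𝓘(𝕜, F)) 𝓘(𝕜, F) (fun w : TotalSpace F V =>
      LinearMap.toContinuousLinearMap (β.coord i) (relFiberCoord e s w) •
        connectionForm D e (β i) w.proj (Y w.proj)) v := fun i => (hcd i).smul (hA' i)
  have hsum : mvfderiv (I.prod 𝓘(𝕜, F)) (fun w : TotalSpace F V =>
      ∑ i, LinearMap.toContinuousLinearMap (β.coord i) (relFiberCoord e s w) •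
          connectionForm D e (β i) w.proj (Y w.proj)) v (liftField D X a v)
      = connectionForm D e (e.continuousLinearMapAt 𝕜 x (a x)
          - e.continuousLinearMapAt 𝕜 x (D s x (X x))) x (Y x) := by
    rw [mvfderiv_finset_sum _ fun i _ => hcA i, sum_apply,
      connectionForm_eq_sum D e β hxe (_ - _), sum_apply]
    refine Finset.sum_congr rfl fun i _ => ?_
    -- The coefficient vanishes at `v`, so the product rule leaves only the derivative of the
    -- coefficient and no derivative of the connection form survives.
    rw [mvfderiv_fun_smul (hcd i) (hA' i), hf0, map_zero, zero_smul, zero_add,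
      ContinuousLinearMap.smulRight_apply, hcv i]
    rfl
  have hbv : MDifferentiableAt (I.prod 𝓘(𝕜, F)) 𝓘(𝕜, F)
      (fun w : TotalSpace F V => (e (TotalSpace.mk' F w.proj (b w.proj))).2) v :=
    MDifferentiableAt.comp (g := fun y => (e (TotalSpace.mk' F y (b y))).2) v hbd'
      (mdifferentiableAt_proj V)
  have hDv : MDifferentiableAt (I.prod 𝓘(𝕜, F)) 𝓘(𝕜, F) (fun w : TotalSpace F V =>
      (e (TotalSpace.mk' F w.proj (D s w.proj (Y w.proj)))).2) v :=
    MDifferentiableAt.comp (g := fun y => (e (TotalSpace.mk' F y (D s y (Y y)))).2) v hDsd'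
      (mdifferentiableAt_proj V)
  have hbD : MDifferentiableAt (I.prod 𝓘(𝕜, F)) 𝓘(𝕜, F) (fun w : TotalSpace F V =>
      (e (TotalSpace.mk' F w.proj (b w.proj))).2
        - (e (TotalSpace.mk' F w.proj (D s w.proj (Y w.proj)))).2) v := hbv.sub hDv
  have hbX := mvfderiv_comp_proj (w := v) hbd' (liftField D X a v)
  have hDX := mvfderiv_comp_proj (w := v) hDsd' (liftField D X a v)
  rw [dproj_liftField] at hbX hDX
  have hb2 := continuousLinearMapAt_covariantDerivative D e hxe hbd (X x)
  have hD2 := continuousLinearMapAt_covariantDerivative D e hxe hDsd (X x)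
  have hb3 := e.continuousLinearMapAt_apply_of_mem (R := 𝕜) hxe (b x)
  have hD3 := e.continuousLinearMapAt_apply_of_mem (R := 𝕜) hxe (D s x (Y x))
  have hneg : connectionForm D e (e.continuousLinearMapAt 𝕜 x (a x)
          - e.continuousLinearMapAt 𝕜 x (D s x (X x))) x (Y x)
      = connectionForm D e (e.continuousLinearMapAt 𝕜 x (a x)) x (Y x)
        - connectionForm D e (e.continuousLinearMapAt 𝕜 x (D s x (X x))) x (Y x) := by
    have h := connectionForm_add D e hxe (e.continuousLinearMapAt 𝕜 x (a x)
          - e.continuousLinearMapAt 𝕜 x (D s x (X x))) (e.continuousLinearMapAt 𝕜 x (D s x (X x)))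
    rw [sub_add_cancel] at h
    rw [h, add_apply, add_sub_cancel_right]
  rw [mvfderiv_congr hnear, mvfderiv_fun_sub hbD
    (mdifferentiableAt_finset_sum _ fun i _ => hcA i), mvfderiv_fun_sub hbv hDv,
    sub_apply, sub_apply, hsum, hneg, hbX, hDX, hb2, hD2, ← hb3, ← hD3]
  abel

/-- The Lie bracket of two lifts, at the points of a section `s`. -/
theorem mlieBracket_liftField (hD : IsSmoothConnection D) {U : Set M} (hU : IsOpen U)
    {X Y : ∀ x : M, TangentSpace I x} {a b s : ∀ x, V x} (hX : IsSectionOn I E U X)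
    (hY : IsSectionOn I E U Y) (ha : IsSectionOn I F U a) (hb : IsSectionOn I F U b)
    (hs : IsSectionOn I F U s) {x : M} (hx : x ∈ U) :
    mlieBracket (I.prod 𝓘(𝕜, F)) (liftField D X a) (liftField D Y b) (TotalSpace.mk' F x (s x))
      = liftField D (mlieBracket I X Y)
        (fun y => D b y (X y) - D a y (Y y) - curvature D X Y s y) (TotalSpace.mk' F x (s x)) := by
  have : CompleteSpace F := FiniteDimensional.complete 𝕜 F
  set v : TotalSpace F V := TotalSpace.mk' F x (s x) with hv_def
  have hv : v.proj ∈ U := hx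
  let e := trivializationAt F V x
  have hxe : x ∈ e.baseSet := FiberBundle.mem_baseSet_trivializationAt' _
  have hUV := isOpen_proj_preimage (F := F) (V := V) hU
  have h1 := mvfderiv_mlieBracket (I := I.prod 𝓘(𝕜, F))
    ((contMDiffAt_relFiberCoord e hU hs hv hxe).of_le (by norm_cast))
    ((isSectionOn_liftField hD hU hX ha).mdifferentiableAt hUV hv)
    ((isSectionOn_liftField hD hU hY hb).mdifferentiableAt hUV hv)
  -- The commutator of the two iterated derivatives yields D_X b − D_Y a and the second-order part
  -- of the curvature. The remaining term of the curvature comes from applying the first-order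
  -- formula to the bracket itself.
  rw [mvfderiv_mvfderiv_relFiberCoord e hD hU hY hb hs hx hxe,
    mvfderiv_mvfderiv_relFiberCoord e hD hU hX ha hs hx hxe] at h1
  have hproj := dproj_mlieBracket_liftField hD hU hX hY ha hb v hv
  generalize hξ : mlieBracket (I.prod 𝓘(𝕜, F)) (liftField D X a) (liftField D Y b) v = ξ at h1 hproj
  have key : verticalPart D v ξ = D b x (X x) - D a x (Y x) - curvature D X Y s x := by
    have hdec := horizontal_add_vertical D v ξ
    let X' : ∀ y : M, TangentSpace I y := mlieBracket I X Y
    classical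
    -- Only the value at `x` matters: the first-order formula asks for no smoothness of the lifted
    -- field.
    let c' : ∀ y, V y := Function.update 0 x (verticalPart D v ξ)
    have hc' : c' v.proj = verticalPart D v ξ := Function.update_self _ _ _
    have hl : liftField D X' c' v = ξ := by
      have hX' : X' v.proj = dproj I v ξ := hproj.symm
      rw [liftField, hc', hX']; exact hdec
    have h2 := mvfderiv_relFiberCoord_liftField (D := D) e hU hs X' c' hv hxe
    have hf0 : relFiberCoord e s v = 0 := sub_self _
    have hz : connectionForm D e (0 : F) v.proj (X' v.proj) = 0 := by
      have h := connectionForm_smul D e hxe (0 : 𝕜) (0 : F)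
      rw [zero_smul, zero_smul] at h
      exact congrArg (fun L : E →L[𝕜] F => L (X' x)) h
    rw [hl, h1, hf0, hz, sub_zero, hc'] at h2
    have hinj : Function.Injective (e.continuousLinearMapAt 𝕜 x) := by
      intro u u' h
      rw [← e.symmL_continuousLinearMapAt (R := 𝕜) hxe u, h,
        e.symmL_continuousLinearMapAt (R := 𝕜) hxe]
    apply hinj
    have h3 := e.continuousLinearMapAt_apply_of_mem (R := 𝕜) hxe (verticalPart D v ξ)
    have h4 := h3.trans (sub_eq_iff_eq_add.1 h2.symm)
    refine h4.trans ?_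
    simp only [curvature, map_sub]
    abel
  exact (horizontal_add_vertical D v ξ).symm.trans (congrArg₂ (· + ·)
    (congrArg (horizontalLift D v) hproj) (congrArg (verticalLift I v) key))

end Bracket

/-! ### Products of sections expanded in frames. -/

section Multiplication

set_option linter.unusedSectionVars false

variable {𝕜 : Type*} [RCLike 𝕜]
  {E : Type*} [NormedAddCommGroup E] [NormedSpace 𝕜 E]
  {H : Type*} [TopologicalSpace H] {I : ModelWithCorners 𝕜 E H}
  {M : Type*} [TopologicalSpace M] [ChartedSpace H M]
  {F : Type*} [NormedAddCommGroup F] [NormedSpace 𝕜 F]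
  {V : M → Type*} [TopologicalSpace (TotalSpace F V)]
  [∀ x, AddCommGroup (V x)] [∀ x, Module 𝕜 (V x)]
  [∀ x, TopologicalSpace (V x)]
  [FiberBundle F V] [VectorBundle 𝕜 F V]

theorem contMDiffAt_mul_of_expansion {n : ℕ∞ω} [ContMDiffVectorBundle n F V I] {ι : Type*}
    [Fintype ι] {mul : ∀ x, V x →ₗ[𝕜] V x →ₗ[𝕜] V x} {L : ι → ∀ x, V x} {s t : ∀ x, V x}
    {c d : ι → M → 𝕜} {x : M} (hc : ∀ i, ContMDiffAt I 𝓘(𝕜, 𝕜) n (c i) x)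
    (hd : ∀ i, ContMDiffAt I 𝓘(𝕜, 𝕜) n (d i) x)
    (hs : ∀ᶠ y in 𝓝 x, s y = ∑ i, c i y • L i y) (ht : ∀ᶠ y in 𝓝 x, t y = ∑ i, d i y • L i y)
    (hL : ∀ i j, ContMDiffAt I (I.prod 𝓘(𝕜, F)) n
      (fun y => TotalSpace.mk' F y (mul y (L i y) (L j y))) x) :
    ContMDiffAt I (I.prod 𝓘(𝕜, F)) n (fun y => TotalSpace.mk' F y (mul y (s y) (t y))) x := by
  have h : ContMDiffAt I (I.prod 𝓘(𝕜, F)) n (fun y => TotalSpace.mk' F y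
      (∑ i, ∑ j, (c i y * d j y) • mul y (L i y) (L j y))) x :=
    .sum_section fun i _ => .sum_section fun j _ => ((hc i).mul (hd j)).smul_section (hL i j)
  refine h.congr_of_eventuallyEq ?_
  filter_upwards [hs, ht] with y h1 h2
  rw [h1, h2]
  simp only [map_sum, map_smul, LinearMap.sum_apply, LinearMap.smul_apply, Finset.smul_sum,
    mul_smul]
  exact congrArg _ (Finset.sum_comm.trans (Finset.sum_congr rfl fun i _ =>
    Finset.sum_congr rfl fun j _ => smul_comm _ _ _))

theorem mdifferentiableAt_mul_of_expansion [ContMDiffVectorBundle 1 F V I] {ι : Type*}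
    [Fintype ι] {mul : ∀ x, V x →ₗ[𝕜] V x →ₗ[𝕜] V x} {L : ι → ∀ x, V x} {s t : ∀ x, V x}
    {c d : ι → M → 𝕜} {x : M} (hc : ∀ i, MDifferentiableAt I 𝓘(𝕜, 𝕜) (c i) x)
    (hd : ∀ i, MDifferentiableAt I 𝓘(𝕜, 𝕜) (d i) x)
    (hs : ∀ᶠ y in 𝓝 x, s y = ∑ i, c i y • L i y) (ht : ∀ᶠ y in 𝓝 x, t y = ∑ i, d i y • L i y)
    (hL : ∀ i j, MDifferentiableAt I (I.prod 𝓘(𝕜, F))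
      (fun y => TotalSpace.mk' F y (mul y (L i y) (L j y))) x) :
    MDifferentiableAt I (I.prod 𝓘(𝕜, F)) (fun y => TotalSpace.mk' F y (mul y (s y) (t y))) x := by
  have h : MDifferentiableAt I (I.prod 𝓘(𝕜, F)) (fun y => TotalSpace.mk' F y
      (∑ i, ∑ j, (c i y * d j y) • mul y (L i y) (L j y))) x :=
    .sum_section fun i _ => .sum_section fun j _ => ((hc i).mul (hd j)).smul_section (hL i j)
  refine h.congr_of_eventuallyEq ?_
  filter_upwards [hs, ht] with y h1 h2
  rw [h1, h2]
  simp only [map_sum, map_smul, LinearMap.sum_apply, LinearMap.smul_apply, Finset.smul_sum,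
    mul_smul]
  exact congrArg _ (Finset.sum_comm.trans (Finset.sum_congr rfl fun i _ =>
    Finset.sum_congr rfl fun j _ => smul_comm _ _ _))

/-- The definition only speaks of C^∞ sections, while the tensoriality criterion tests sections
differentiable at one point. Expansion in a smooth local frame bridges the gap. -/
theorem IsMultiplication.mdifferentiableAt_mul [FiniteDimensional 𝕜 F]
    [ContMDiffVectorBundle ∞ F V I] {mul : ∀ x, V x →ₗ[𝕜] V x →ₗ[𝕜] V x} {e : ∀ x, V x}
    (h : IsMultiplication I F mul e) {s t : ∀ x, V x} {x : M}
    (hs : MDifferentiableAt I (I.prod 𝓘(𝕜, F)) (fun y => TotalSpace.mk' F y (s y)) x)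
    (ht : MDifferentiableAt I (I.prod 𝓘(𝕜, F)) (fun y => TotalSpace.mk' F y (t y)) x) :
    MDifferentiableAt I (I.prod 𝓘(𝕜, F)) (fun y => TotalSpace.mk' F y (mul y (s y) (t y))) x := by
  have : ContMDiffVectorBundle 1 F V I := .of_le (n := ∞) (by simp)
  let τ := trivializationAt F V x
  have hx : x ∈ τ.baseSet := FiberBundle.mem_baseSet_trivializationAt' x
  let b := Module.finBasis 𝕜 F
  refine mdifferentiableAt_mul_of_expansion
    (fun i => mdifferentiableAt_localFrameCoeff b hx hs i)
    (fun i => mdifferentiableAt_localFrameCoeff b hx ht i)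
    (τ.eventually_eq_localFrame_sum_coeff_smul b hx)
    (τ.eventually_eq_localFrame_sum_coeff_smul b hx) fun i j => ?_
  exact (h.contMDiff_mul τ.baseSet τ.open_baseSet _ _ (τ.contMDiffOn_localFrame_baseSet ∞ b i)
    (τ.contMDiffOn_localFrame_baseSet ∞ b j)).mdifferentiableAt τ.open_baseSet hx

end Multiplication

/-! ### Tensoriality of the F-manifold condition. -/

section LieDerivative

set_option linter.unusedSectionVars false

variable {𝕜 : Type*} [RCLike 𝕜]
  {E : Type*} [NormedAddCommGroup E] [NormedSpace 𝕜 E] [FiniteDimensional 𝕜 E]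
  {H : Type*} [TopologicalSpace H] {I : ModelWithCorners 𝕜 E H}
  {M : Type*} [TopologicalSpace M] [ChartedSpace H M] [IsManifold I ∞ M]
  {mul : ∀ x : M, TangentSpace I x →ₗ[𝕜] TangentSpace I x →ₗ[𝕜] TangentSpace I x}
  {e : ∀ x : M, TangentSpace I x}

theorem lieDerivMul_comm (h : IsMultiplication I E mul e) (X Z W : ∀ x : M, TangentSpace I x)
    (x : M) : lieDerivMul I mul X Z W x = lieDerivMul I mul X W Z x := by
  have h1 : (fun y => mul y (Z y) (W y)) = fun y => mul y (W y) (Z y) :=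
    funext fun y => h.comm y _ _
  rw [lieDerivMul, lieDerivMul, h1, h.comm x (mlieBracket I X Z x), h.comm x (Z x)]
  abel

/-- The derivative of f along X enters through [X, fZ∘W] and through [X, fZ]∘W with opposite signs.
-/
theorem tensorialAt_lieDerivMul (h : IsMultiplication I E mul e) {X W : ∀ x : M, TangentSpace I x}
    {x : M} (hW : MDifferentiableAt I (I.prod 𝓘(𝕜, E)) (fun y => TotalSpace.mk' E y (W y)) x) :
    TensorialAt I E (fun Z => lieDerivMul I mul X Z W x) x where
  smul {f Z} hf hZ := by
    have h1 : (fun y => mul y ((f • Z) y) (W y)) = f • fun y => mul y (Z y) (W y) :=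
      funext fun y => by simp
    have := FiniteDimensional.complete 𝕜 E
    simp only [lieDerivMul, h1]
    rw [mlieBracket_smul_right hf (h.mdifferentiableAt_mul hZ hW), mlieBracket_smul_right hf hZ]
    simp only [map_add, map_smul, LinearMap.add_apply, LinearMap.smul_apply, Pi.smul_apply',
      smul_sub]
    abel
  add {Z Z'} hZ hZ' := by
    have h1 : (fun y => mul y ((Z + Z') y) (W y))
        = (fun y => mul y (Z y) (W y)) + fun y => mul y (Z' y) (W y) :=
      funext fun y => by simp
    have := FiniteDimensional.complete 𝕜 E
    simp only [lieDerivMul, h1]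
    rw [mlieBracket_add_right (h.mdifferentiableAt_mul hZ hW) (h.mdifferentiableAt_mul hZ' hW),
      mlieBracket_add_right hZ hZ']
    simp only [map_add, LinearMap.add_apply, Pi.add_apply]
    abel

/-- The Lie derivative of a multiplication is a tensor in its arguments. -/
theorem lieDerivMul_congr (h : IsMultiplication I E mul e) {X Z W Z' W' : ∀ x : M, TangentSpace I x}
    {x : M} (hZ : MDifferentiableAt I (I.prod 𝓘(𝕜, E)) (fun y => TotalSpace.mk' E y (Z y)) x)
    (hZ' : MDifferentiableAt I (I.prod 𝓘(𝕜, E)) (fun y => TotalSpace.mk' E y (Z' y)) x)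
    (hW : MDifferentiableAt I (I.prod 𝓘(𝕜, E)) (fun y => TotalSpace.mk' E y (W y)) x)
    (hW' : MDifferentiableAt I (I.prod 𝓘(𝕜, E)) (fun y => TotalSpace.mk' E y (W' y)) x)
    (hZZ : Z x = Z' x) (hWW : W x = W' x) :
    lieDerivMul I mul X Z W x = lieDerivMul I mul X Z' W' x := by
  have := FiniteDimensional.complete 𝕜 E
  refine TensorialAt.pointwise₂ (Φ := fun Z W => lieDerivMul I mul X Z W x)
    (fun W hW => tensorialAt_lieDerivMul h hW) (fun Z hZ => ?_) hZ hZ' hW hW' hZZ hWW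
  simp only [lieDerivMul_comm h X Z]
  exact tensorialAt_lieDerivMul h hZ

variable (I mul) in
/-- The defect of the integrability condition of an `F`-manifold. -/
def integrabilityDefect (X Y Z W : ∀ x : M, TangentSpace I x) (x : M) : TangentSpace I x :=
  lieDerivMul I mul (fun y => mul y (X y) (Y y)) Z W x
    - (mul x (X x) (lieDerivMul I mul Y Z W x) + mul x (Y x) (lieDerivMul I mul X Z W x))

theorem integrabilityDefect_comm (h : IsMultiplication I E mul e)
    (X Y Z W : ∀ x : M, TangentSpace I x) (x : M) :
    integrabilityDefect I mul X Y Z W x = integrabilityDefect I mul Y X Z W x := by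
  have h1 : (fun y => mul y (X y) (Y y)) = fun y => mul y (Y y) (X y) :=
    funext fun y => h.comm y _ _
  rw [integrabilityDefect, integrabilityDefect, h1, add_comm]

/-- The point is that the non-tensorial part is X multiplied by an expression not involving X; the
unit is needed to write X itself as such a multiple. -/
theorem lieDerivMul_smul_left (h : IsMultiplication I E mul e)
    {X Z W : ∀ x : M, TangentSpace I x} {f : M → 𝕜} {x : M}
    (hf : MDifferentiableAt I 𝓘(𝕜, 𝕜) f x)
    (hX : MDifferentiableAt I (I.prod 𝓘(𝕜, E)) (fun y => TotalSpace.mk' E y (X y)) x) :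
    lieDerivMul I mul (f • X) Z W x = f x • lieDerivMul I mul X Z W x
      + mul x (X x) (- mvfderiv I f x (mul x (Z x) (W x)) • e x + mvfderiv I f x (Z x) • W x
        + mvfderiv I f x (W x) • Z x) := by
  have := FiniteDimensional.complete 𝕜 E
  have hXe : mul x (X x) (e x) = X x := (h.comm x _ _).trans (h.unit_mul x _)
  simp only [lieDerivMul]
  rw [mlieBracket_smul_left hf hX, mlieBracket_smul_left hf hX, mlieBracket_smul_left hf hX]
  simp only [map_add, map_smul, LinearMap.add_apply, LinearMap.smul_apply, smul_sub, neg_smul,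
    map_neg, LinearMap.neg_apply, hXe, h.comm x (Z x) (X x)]
  abel

/-- By `lieDerivMul_smul_left`, replacing X by fX produces the same extra term, X∘Y times one
expression in f, Z, W, on both sides of the F-manifold identity. -/
theorem tensorialAt_integrabilityDefect (h : IsMultiplication I E mul e)
    {Y Z W : ∀ x : M, TangentSpace I x}
    {x : M} (hY : MDifferentiableAt I (I.prod 𝓘(𝕜, E)) (fun y => TotalSpace.mk' E y (Y y)) x) :
    TensorialAt I E (fun X => integrabilityDefect I mul X Y Z W x) x where
  smul {f X} hf hX := by
    have h1 : (fun y => mul y ((f • X) y) (Y y)) = f • fun y => mul y (X y) (Y y) :=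
      funext fun y => by simp
    simp only [integrabilityDefect, h1]
    rw [lieDerivMul_smul_left h hf (h.mdifferentiableAt_mul hX hY), lieDerivMul_smul_left h hf hX,
      h.comm x (X x) (Y x), h.assoc]
    simp only [map_add, map_smul, LinearMap.smul_apply, Pi.smul_apply', smul_sub, smul_add]
    abel
  add {X X'} hX hX' := by
    have h1 : (fun y => mul y ((X + X') y) (Y y))
        = (fun y => mul y (X y) (Y y)) + fun y => mul y (X' y) (Y y) :=
      funext fun y => by simp
    have := FiniteDimensional.complete 𝕜 E
    simp only [integrabilityDefect, lieDerivMul, h1]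
    rw [mlieBracket_add_left (h.mdifferentiableAt_mul hX hY) (h.mdifferentiableAt_mul hX' hY),
      mlieBracket_add_left (h.mdifferentiableAt_mul hX hY) (h.mdifferentiableAt_mul hX' hY),
      mlieBracket_add_left (h.mdifferentiableAt_mul hX hY) (h.mdifferentiableAt_mul hX' hY),
      mlieBracket_add_left hX hX', mlieBracket_add_left hX hX', mlieBracket_add_left hX hX']
    simp only [map_add, map_sub, LinearMap.add_apply, Pi.add_apply]
    abel

/-- The defect of the integrability condition is a tensor. -/
theorem integrabilityDefect_congr (h : IsMultiplication I E mul e)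
    {X Y Z W X' Y' Z' W' : ∀ x : M, TangentSpace I x} {x : M}
    (hX : MDifferentiableAt I (I.prod 𝓘(𝕜, E)) (fun y => TotalSpace.mk' E y (X y)) x)
    (hX' : MDifferentiableAt I (I.prod 𝓘(𝕜, E)) (fun y => TotalSpace.mk' E y (X' y)) x)
    (hY : MDifferentiableAt I (I.prod 𝓘(𝕜, E)) (fun y => TotalSpace.mk' E y (Y y)) x)
    (hY' : MDifferentiableAt I (I.prod 𝓘(𝕜, E)) (fun y => TotalSpace.mk' E y (Y' y)) x)
    (hZ : MDifferentiableAt I (I.prod 𝓘(𝕜, E)) (fun y => TotalSpace.mk' E y (Z y)) x)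
    (hZ' : MDifferentiableAt I (I.prod 𝓘(𝕜, E)) (fun y => TotalSpace.mk' E y (Z' y)) x)
    (hW : MDifferentiableAt I (I.prod 𝓘(𝕜, E)) (fun y => TotalSpace.mk' E y (W y)) x)
    (hW' : MDifferentiableAt I (I.prod 𝓘(𝕜, E)) (fun y => TotalSpace.mk' E y (W' y)) x)
    (hXX : X x = X' x) (hYY : Y x = Y' x) (hZZ : Z x = Z' x) (hWW : W x = W' x) :
    integrabilityDefect I mul X Y Z W x = integrabilityDefect I mul X' Y' Z' W' x := by
  have h1 : integrabilityDefect I mul X Y Z W x = integrabilityDefect I mul X' Y' Z W x := by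
    refine TensorialAt.pointwise₂ (Φ := fun X Y => integrabilityDefect I mul X Y Z W x)
      (fun Y hY => tensorialAt_integrabilityDefect h hY) (fun X hX => ?_) hX hX' hY hY' hXX hYY
    simp only [integrabilityDefect_comm h X]
    exact tensorialAt_integrabilityDefect h hX
  rw [h1]
  simp only [integrabilityDefect]
  rw [lieDerivMul_congr h hZ hZ' hW hW' hZZ hWW, lieDerivMul_congr h hZ hZ' hW hW' hZZ hWW,
    lieDerivMul_congr h hZ hZ' hW hW' hZZ hWW]

end LieDerivative

/-! ### The multiplication on the total space. -/

section TotalMultiplication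

set_option linter.unusedSectionVars false

variable {𝕜 : Type*} [RCLike 𝕜]
  {E : Type*} [NormedAddCommGroup E] [NormedSpace 𝕜 E] [FiniteDimensional 𝕜 E]
  {H : Type*} [TopologicalSpace H] {I : ModelWithCorners 𝕜 E H}
  {M : Type*} [TopologicalSpace M] [ChartedSpace H M]
  {F : Type*} [NormedAddCommGroup F] [NormedSpace 𝕜 F]
  {V : M → Type*} [TopologicalSpace (TotalSpace F V)]
  [∀ x, AddCommGroup (V x)] [∀ x, Module 𝕜 (V x)]
  [∀ x, TopologicalSpace (V x)] [∀ x, IsTopologicalAddGroup (V x)]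
  [∀ x, ContinuousSMul 𝕜 (V x)] [FiberBundle F V] [VectorBundle 𝕜 F V]
  [IsManifold I ∞ M] [ContMDiffVectorBundle ∞ F V I] [FiniteDimensional 𝕜 F]
  {D : CovariantDerivative I F V}
  {mulM : ∀ x : M, TangentSpace I x →ₗ[𝕜] TangentSpace I x →ₗ[𝕜] TangentSpace I x}
  {eM : ∀ x : M, TangentSpace I x}
  {mulV : ∀ x, V x →ₗ[𝕜] V x →ₗ[𝕜] V x} {eV : ∀ x, V x}
  {α : ∀ x, V x →ₗ[𝕜] TangentSpace I x}

theorem IsSectionOn.add {U : Set M} {s t : ∀ x, V x} (hs : IsSectionOn I F U s)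
    (ht : IsSectionOn I F U t) : IsSectionOn I F U (fun x => s x + t x) :=
  ContMDiffOn.add_section hs ht

theorem IsSectionOn.zero {U : Set M} : IsSectionOn I F U (fun x => (0 : V x)) :=
  (contMDiff_zeroSection 𝕜 V).contMDiffOn

theorem IsSectionOn.map_morphism (hα : ContMDiff (I.prod 𝓘(𝕜, F)) (I.prod 𝓘(𝕜, E)) ∞
      (fun v : TotalSpace F V => (⟨v.proj, α v.proj v.2⟩ : TangentBundle I M)))
    {U : Set M} {s : ∀ x, V x} (hs : IsSectionOn I F U s) :
    IsSectionOn I E U (fun x => α x (s x)) :=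
  hα.comp_contMDiffOn hs

-- Lifts are closed under multiplication, so the bracket formula for lifts applies again to their
-- products.
variable (D mulM mulV α) in
theorem totalMul_liftField (X Y : ∀ x : M, TangentSpace I x) (a b : ∀ x, V x)
    (v : TotalSpace F V) :
    totalMul D mulM mulV α v (liftField D X a v) (liftField D Y b v)
      = liftField D (fun x => mulM x (X x) (Y x) + mulM x (α x (a x)) (Y x)
          + mulM x (α x (b x)) (X x)) (fun x => mulV x (a x) (b x)) v := by
  simp only [liftField, map_add, LinearMap.add_apply, totalMul_horizontal_horizontal,
    totalMul_vertical_vertical, totalMul_vertical_horizontal, totalMul_horizontal_vertical]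
  abel

theorem verticalField_eq_liftField (s : ∀ x, V x) :
    verticalField I s = liftField D (fun x => (0 : TangentSpace I x)) s := by
  funext v
  rw [liftField, map_zero, zero_add, verticalField]

/-- Every tangent vector of the total space is the value of a lift at that point. -/
theorem eq_liftField (v : TotalSpace F V) (ξ : TangentSpace (I.prod 𝓘(𝕜, F)) v)
    {X : ∀ x : M, TangentSpace I x} {a : ∀ x, V x} (hX : X v.proj = dproj I v ξ)
    (ha : a v.proj = verticalPart D v ξ) : ξ = liftField D X a v := by
  rw [liftField, hX, ha, horizontal_add_vertical]

theorem eq_sum_localFrame {ι : Type*} [Fintype ι]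
    (e : Trivialization F (TotalSpace.proj : TotalSpace F V → M)) [MemTrivializationAtlas e]
    (b : Module.Basis ι 𝕜 F) {x : M} (hx : x ∈ e.baseSet) (v : V x) :
    v = ∑ i, b.coord i (e (TotalSpace.mk' F x v)).2 • e.localFrame b i x := by
  refine ((e.basisAt b hx).sum_repr v).symm.trans (Finset.sum_congr rfl fun i _ => ?_)
  rw [e.localFrame_apply_of_mem_baseSet b hx]
  rfl

section Frame

variable {ι κ : Type*} (β : Module.Basis ι 𝕜 E) (γ : Module.Basis κ 𝕜 F) (p : M)

variable (I) in
/-- The horizontal components of the frame of lifts at `p`. -/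
def frameHorizontal (k : ι ⊕ κ) (x : M) : TangentSpace I x :=
  k.elim (fun i => (trivializationAt E (TangentSpace I) p).localFrame β i x) fun _ => 0

variable (V) in
/-- The vertical components of the frame of lifts at `p`. -/
def frameVertical (k : ι ⊕ κ) (x : M) : V x :=
  k.elim (fun _ => 0) fun j => (trivializationAt F V p).localFrame γ j x

theorem isSectionOn_frameHorizontal (k : ι ⊕ κ) :
    IsSectionOn I E (trivializationAt E (TangentSpace I) p).baseSet
      (frameHorizontal (κ := κ) I β p k) := by
  cases k with
  | inl i => exact (trivializationAt E (TangentSpace I) p).contMDiffOn_localFrame_baseSet ∞ β i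
  | inr j => exact IsSectionOn.zero

theorem isSectionOn_frameVertical (k : ι ⊕ κ) :
    IsSectionOn I F (trivializationAt F V p).baseSet (frameVertical (ι := ι) V γ p k) := by
  cases k with
  | inl i => exact IsSectionOn.zero
  | inr j => exact (trivializationAt F V p).contMDiffOn_localFrame_baseSet ∞ γ j

/-- A smooth vector field on the total space is a combination of lifts of frames, with smooth
coefficients. -/
theorem exists_expansion_liftField [Fintype ι] [Fintype κ] (hD : IsSmoothConnection D)
    {ξ : ∀ w : TotalSpace F V, TangentSpace (I.prod 𝓘(𝕜, F)) w} {v : TotalSpace F V}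
    (hξ : ContMDiffAt (I.prod 𝓘(𝕜, F)) ((I.prod 𝓘(𝕜, F)).prod 𝓘(𝕜, E × F)) ∞
      (fun w => TotalSpace.mk' (E × F) w (ξ w)) v) :
    ∃ c : ι ⊕ κ → TotalSpace F V → 𝕜,
      (∀ k, ContMDiffAt (I.prod 𝓘(𝕜, F)) 𝓘(𝕜, 𝕜) ∞ (c k) v) ∧
      ∀ᶠ w in 𝓝 v, ξ w = ∑ k, c k w • liftField D (frameHorizontal I β v.proj k)
        (frameVertical V γ v.proj k) w := by
  set e := trivializationAt F V v.proj with he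
  set τ := trivializationAt E (TangentSpace I) v.proj with hτ
  have hve : v.proj ∈ e.baseSet := FiberBundle.mem_baseSet_trivializationAt' _
  have hvτ : v.proj ∈ τ.baseSet := FiberBundle.mem_baseSet_trivializationAt' _
  have hproj : ContMDiffAt (I.prod 𝓘(𝕜, F)) I ∞ (fun w : TotalSpace F V => w.proj) v :=
    contMDiffAt_proj V
  have h0 := contMDiffAt_vectorField_iff.1 hξ
  let g : TotalSpace F V → E := fun w =>
    (mvfderiv (I.prod 𝓘(𝕜, F)) (extChartAt (I.prod 𝓘(𝕜, F)) v) w (ξ w)).1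
  let f : TotalSpace F V → F := fun w =>
    (mvfderiv (I.prod 𝓘(𝕜, F)) (extChartAt (I.prod 𝓘(𝕜, F)) v) w (ξ w)).2
  have hg : ContMDiffAt (I.prod 𝓘(𝕜, F)) 𝓘(𝕜, E) ∞ g v :=
    (contDiff_fst.contMDiff.contMDiffAt).comp v h0
  have hf : ContMDiffAt (I.prod 𝓘(𝕜, F)) 𝓘(𝕜, F) ∞ f v :=
    (contDiff_snd.contMDiff.contMDiffAt).comp v h0
  have hgf : ∀ w : TotalSpace F V, w.proj ∈ e.baseSet → w.proj ∈ τ.baseSet →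
      g w = (τ (TotalSpace.mk' E w.proj (dproj I w (ξ w)))).2 ∧
      f w = mvfderiv (I.prod 𝓘(𝕜, F)) (fun w : TotalSpace F V => (e w).2) w (ξ w) := by
    intro w hw hw'
    have h1 := mvfderiv_extChartAt_totalSpace v w hw hw' (ξ w)
    refine ⟨?_, congrArg Prod.snd h1⟩
    refine (congrArg Prod.fst h1).trans ?_
    have h2 := TangentBundle.continuousLinearMapAt_trivializationAt (I := I) hw'
    have h3 := τ.continuousLinearMapAt_apply_of_mem (R := 𝕜) hw' (dproj I w (ξ w))
    exact (congrArg (fun L : E →L[𝕜] E => L (dproj I w (ξ w))) h2).symm.trans h3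
  have hUe := e.open_baseSet.inter τ.open_baseSet
  let A : κ → ι → TotalSpace F V → F := fun j i w =>
    connectionForm D e (γ j) w.proj (τ.localFrame β i w.proj)
  -- The coordinate of the vertical part: the derivative of the fiber coordinate along `ξ`, with the
  -- connection form of the horizontal part added back. It is expanded in both bases so that
  -- smoothness is visible.
  let a : TotalSpace F V → F := fun w =>
    f w + ∑ j, γ.coord j (e w).2 • ∑ i, β.coord i (g w) • A j i w
  have hA : ∀ j i, ContMDiffAt (I.prod 𝓘(𝕜, F)) 𝓘(𝕜, F) ∞ (A j i) v := by
    intro j i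
    have h := contMDiffOn_connectionForm (X := τ.localFrame β i) e hD hUe Set.inter_subset_left
      (IsSectionOn.mono (τ.contMDiffOn_localFrame_baseSet ∞ β i) Set.inter_subset_right) (γ j)
    exact (h.contMDiffAt (hUe.mem_nhds ⟨hve, hvτ⟩)).comp v hproj
  have hcg : ∀ i, ContMDiffAt (I.prod 𝓘(𝕜, F)) 𝓘(𝕜, 𝕜) ∞ (fun w => β.coord i (g w)) v :=
    fun i => ((LinearMap.toContinuousLinearMap (β.coord i)).contDiff.contMDiff.contMDiffAt).comp v hg
  have hce : ∀ j, ContMDiffAt (I.prod 𝓘(𝕜, F)) 𝓘(𝕜, 𝕜) ∞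
      (fun w : TotalSpace F V => γ.coord j (e w).2) v := fun j =>
    ((LinearMap.toContinuousLinearMap (γ.coord j)).contDiff.contMDiff.contMDiffAt).comp v
      (contMDiffAt_fiberCoord e ⊤ hve)
  have ha : ContMDiffAt (I.prod 𝓘(𝕜, F)) 𝓘(𝕜, F) ∞ a v := by
    refine hf.add (ContMDiffAt.sum fun j _ => ?_)
    have h : ContMDiffAt (I.prod 𝓘(𝕜, F)) 𝓘(𝕜, F) ∞
        (fun w => ∑ i, β.coord i (g w) • A j i w) v :=
      ContMDiffAt.sum fun i _ => (hcg i).smul (hA j i)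
    exact (hce j).smul h
  refine ⟨fun k w => k.elim (fun i => β.coord i (g w)) fun j => γ.coord j (a w), ?_, ?_⟩
  · rintro (i | j)
    · exact hcg i
    · exact ((LinearMap.toContinuousLinearMap (γ.coord j)).contDiff.contMDiff.contMDiffAt).comp v ha
  · filter_upwards [(isOpen_proj_preimage hUe).mem_nhds ⟨hve, hvτ⟩] with w hw
    obtain ⟨h1, h2⟩ := hgf w hw.1 hw.2
    have hX : dproj I w (ξ w) = ∑ i, β.coord i (g w) • τ.localFrame β i w.proj := by
      rw [h1]
      exact eq_sum_localFrame τ β hw.2 _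
    have ha' : a w = (e (TotalSpace.mk' F w.proj (verticalPart D w (ξ w)))).2 := by
      have h3 := mvfderiv_fiberCoord_add D e w hw.1 (dproj I w (ξ w)) (verticalPart D w (ξ w))
      rw [horizontal_add_vertical, ← h2, connectionForm_eq_sum D e γ hw.1] at h3
      refine Eq.trans ?_ (sub_eq_iff_eq_add.1 h3.symm).symm
      refine congrArg (f w + ·) ?_
      rw [sum_apply]
      refine Finset.sum_congr rfl fun j _ => ?_
      rw [smul_apply, hX, map_sum]
      simp only [map_smul]
      rfl
    have hY : verticalPart D w (ξ w) = ∑ j, γ.coord j (a w) • e.localFrame γ j w.proj := by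
      rw [ha']
      exact eq_sum_localFrame e γ hw.1 _
    rw [Fintype.sum_sum_type]
    simp only [liftField, frameHorizontal, frameVertical, Sum.elim_inl, Sum.elim_inr, map_zero,
      add_zero, zero_add, ← he, ← hτ, ← map_smul, ← map_sum]
    rw [← hX, ← hY, horizontal_add_vertical]

end Frame

/-- Smoothness is checked on a local frame of lifts, whose products are lifts of smooth sections.
Associativity of mixed products with two vertical factors is the multiplicativity of α, and the unit
law on horizontal lifts is α(e_V) = e_M. -/
theorem isMultiplication_totalMul (hD : IsSmoothConnection D) (hM : IsMultiplication I E mulM eM)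
    (hV : IsMultiplication I F mulV eV)
    (hα : ContMDiff (I.prod 𝓘(𝕜, F)) (I.prod 𝓘(𝕜, E)) ∞
      (fun v : TotalSpace F V => (⟨v.proj, α v.proj v.2⟩ : TangentBundle I M)))
    (hα_mul : ∀ x (a b : V x), α x (mulV x a b) = mulM x (α x a) (α x b))
    (hα_unit : ∀ x, α x (eV x) = eM x) :
    IsMultiplication (I.prod 𝓘(𝕜, F)) (E × F) (totalMul D mulM mulV α) (verticalField I eV) where
  contMDiff_mul := by
    intro W hW ξ η hξ hη v hv
    refine ContMDiffAt.contMDiffWithinAt ?_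
    have hb := FiberBundle.mem_baseSet_trivializationAt' (F := F) (E := V) v.proj
    have hb' := FiberBundle.mem_baseSet_trivializationAt' (F := E) (E := TangentSpace I) v.proj
    let β := Module.finBasis 𝕜 E
    let γ := Module.finBasis 𝕜 F
    obtain ⟨c, hc, hcξ⟩ := exists_expansion_liftField β γ hD
      (ContMDiffOn.contMDiffAt hξ (hW.mem_nhds hv))
    obtain ⟨d, hd, hdη⟩ := exists_expansion_liftField β γ hD
      (ContMDiffOn.contMDiffAt hη (hW.mem_nhds hv))
    refine contMDiffAt_mul_of_expansion hc hd hcξ hdη fun k l => ?_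
    simp only [totalMul_liftField]
    have hU := (trivializationAt F V v.proj).open_baseSet.inter
      (trivializationAt E (TangentSpace I) v.proj).open_baseSet
    have h1 := fun k => (isSectionOn_frameHorizontal (I := I) (κ := Fin (Module.finrank 𝕜 F))
      β v.proj k).mono
      (Set.inter_subset_right (s := (trivializationAt F V v.proj).baseSet))
    have h2 := fun k => (isSectionOn_frameVertical (I := I) (V := V)
      (ι := Fin (Module.finrank 𝕜 E)) γ v.proj k).mono
      (Set.inter_subset_left (t := (trivializationAt E (TangentSpace I) v.proj).baseSet))
    refine ContMDiffOn.contMDiffAt (isSectionOn_liftField hD hU (((hM.contMDiff_mul _ hU _ _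
      (h1 k) (h1 l)).add (hM.contMDiff_mul _ hU _ _ ((h2 k).map_morphism hα) (h1 l))).add
      (hM.contMDiff_mul _ hU _ _ ((h2 l).map_morphism hα) (h1 k)))
      (hV.contMDiff_mul _ hU _ _ (h2 k) (h2 l))) ((isOpen_proj_preimage hU).mem_nhds ⟨hb, hb'⟩)
  contMDiff_unit := by
    rw [verticalField_eq_liftField (D := D)]
    exact isSectionOn_liftField hD isOpen_univ IsSectionOn.zero hV.contMDiff_unit
  comm := by
    intro v ξ η
    rw [← horizontal_add_vertical D v ξ, ← horizontal_add_vertical D v η]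
    simp only [map_add, LinearMap.add_apply, totalMul_horizontal_horizontal,
      totalMul_vertical_vertical, totalMul_vertical_horizontal, totalMul_horizontal_vertical,
      hM.comm v.proj (dproj I v ξ), hV.comm v.proj (verticalPart D v ξ)]
    abel
  assoc := by
    intro v ξ η ζ
    -- Left commutativity, used to bring the triple products into a common order.
    have hc : ∀ X Y Z : TangentSpace I v.proj, mulM v.proj X (mulM v.proj Y Z)
        = mulM v.proj Y (mulM v.proj X Z) := fun X Y Z => by
      rw [← hM.assoc, hM.comm v.proj X, hM.assoc]
    rw [← horizontal_add_vertical D v ξ, ← horizontal_add_vertical D v η,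
      ← horizontal_add_vertical D v ζ]
    generalize dproj I v ξ = X
    generalize dproj I v η = Y
    generalize dproj I v ζ = Z
    simp only [map_add, LinearMap.add_apply, totalMul_horizontal_horizontal,
      totalMul_vertical_vertical, totalMul_vertical_horizontal, totalMul_horizontal_vertical,
      hα_mul, hM.assoc, hV.assoc]
    rw [hc (α v.proj (verticalPart D v ζ)) (α v.proj (verticalPart D v ξ)),
      hc (α v.proj (verticalPart D v ζ)) (α v.proj (verticalPart D v η)),
      hc X (α v.proj (verticalPart D v η)), hc X (α v.proj (verticalPart D v ζ))]
  unit_mul := by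
    intro v ξ
    rw [← horizontal_add_vertical D v ξ, verticalField]
    simp only [map_add, totalMul_vertical_vertical, totalMul_vertical_horizontal, hα_unit,
      hM.unit_mul, hV.unit_mul]

end TotalMultiplication

/-! ### The F-manifold identity evaluated on lifts. -/

section LieDerivativeOfLifts

set_option linter.unusedSectionVars false

variable {𝕜 : Type*} [RCLike 𝕜]
  {E : Type*} [NormedAddCommGroup E] [NormedSpace 𝕜 E] [FiniteDimensional 𝕜 E]
  {H : Type*} [TopologicalSpace H] {I : ModelWithCorners 𝕜 E H} [I.Boundaryless]
  {M : Type*} [TopologicalSpace M] [ChartedSpace H M]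
  {F : Type*} [NormedAddCommGroup F] [NormedSpace 𝕜 F]
  {V : M → Type*} [TopologicalSpace (TotalSpace F V)]
  [∀ x, AddCommGroup (V x)] [∀ x, Module 𝕜 (V x)]
  [∀ x, TopologicalSpace (V x)] [∀ x, IsTopologicalAddGroup (V x)]
  [∀ x, ContinuousSMul 𝕜 (V x)] [FiberBundle F V] [VectorBundle 𝕜 F V]
  [IsManifold I ∞ M] [ContMDiffVectorBundle ∞ F V I] [FiniteDimensional 𝕜 F]
  {D : CovariantDerivative I F V}
  {mulM : ∀ x : M, TangentSpace I x →ₗ[𝕜] TangentSpace I x →ₗ[𝕜] TangentSpace I x}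
  {eM : ∀ x : M, TangentSpace I x}
  {mulV : ∀ x, V x →ₗ[𝕜] V x →ₗ[𝕜] V x} {eV : ∀ x, V x}
  {α : ∀ x, V x →ₗ[𝕜] TangentSpace I x}

variable (mulM α) in
/-- The horizontal component of the product of two lifts. -/
def horizontalMul (X : ∀ x : M, TangentSpace I x) (a : ∀ x, V x) (Y : ∀ x : M, TangentSpace I x)
    (b : ∀ x, V x) (x : M) : TangentSpace I x :=
  mulM x (X x) (Y x) + mulM x (α x (a x)) (Y x) + mulM x (α x (b x)) (X x)

variable (D) in
/-- The vertical component of the Lie bracket of two lifts, at the points of the section `s`. -/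
def verticalBracket (s : ∀ x, V x) (X : ∀ x : M, TangentSpace I x) (a : ∀ x, V x)
    (Y : ∀ x : M, TangentSpace I x) (b : ∀ x, V x) (x : M) : V x :=
  D b x (X x) - D a x (Y x) - curvature D X Y s x

theorem isSectionOn_horizontalMul (hM : IsMultiplication I E mulM eM)
    (hα : ContMDiff (I.prod 𝓘(𝕜, F)) (I.prod 𝓘(𝕜, E)) ∞
      (fun v : TotalSpace F V => (⟨v.proj, α v.proj v.2⟩ : TangentBundle I M)))
    {U : Set M} (hU : IsOpen U) {X Y : ∀ x : M, TangentSpace I x} {a b : ∀ x, V x}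
    (hX : IsSectionOn I E U X) (ha : IsSectionOn I F U a) (hY : IsSectionOn I E U Y)
    (hb : IsSectionOn I F U b) : IsSectionOn I E U (horizontalMul mulM α X a Y b) :=
  ((hM.contMDiff_mul _ hU _ _ hX hY).add (hM.contMDiff_mul _ hU _ _ (ha.map_morphism hα) hY)).add
    (hM.contMDiff_mul _ hU _ _ (hb.map_morphism hα) hX)

variable (D mulM α) in
/-- The horizontal component of the Lie derivative of the multiplication along a lift, at the
points of the section `s`. -/
def horizontalLieDeriv (s : ∀ x, V x) (X : ∀ x : M, TangentSpace I x) (a : ∀ x, V x)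
    (Y : ∀ x : M, TangentSpace I x) (b : ∀ x, V x) (Z : ∀ x : M, TangentSpace I x) (c : ∀ x, V x)
    (x : M) : TangentSpace I x :=
  mlieBracket I X (horizontalMul mulM α Y b Z c) x
    - horizontalMul mulM α (mlieBracket I X Y) (verticalBracket D s X a Y b) Z c x
    - horizontalMul mulM α Y b (mlieBracket I X Z) (verticalBracket D s X a Z c) x

variable (D mulM mulV α) in
/-- The vertical component of the Lie derivative of the multiplication along a lift, at the
points of the section `s`. -/
def verticalLieDeriv (s : ∀ x, V x) (X : ∀ x : M, TangentSpace I x) (a : ∀ x, V x)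
    (Y : ∀ x : M, TangentSpace I x) (b : ∀ x, V x) (Z : ∀ x : M, TangentSpace I x) (c : ∀ x, V x)
    (x : M) : V x :=
  verticalBracket D s X a (horizontalMul mulM α Y b Z c) (fun y => mulV y (b y) (c y)) x
    - mulV x (verticalBracket D s X a Y b x) (c x) - mulV x (b x) (verticalBracket D s X a Z c x)

/-- Each bracket involved is one of lifts, known at the points of `s`; the outer products are
pointwise, so it does not matter that the vertical part of a bracket depends on `s`. -/
theorem lieDerivMul_liftField (hD : IsSmoothConnection D) (hM : IsMultiplication I E mulM eM)
    (hV : IsMultiplication I F mulV eV)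
    (hα : ContMDiff (I.prod 𝓘(𝕜, F)) (I.prod 𝓘(𝕜, E)) ∞
      (fun v : TotalSpace F V => (⟨v.proj, α v.proj v.2⟩ : TangentBundle I M)))
    {U : Set M} (hU : IsOpen U) {X Y Z : ∀ x : M, TangentSpace I x} {a b c s : ∀ x, V x}
    (hX : IsSectionOn I E U X) (ha : IsSectionOn I F U a) (hY : IsSectionOn I E U Y)
    (hb : IsSectionOn I F U b) (hZ : IsSectionOn I E U Z) (hc : IsSectionOn I F U c)
    (hs : IsSectionOn I F U s) {x : M} (hx : x ∈ U) :
    lieDerivMul (I.prod 𝓘(𝕜, F)) (totalMul D mulM mulV α) (liftField D X a) (liftField D Y b)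
        (liftField D Z c) (TotalSpace.mk' F x (s x))
      = liftField D (horizontalLieDeriv D mulM α s X a Y b Z c)
        (verticalLieDeriv D mulM mulV α s X a Y b Z c) (TotalSpace.mk' F x (s x)) := by
  have := FiniteDimensional.complete 𝕜 E
  have h1 : (fun w : TotalSpace F V => totalMul D mulM mulV α w (liftField D Y b w)
      (liftField D Z c w)) = liftField D (horizontalMul mulM α Y b Z c)
        (fun y => mulV y (b y) (c y)) :=
    funext fun w => totalMul_liftField D mulM mulV α Y Z b c w
  have hYZ := isSectionOn_horizontalMul hM hα hU hY hb hZ hc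
  have hbc := hV.contMDiff_mul _ hU _ _ hb hc
  rw [lieDerivMul, h1, mlieBracket_liftField hD hU hX hYZ ha hbc hs hx,
    mlieBracket_liftField hD hU hX hY ha hb hs hx, mlieBracket_liftField hD hU hX hZ ha hc hs hx,
    totalMul_liftField, totalMul_liftField]
  have hsub : ∀ (H₁ H₂ H₃ : TangentSpace I x) (v₁ v₂ v₃ : V x),
      horizontalLift D (TotalSpace.mk' F x (s x)) H₁ + verticalLift I (TotalSpace.mk' F x (s x)) v₁
        - (horizontalLift D (TotalSpace.mk' F x (s x)) H₂
          + verticalLift I (TotalSpace.mk' F x (s x)) v₂)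
        - (horizontalLift D (TotalSpace.mk' F x (s x)) H₃
          + verticalLift I (TotalSpace.mk' F x (s x)) v₃)
      = horizontalLift D (TotalSpace.mk' F x (s x)) (H₁ - H₂ - H₃)
        + verticalLift I (TotalSpace.mk' F x (s x)) (v₁ - v₂ - v₃) := by
    intro H₁ H₂ H₃ v₁ v₂ v₃
    rw [map_sub, map_sub, map_sub, map_sub]
    abel
  exact hsub _ _ _ _ _ _

variable (D) in
theorem horizontalLift_add_verticalLift_eq_iff (v : TotalSpace F V)
    (H₁ H₂ H₃ : TangentSpace I v.proj) (v₁ v₂ v₃ : V v.proj) :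
    horizontalLift D v H₁ + verticalLift I v v₁ = (horizontalLift D v H₂ + verticalLift I v v₂)
      + (horizontalLift D v H₃ + verticalLift I v v₃) ↔ H₁ = H₂ + H₃ ∧ v₁ = v₂ + v₃ := by
  constructor
  · intro h
    have h2 := congrArg (dproj I v) h
    have h3 := congrArg (verticalPart D v) h
    simp only [map_add, dproj_horizontalLift, dproj_verticalLift, verticalPart_horizontalLift,
      verticalPart_verticalLift, add_zero, zero_add] at h2 h3
    exact ⟨h2, h3⟩
  · rintro ⟨rfl, rfl⟩
    rw [map_add, map_add]
    abel

/-- The integrability condition of the total space, evaluated on lifts. -/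
theorem integrabilityDefect_liftField_eq_zero_iff (hD : IsSmoothConnection D)
    (hM : IsMultiplication I E mulM eM) (hV : IsMultiplication I F mulV eV)
    (hα : ContMDiff (I.prod 𝓘(𝕜, F)) (I.prod 𝓘(𝕜, E)) ∞
      (fun v : TotalSpace F V => (⟨v.proj, α v.proj v.2⟩ : TangentBundle I M)))
    {U : Set M} (hU : IsOpen U) {X Y Z W : ∀ x : M, TangentSpace I x} {a b c d s : ∀ x, V x}
    (hX : IsSectionOn I E U X) (ha : IsSectionOn I F U a) (hY : IsSectionOn I E U Y)
    (hb : IsSectionOn I F U b) (hZ : IsSectionOn I E U Z) (hc : IsSectionOn I F U c)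
    (hW : IsSectionOn I E U W) (hd : IsSectionOn I F U d)
    (hs : IsSectionOn I F U s) {x : M} (hx : x ∈ U) :
    integrabilityDefect (I.prod 𝓘(𝕜, F)) (totalMul D mulM mulV α) (liftField D X a)
        (liftField D Y b) (liftField D Z c) (liftField D W d) (TotalSpace.mk' F x (s x)) = 0 ↔
      horizontalLieDeriv D mulM α s (horizontalMul mulM α X a Y b) (fun y => mulV y (a y) (b y))
          Z c W d x
        = horizontalMul mulM α X a (horizontalLieDeriv D mulM α s Y b Z c W d)
            (verticalLieDeriv D mulM mulV α s Y b Z c W d) x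
          + horizontalMul mulM α Y b (horizontalLieDeriv D mulM α s X a Z c W d)
            (verticalLieDeriv D mulM mulV α s X a Z c W d) x ∧
      verticalLieDeriv D mulM mulV α s (horizontalMul mulM α X a Y b)
          (fun y => mulV y (a y) (b y)) Z c W d x
        = mulV x (a x) (verticalLieDeriv D mulM mulV α s Y b Z c W d x)
          + mulV x (b x) (verticalLieDeriv D mulM mulV α s X a Z c W d x) := by
  have h1 : (fun w : TotalSpace F V => totalMul D mulM mulV α w (liftField D X a w)
      (liftField D Y b w)) = liftField D (horizontalMul mulM α X a Y b)
        (fun y => mulV y (a y) (b y)) :=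
    funext fun w => totalMul_liftField D mulM mulV α X Y a b w
  have hXY := isSectionOn_horizontalMul hM hα hU hX ha hY hb
  have hab := hV.contMDiff_mul _ hU _ _ ha hb
  rw [integrabilityDefect, h1, lieDerivMul_liftField hD hM hV hα hU hXY hab hZ hc hW hd hs hx,
    lieDerivMul_liftField hD hM hV hα hU hX ha hZ hc hW hd hs hx,
    lieDerivMul_liftField hD hM hV hα hU hY hb hZ hc hW hd hs hx,
    totalMul_liftField, totalMul_liftField, sub_eq_zero]
  exact horizontalLift_add_verticalLift_eq_iff D (TotalSpace.mk' F x (s x)) _ _ _ _ _ _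

end LieDerivativeOfLifts

/-! ### Necessity of the four conditions. -/

section Necessity

set_option linter.unusedSectionVars false

variable {𝕜 : Type*} [RCLike 𝕜]
  {E : Type*} [NormedAddCommGroup E] [NormedSpace 𝕜 E] [FiniteDimensional 𝕜 E]
  {H : Type*} [TopologicalSpace H] {I : ModelWithCorners 𝕜 E H} [I.Boundaryless]
  {M : Type*} [TopologicalSpace M] [ChartedSpace H M]
  {F : Type*} [NormedAddCommGroup F] [NormedSpace 𝕜 F]
  {V : M → Type*} [TopologicalSpace (TotalSpace F V)]
  [∀ x, AddCommGroup (V x)] [∀ x, Module 𝕜 (V x)]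
  [∀ x, TopologicalSpace (V x)] [∀ x, IsTopologicalAddGroup (V x)]
  [∀ x, ContinuousSMul 𝕜 (V x)] [FiberBundle F V] [VectorBundle 𝕜 F V]
  [IsManifold I ∞ M] [ContMDiffVectorBundle ∞ F V I] [FiniteDimensional 𝕜 F]
  {D : CovariantDerivative I F V}
  {mulM : ∀ x : M, TangentSpace I x →ₗ[𝕜] TangentSpace I x →ₗ[𝕜] TangentSpace I x}
  {eM : ∀ x : M, TangentSpace I x}
  {mulV : ∀ x, V x →ₗ[𝕜] V x →ₗ[𝕜] V x} {eV : ∀ x, V x}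
  {α : ∀ x, V x →ₗ[𝕜] TangentSpace I x}

variable (D) in
@[simp]
theorem covariantDerivative_zero (x : M) : D (fun y => (0 : V y)) x = 0 :=
  congrFun D.zero x

@[simp]
theorem mlieBracket_fun_zero_left (X : ∀ x : M, TangentSpace I x) :
    mlieBracket I (fun y => (0 : TangentSpace I y)) X = 0 :=
  mlieBracket_zero_left

@[simp]
theorem mlieBracket_fun_zero_right (X : ∀ x : M, TangentSpace I x) :
    mlieBracket I X (fun y => (0 : TangentSpace I y)) = 0 :=
  mlieBracket_zero_right

theorem IsMultiplication.mul_unit {mul : ∀ x, V x →ₗ[𝕜] V x →ₗ[𝕜] V x} {e : ∀ x, V x}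
    (h : IsMultiplication I F mul e) (x : M) (a : V x) : mul x a (e x) = a :=
  (h.comm x _ _).trans (h.unit_mul x a)

variable (I) in
theorem exists_isSectionOn {x : M} (v : V x) : ∃ U : Set M, IsOpen U ∧ x ∈ U ∧
    ∃ s : ∀ y, V y, IsSectionOn I F U s ∧ s x = v := by
  have hx := FiberBundle.mem_baseSet_trivializationAt' (F := F) (E := V) x
  exact ⟨_, (trivializationAt F V x).open_baseSet, hx, _,
    isSectionOn_const (trivializationAt F V x) (trivializationAt F V x (TotalSpace.mk' F x v)).2,
    (trivializationAt F V x).symm_apply_apply_mk hx v⟩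

/-- The Lie derivative of the multiplication along the unit field vanishes. -/
theorem lieDerivMul_unit {mul : ∀ x : M, TangentSpace I x →ₗ[𝕜] TangentSpace I x →ₗ[𝕜] TangentSpace I x}
    {e : ∀ x : M, TangentSpace I x} (h : IsFManifold I mul e) {U : Set M} (hU : IsOpen U)
    {Z W : ∀ x : M, TangentSpace I x} (hZ : IsSectionOn I E U Z) (hW : IsSectionOn I E U W)
    {x : M} (hx : x ∈ U) : lieDerivMul I mul e Z W x = 0 := by
  have he : IsSectionOn I E U e := h.isMultiplication.contMDiff_unit.mono (Set.subset_univ U)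
  have h1 := h.lieDeriv_mul U hU e e Z W he he hZ hW x hx
  simp only [h.isMultiplication.unit_mul] at h1
  simpa using h1

variable (mulM α) in
@[simp]
theorem horizontalMul_zero_zero (X Y : ∀ x : M, TangentSpace I x) :
    horizontalMul mulM α X (fun _ => (0 : V _)) Y (fun _ => 0) = fun x => mulM x (X x) (Y x) := by
  funext x; simp [horizontalMul]

variable (mulM α) in
@[simp]
theorem horizontalMul_zero_left (a : ∀ x, V x) (Y : ∀ x : M, TangentSpace I x) :
    horizontalMul mulM α (fun _ => 0) a Y (fun _ => 0) = fun x => mulM x (α x (a x)) (Y x) := by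
  funext x; simp [horizontalMul]

variable (mulM α) in
@[simp]
theorem horizontalMul_zero_right (X : ∀ x : M, TangentSpace I x) (b : ∀ x, V x) :
    horizontalMul mulM α X (fun _ => 0) (fun _ => 0) b = fun x => mulM x (α x (b x)) (X x) := by
  funext x; simp [horizontalMul]

variable (mulM α) in
@[simp]
theorem horizontalMul_vertical (a b : ∀ x, V x) :
    horizontalMul mulM α (fun _ => 0) a (fun _ => 0) b = fun _ => 0 := by
  funext x; simp [horizontalMul]

theorem horizontalMul_apply (X Y : ∀ x : M, TangentSpace I x) (a b : ∀ x, V x) (x : M) :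
    horizontalMul mulM α X a Y b x
      = mulM x (X x) (Y x) + mulM x (α x (a x)) (Y x) + mulM x (α x (b x)) (X x) := rfl

theorem integrability_liftField
    (hF : IsFManifold (I.prod 𝓘(𝕜, F)) (totalMul D mulM mulV α) (verticalField I eV))
    (hD : IsSmoothConnection D) (hM : IsMultiplication I E mulM eM)
    (hV : IsMultiplication I F mulV eV)
    (hα : ContMDiff (I.prod 𝓘(𝕜, F)) (I.prod 𝓘(𝕜, E)) ∞
      (fun v : TotalSpace F V => (⟨v.proj, α v.proj v.2⟩ : TangentBundle I M)))
    {U : Set M} (hU : IsOpen U) {X Y Z W : ∀ x : M, TangentSpace I x} {a b c d s : ∀ x, V x}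
    (hX : IsSectionOn I E U X) (ha : IsSectionOn I F U a) (hY : IsSectionOn I E U Y)
    (hb : IsSectionOn I F U b) (hZ : IsSectionOn I E U Z) (hc : IsSectionOn I F U c)
    (hW : IsSectionOn I E U W) (hd : IsSectionOn I F U d)
    (hs : IsSectionOn I F U s) {x : M} (hx : x ∈ U) :
      horizontalLieDeriv D mulM α s (horizontalMul mulM α X a Y b) (fun y => mulV y (a y) (b y))
          Z c W d x
        = horizontalMul mulM α X a (horizontalLieDeriv D mulM α s Y b Z c W d)
            (verticalLieDeriv D mulM mulV α s Y b Z c W d) x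
          + horizontalMul mulM α Y b (horizontalLieDeriv D mulM α s X a Z c W d)
            (verticalLieDeriv D mulM mulV α s X a Z c W d) x ∧
      verticalLieDeriv D mulM mulV α s (horizontalMul mulM α X a Y b)
          (fun y => mulV y (a y) (b y)) Z c W d x
        = mulV x (a x) (verticalLieDeriv D mulM mulV α s Y b Z c W d x)
          + mulV x (b x) (verticalLieDeriv D mulM mulV α s X a Z c W d x) := by
  refine (integrabilityDefect_liftField_eq_zero_iff hD hM hV hα hU hX ha hY hb hZ hc hW hd hs
    hx).1 ?_
  rw [integrabilityDefect, sub_eq_zero]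
  exact hF.lieDeriv_mul _ (isOpen_proj_preimage hU) _ _ _ _ (isSectionOn_liftField hD hU hX ha)
    (isSectionOn_liftField hD hU hY hb) (isSectionOn_liftField hD hU hZ hc)
    (isSectionOn_liftField hD hU hW hd) _ hx

/-- Test fields X~, e_M~, Y~, e_M~, vertical component at the points of s: the right side vanishes
since all vertical parts are zero, and on the left only −R(X,Y)s is left. -/
theorem isFlat_of_total
    (hF : IsFManifold (I.prod 𝓘(𝕜, F)) (totalMul D mulM mulV α) (verticalField I eV))
    (hD : IsSmoothConnection D) (hM : IsMultiplication I E mulM eM)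
    (hV : IsMultiplication I F mulV eV)
    (hα : ContMDiff (I.prod 𝓘(𝕜, F)) (I.prod 𝓘(𝕜, E)) ∞
      (fun v : TotalSpace F V => (⟨v.proj, α v.proj v.2⟩ : TangentBundle I M))) : IsFlat D := by
  intro U hU X Y s hX hY hs x hx
  have he : IsSectionOn I E U eM := hM.contMDiff_unit.mono (Set.subset_univ U)
  have h := (integrability_liftField
    hF hD hM hV hα hU hX .zero he .zero hY .zero he .zero hs hx).2
  simpa [verticalLieDeriv, verticalBracket, horizontalMul_apply, hM.mul_unit] using h

/-- The horizontal component for four horizontal lifts along the zero section. The vertical parts of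
the brackets are curvature terms and drop out. -/
theorem isFManifold_of_total
    (hF : IsFManifold (I.prod 𝓘(𝕜, F)) (totalMul D mulM mulV α) (verticalField I eV))
    (hD : IsSmoothConnection D) (hM : IsMultiplication I E mulM eM)
    (hV : IsMultiplication I F mulV eV)
    (hα : ContMDiff (I.prod 𝓘(𝕜, F)) (I.prod 𝓘(𝕜, E)) ∞
      (fun v : TotalSpace F V => (⟨v.proj, α v.proj v.2⟩ : TangentBundle I M)))
    (hflat : IsFlat D) : IsFManifold I mulM eM := by
  refine ⟨hM, fun U hU X Y Z W hX hY hZ hW x hx => ?_⟩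
  have h := (integrability_liftField
    hF hD hM hV hα hU hX .zero hY .zero hZ .zero hW .zero .zero hx).1
  have hR : ∀ {X Y : ∀ x : M, TangentSpace I x} , IsSectionOn I E U X → IsSectionOn I E U Y →
    curvature D X Y (fun _ => (0 : V _)) x = 0 := fun hX hY => hflat U hU _ _ _ hX hY .zero x hx
  have hXY := hM.contMDiff_mul U hU _ _ hX hY
  have hZW := hM.contMDiff_mul U hU _ _ hZ hW
  simpa [horizontalLieDeriv, verticalLieDeriv, verticalBracket, lieDerivMul,
    horizontalMul_apply, hR hXY hZ, hR hXY hW,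
    hR hX hZ, hR hX hW, hR hY hZ, hR hY hW, hR hX hZW, hR hY hZW] using h

/-- Test fields s, e_M~, Y~, Z~. The product of the first two is α(s)~, and the Lie derivative along
the parallel vertical field s contributes nothing. What remains equates the Lie derivative along
α(s) with α(s) times the one along e_M, and the latter is zero on an F-manifold. -/
theorem lieDerivMul_parallel_of_total
    (hF : IsFManifold (I.prod 𝓘(𝕜, F)) (totalMul D mulM mulV α) (verticalField I eV))
    (hD : IsSmoothConnection D) (hM : IsMultiplication I E mulM eM)
    (hV : IsMultiplication I F mulV eV)
    (hα : ContMDiff (I.prod 𝓘(𝕜, F)) (I.prod 𝓘(𝕜, E)) ∞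
      (fun v : TotalSpace F V => (⟨v.proj, α v.proj v.2⟩ : TangentBundle I M)))
    (hflat : IsFlat D) {U : Set M} (hU : IsOpen U) {s : ∀ x, V x}
    (hs : IsParallelOn D U s) {Y Z : ∀ x : M, TangentSpace I x} (hY : IsSectionOn I E U Y)
    (hZ : IsSectionOn I E U Z) {x : M} (hx : x ∈ U) :
    lieDerivMul I mulM (fun y => α y (s y)) Y Z x = 0 := by
  have he : IsSectionOn I E U eM := hM.contMDiff_unit.mono (Set.subset_univ U)
  have hR : ∀ {X Y : ∀ x : M, TangentSpace I x} , IsSectionOn I E U X → IsSectionOn I E U Y →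
    curvature D X Y (fun _ => (0 : V _)) x = 0 := fun hX hY => hflat U hU _ _ _ hX hY .zero x hx
  have h := (integrability_liftField
    hF hD hM hV hα hU .zero hs.1 he .zero hY .zero hZ .zero .zero hx).1
  have hYZ := hM.contMDiff_mul U hU _ _ hY hZ
  have hsE := hs.1.map_morphism hα
  have h0 := lieDerivMul_unit (isFManifold_of_total hF hD hM hV hα hflat) hU hY hZ hx
  have hc : ∀ X : ∀ x : M, TangentSpace I x,
    curvature D (fun y => 0) X (fun _ => (0 : V _)) x = 0 := by simp [curvature]
  simp [horizontalLieDeriv, verticalLieDeriv, verticalBracket, horizontalMul_apply, hM.mul_unit,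
    hR hsE hY, hR hsE hZ, hR he hY, hR he hZ, hR he hYZ, hs.2 x hx, hc] at h
  simp only [lieDerivMul] at h0 ⊢
  rw [h, ← map_sub, ← map_sub, h0, map_zero]

theorem parallel_of_total
    (hF : IsFManifold (I.prod 𝓘(𝕜, F)) (totalMul D mulM mulV α) (verticalField I eV))
    (hD : IsSmoothConnection D) (hM : IsMultiplication I E mulM eM)
    (hV : IsMultiplication I F mulV eV)
    (hα : ContMDiff (I.prod 𝓘(𝕜, F)) (I.prod 𝓘(𝕜, E)) ∞
      (fun v : TotalSpace F V => (⟨v.proj, α v.proj v.2⟩ : TangentBundle I M)))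
    (hflat : IsFlat D) {U : Set M} (hU : IsOpen U) {a b : ∀ x, V x}
    (ha : IsParallelOn D U a) (hb : IsParallelOn D U b) :
    IsParallelOn D U (fun x => mulV x (a x) (b x)) ∧
      ∀ x ∈ U, mlieBracket I (fun y => α y (a y)) (fun y => α y (b y)) x = 0 := by
  have he : IsSectionOn I E U eM := hM.contMDiff_unit.mono (Set.subset_univ U)
  have hR : ∀ {X Y : ∀ x : M, TangentSpace I x} {x : M}, IsSectionOn I E U X →
      IsSectionOn I E U Y → x ∈ U → curvature D X Y (fun _ => (0 : V _)) x = 0 :=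
    fun hX hY hx => hflat U hU _ _ _ hX hY .zero _ hx
  have hc : ∀ (X : ∀ x : M, TangentSpace I x) x,
    curvature D (fun y => 0) X (fun _ => (0 : V _)) x = 0 := by simp [curvature]
  have hc' : ∀ (X : ∀ x : M, TangentSpace I x) x,
    curvature D X (fun y => 0) (fun _ => (0 : V _)) x = 0 := by simp [curvature]
  refine ⟨⟨hV.contMDiff_mul U hU _ _ ha.1 hb.1, fun x hx => ?_⟩, fun x hx => ?_⟩
  · refine ContinuousLinearMap.ext fun X₀ => ?_
    obtain ⟨U', hU', hxU', X, hX, hXx⟩ := exists_isSectionOn (I := I) (F := E) X₀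
    -- Test fields X~, e_M~, a, b, vertical component: the right side is zero, and the left side is
    -- D_X(a∘b) because a and b are parallel.
    have h := (integrability_liftField hF hD hM hV hα (hU.inter hU')
      (hX.mono Set.inter_subset_right) .zero (he.mono Set.inter_subset_left) .zero .zero
      (ha.1.mono Set.inter_subset_left) .zero (hb.1.mono Set.inter_subset_left) .zero ⟨hx, hxU'⟩).2
    simp [verticalLieDeriv, verticalBracket, hM.mul_unit, ha.2 x hx, hb.2 x hx, hc'] at h
    rw [← hXx]
    exact h
  · have hae := ha.1.map_morphism hα
    have hbe := hb.1.map_morphism hα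
    -- Test fields a, e_M~, b, e_M~, horizontal component. It reduces to [α(a),α(b)] = 0 once the
    -- brackets of α(a) and α(b) with e_M are known to vanish.
    have h := (integrability_liftField
    hF hD hM hV hα hU .zero ha.1 he .zero .zero hb.1 he .zero
      .zero hx).1
    -- Evaluated on (e_M, e_M), the Lie derivative of the multiplication along α(a) is −[α(a), e_M].
    have h0 := lieDerivMul_parallel_of_total hF hD hM hV hα hflat hU ha he he hx
    have h1 := lieDerivMul_parallel_of_total hF hD hM hV hα hflat hU hb he he hx
    simp [lieDerivMul, hM.mul_unit, hM.unit_mul] at h0 h1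
    rw [mlieBracket_swap_apply, neg_eq_zero] at h1
    simp [verticalLieDeriv, horizontalLieDeriv, verticalBracket, horizontalMul_apply, hM.mul_unit,
      ha.2 x hx, hb.2 x hx, hc', hc, hR hae he hx, hR he hbe hx, h0, h1] at h
    exact h

end Necessity

/-! ### Sufficiency of the four conditions. -/

section Sufficiency

set_option linter.unusedSectionVars false

variable {𝕜 : Type*} [RCLike 𝕜]
  {E : Type*} [NormedAddCommGroup E] [NormedSpace 𝕜 E] [FiniteDimensional 𝕜 E]
  {H : Type*} [TopologicalSpace H] {I : ModelWithCorners 𝕜 E H} [I.Boundaryless]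
  {M : Type*} [TopologicalSpace M] [ChartedSpace H M]
  {F : Type*} [NormedAddCommGroup F] [NormedSpace 𝕜 F]
  {V : M → Type*} [TopologicalSpace (TotalSpace F V)]
  [∀ x, AddCommGroup (V x)] [∀ x, Module 𝕜 (V x)]
  [∀ x, TopologicalSpace (V x)] [∀ x, IsTopologicalAddGroup (V x)]
  [∀ x, ContinuousSMul 𝕜 (V x)] [FiberBundle F V] [VectorBundle 𝕜 F V]
  [IsManifold I ∞ M] [ContMDiffVectorBundle ∞ F V I] [FiniteDimensional 𝕜 F]
  {D : CovariantDerivative I F V}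
  {mulM : ∀ x : M, TangentSpace I x →ₗ[𝕜] TangentSpace I x →ₗ[𝕜] TangentSpace I x}
  {eM : ∀ x : M, TangentSpace I x}
  {mulV : ∀ x, V x →ₗ[𝕜] V x →ₗ[𝕜] V x} {eV : ∀ x, V x}
  {α : ∀ x, V x →ₗ[𝕜] TangentSpace I x}

section BracketDerivation

variable {U : Set M} {C C' X Y Z W : ∀ x : M, TangentSpace I x}

variable (mulM) in
/-- The Lie derivative along `X` of the map `(Z, W) ↦ Z ∘ W + C ∘ W + C' ∘ Z`. -/
def affineLieDeriv (C C' Z W X : ∀ x : M, TangentSpace I x) (x : M) : TangentSpace I x :=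
  lieDerivMul I mulM X Z W x
    + (lieDerivMul I mulM X C W x + mulM x (mlieBracket I X C x) (W x))
    + (lieDerivMul I mulM X C' Z x + mulM x (mlieBracket I X C' x) (Z x))

/-- A vanishing Lie derivative along C says that bracketing with C is a derivation of the
multiplication. -/
theorem IsFManifold.mlieBracket_mul_left (hF : IsFManifold I mulM eM)
    (hCL : ∀ X Y, IsSectionOn I E U X → IsSectionOn I E U Y → ∀ x ∈ U,
      lieDerivMul I mulM C X Y x = 0)
    (hX : IsSectionOn I E U X) (hY : IsSectionOn I E U Y) {x : M} (hx : x ∈ U) :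
    mlieBracket I (fun y => mulM y (X y) (Y y)) C x
      = mulM x (X x) (mlieBracket I Y C x) + mulM x (Y x) (mlieBracket I X C x) := by
  have h := hCL X Y hX hY x hx
  have hM := hF.isMultiplication
  rw [lieDerivMul, sub_sub, sub_eq_zero] at h
  rw [mlieBracket_swap_apply, h, mlieBracket_swap_apply (V := Y), mlieBracket_swap_apply (V := X),
    hM.comm x (Y x)]
  simp only [map_neg, LinearMap.neg_apply]
  abel

/-- Each summand obeys the same product rule in X: the Lie derivatives by the F-manifold identity,
the brackets with C and C' because the multiplication is invariant along these fields. -/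
theorem IsFManifold.affineLieDeriv_mul (hF : IsFManifold I mulM eM) (hU : IsOpen U)
    (hC : IsSectionOn I E U C) (hC' : IsSectionOn I E U C')
    (hCL : ∀ X Y, IsSectionOn I E U X → IsSectionOn I E U Y → ∀ x ∈ U,
      lieDerivMul I mulM C X Y x = 0)
    (hCL' : ∀ X Y, IsSectionOn I E U X → IsSectionOn I E U Y → ∀ x ∈ U,
      lieDerivMul I mulM C' X Y x = 0)
    (hZ : IsSectionOn I E U Z) (hW : IsSectionOn I E U W)
    (hX : IsSectionOn I E U X) (hY : IsSectionOn I E U Y) {x : M} (hx : x ∈ U) :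
    affineLieDeriv mulM C C' Z W (fun y => mulM y (X y) (Y y)) x
      = mulM x (X x) (affineLieDeriv mulM C C' Z W Y x)
        + mulM x (Y x) (affineLieDeriv mulM C C' Z W X x) := by
  have hM := hF.isMultiplication
  simp only [affineLieDeriv]
  rw [hF.lieDeriv_mul U hU X Y Z W hX hY hZ hW x hx, hF.lieDeriv_mul U hU X Y C W hX hY hC hW x hx,
    hF.lieDeriv_mul U hU X Y C' Z hX hY hC' hZ x hx, hF.mlieBracket_mul_left hCL hX hY hx,
    hF.mlieBracket_mul_left hCL' hX hY hx]
  simp only [map_add, LinearMap.add_apply, hM.assoc]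
  abel

theorem affineLieDeriv_add (hU : IsOpen U)
    (hX : IsSectionOn I E U X) (hY : IsSectionOn I E U Y) {x : M} (hx : x ∈ U) :
    affineLieDeriv mulM C C' Z W (fun y => X y + Y y) x
      = affineLieDeriv mulM C C' Z W X x + affineLieDeriv mulM C C' Z W Y x := by
  have := FiniteDimensional.complete 𝕜 E
  have h : ∀ Q : ∀ x : M, TangentSpace I x, mlieBracket I (fun y => X y + Y y) Q x
      = mlieBracket I X Q x + mlieBracket I Y Q x := fun Q =>
    mlieBracket_add_left (hX.mdifferentiableAt hU hx) (hY.mdifferentiableAt hU hx)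
  simp only [affineLieDeriv, lieDerivMul, h, map_add, LinearMap.add_apply]
  abel

/-- The expanded form is the one in which the horizontal component on lifts appears, with C = α(c)
and C' = α(d). -/
theorem IsFManifold.affineLieDeriv_eq (hF : IsFManifold I mulM eM) (hU : IsOpen U)
    (hC : IsSectionOn I E U C) (hC' : IsSectionOn I E U C') (hZ : IsSectionOn I E U Z)
    (hW : IsSectionOn I E U W) {x : M} (hx : x ∈ U) :
    affineLieDeriv mulM C C' Z W X x
      = mlieBracket I X (fun y => mulM y (Z y) (W y) + mulM y (C y) (W y) + mulM y (C' y) (Z y)) x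
        - (mulM x (mlieBracket I X Z x) (W x) + mulM x (C' x) (mlieBracket I X Z x))
        - (mulM x (Z x) (mlieBracket I X W x) + mulM x (C x) (mlieBracket I X W x)) := by
  have := FiniteDimensional.complete 𝕜 E
  have hM := hF.isMultiplication
  have h1 := hM.contMDiff_mul U hU _ _ hZ hW
  have h2 := hM.contMDiff_mul U hU _ _ hC hW
  have h3 := hM.contMDiff_mul U hU _ _ hC' hZ
  have h : mlieBracket I X
      (fun y => mulM y (Z y) (W y) + mulM y (C y) (W y) + mulM y (C' y) (Z y)) x
      = mlieBracket I X (fun y => mulM y (Z y) (W y)) x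
        + mlieBracket I X (fun y => mulM y (C y) (W y)) x
        + mlieBracket I X (fun y => mulM y (C' y) (Z y)) x :=
    (mlieBracket_add_right ((h1.add h2).mdifferentiableAt hU hx) (h3.mdifferentiableAt hU hx)).trans
      (congrArg (· + _) (mlieBracket_add_right (h1.mdifferentiableAt hU hx)
        (h2.mdifferentiableAt hU hx)))
  rw [h]
  simp only [affineLieDeriv, lieDerivMul]
  abel

end BracketDerivation

/-- The integrability condition of the total space, on lifts with parallel vertical parts. -/
theorem integrabilityDefect_liftField_parallel (hD : IsSmoothConnection D)
    (hF : IsFManifold I mulM eM) (hV : IsMultiplication I F mulV eV)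
    (hα : ContMDiff (I.prod 𝓘(𝕜, F)) (I.prod 𝓘(𝕜, E)) ∞
      (fun v : TotalSpace F V => (⟨v.proj, α v.proj v.2⟩ : TangentBundle I M)))
    (hflat : IsFlat D)
    (hL : ∀ U : Set M, IsOpen U → ∀ s : ∀ x, V x, IsParallelOn D U s →
        ∀ Y Z : ∀ x : M, TangentSpace I x, IsSectionOn I E U Y → IsSectionOn I E U Z →
          ∀ x ∈ U, lieDerivMul I mulM (fun y => α y (s y)) Y Z x = 0)
    (hpar : ∀ U : Set M, IsOpen U → ∀ s₁ s₂ : ∀ x, V x, IsParallelOn D U s₁ → IsParallelOn D U s₂ →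
        IsParallelOn D U (fun x => mulV x (s₁ x) (s₂ x)) ∧
        ∀ x ∈ U, mlieBracket I (fun y => α y (s₁ y)) (fun y => α y (s₂ y)) x = 0)
    {U : Set M} (hU : IsOpen U) {X Y Z W : ∀ x : M, TangentSpace I x} {a b c d s : ∀ x, V x}
    (hX : IsSectionOn I E U X) (ha : IsParallelOn D U a) (hY : IsSectionOn I E U Y)
    (hb : IsParallelOn D U b) (hZ : IsSectionOn I E U Z) (hc : IsParallelOn D U c)
    (hW : IsSectionOn I E U W) (hd : IsParallelOn D U d)
    (hs : IsSectionOn I F U s) {x : M} (hx : x ∈ U) :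
    integrabilityDefect (I.prod 𝓘(𝕜, F)) (totalMul D mulM mulV α) (liftField D X a)
        (liftField D Y b) (liftField D Z c) (liftField D W d) (TotalSpace.mk' F x (s x)) = 0 := by
  have hM := hF.isMultiplication
  have hαs : ∀ {a : ∀ x, V x}, IsParallelOn D U a → IsSectionOn I E U (fun x => α x (a x)) :=
    fun ha => ha.1.map_morphism hα
  -- Parallel vertical parts and flatness remove every term of the vertical part of a bracket, at
  -- the points of an arbitrary `s`.
  have hvb : ∀ {X Y : ∀ x : M, TangentSpace I x} {a b : ∀ x, V x}, IsSectionOn I E U X →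
      IsSectionOn I E U Y → IsParallelOn D U a → IsParallelOn D U b →
      verticalBracket D s X a Y b x = 0 := by
    intro X Y a b hX hY ha hb
    simp [verticalBracket, ha.2 x hx, hb.2 x hx, hflat U hU X Y s hX hY hs x hx]
  have hv : ∀ {X : ∀ x : M, TangentSpace I x} {a : ∀ x, V x}, IsSectionOn I E U X →
      IsParallelOn D U a → verticalLieDeriv D mulM mulV α s X a Z c W d x = 0 := by
    intro X a hX ha
    simp [verticalLieDeriv, hvb hX hZ ha hc, hvb hX hW ha hd,
      hvb hX (isSectionOn_horizontalMul hM hα hU hZ hc.1 hW hd.1) ha (hpar U hU c d hc hd).1]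
  -- The result no longer depends on `a`; this is why the product, with horizontal part of three
  -- terms, can be handled by additivity in X.
  have hh : ∀ {X : ∀ x : M, TangentSpace I x} {a : ∀ x, V x}, IsSectionOn I E U X →
      IsParallelOn D U a → horizontalLieDeriv D mulM α s X a Z c W d x
        = affineLieDeriv mulM (fun y => α y (c y)) (fun y => α y (d y)) Z W X x := by
    intro X a hX ha
    rw [hF.affineLieDeriv_eq hU (hαs hc) (hαs hd) hZ hW hx]
    simp only [horizontalLieDeriv, horizontalMul_apply, hvb hX hZ ha hc, hvb hX hW ha hd, map_zero,
      LinearMap.zero_apply, add_zero]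
    rfl
  have hab := (hpar U hU a b ha hb).1
  have hXY := isSectionOn_horizontalMul hM hα hU hX ha.1 hY hb.1
  refine (integrabilityDefect_liftField_eq_zero_iff hD hM hV hα hU hX ha.1 hY hb.1 hZ hc.1 hW hd.1
    hs hx).2 ⟨?_, ?_⟩
  · have hmul : ∀ {X Y : ∀ x : M, TangentSpace I x}, IsSectionOn I E U X → IsSectionOn I E U Y →
        affineLieDeriv mulM (fun y => α y (c y)) (fun y => α y (d y)) Z W
          (fun y => mulM y (X y) (Y y)) x
        = mulM x (X x) (affineLieDeriv mulM (fun y => α y (c y)) (fun y => α y (d y)) Z W Y x)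
          + mulM x (Y x)
            (affineLieDeriv mulM (fun y => α y (c y)) (fun y => α y (d y)) Z W X x) :=
      fun hX hY => hF.affineLieDeriv_mul hU (hαs hc) (hαs hd) (hL U hU c hc) (hL U hU d hd) hZ hW
        hX hY hx
    -- The Lie derivative summands vanish by condition 3, the brackets with α(c) and α(d) by
    -- condition 4.
    have hzero : ∀ {a : ∀ x, V x}, IsParallelOn D U a →
        affineLieDeriv mulM (fun y => α y (c y)) (fun y => α y (d y)) Z W
          (fun y => α y (a y)) x = 0 := by
      intro a ha
      simp [affineLieDeriv, hL U hU a ha _ _ hZ hW x hx, hL U hU a ha _ _ (hαs hc) hW x hx,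
        hL U hU a ha _ _ (hαs hd) hZ x hx, (hpar U hU a c ha hc).2 x hx,
        (hpar U hU a d ha hd).2 x hx]
    have h1 := hM.contMDiff_mul U hU _ _ hX hY
    have h2 := hM.contMDiff_mul U hU _ _ (hαs ha) hY
    have h3 := hM.contMDiff_mul U hU _ _ (hαs hb) hX
    rw [hh hXY hab, horizontalMul_apply, horizontalMul_apply, hv hX ha, hv hY hb, hh hX ha, hh hY hb]
    refine (affineLieDeriv_add hU (h1.add h2) h3 hx).trans ?_
    rw [affineLieDeriv_add hU h1 h2 hx, hmul hX hY, hmul (hαs ha) hY, hmul (hαs hb) hX, hzero ha,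
      hzero hb]
    simp only [map_zero, LinearMap.zero_apply, add_zero]
    abel
  · rw [hv hXY hab, hv hX ha, hv hY hb, map_zero, map_zero, add_zero]

/-- By tensoriality each of the four fields may be replaced by a lift with the same value at the
given point; `hex` allows its vertical part to be parallel. -/
theorem isFManifold_total (hD : IsSmoothConnection D)
    (hF : IsFManifold I mulM eM) (hV : IsMultiplication I F mulV eV)
    (hα : ContMDiff (I.prod 𝓘(𝕜, F)) (I.prod 𝓘(𝕜, E)) ∞
      (fun v : TotalSpace F V => (⟨v.proj, α v.proj v.2⟩ : TangentBundle I M)))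
    (hα_mul : ∀ x (a b : V x), α x (mulV x a b) = mulM x (α x a) (α x b))
    (hα_unit : ∀ x, α x (eV x) = eM x)
    (hflat : IsFlat D)
    (hL : ∀ U : Set M, IsOpen U → ∀ s : ∀ x, V x, IsParallelOn D U s →
        ∀ Y Z : ∀ x : M, TangentSpace I x, IsSectionOn I E U Y → IsSectionOn I E U Z →
          ∀ x ∈ U, lieDerivMul I mulM (fun y => α y (s y)) Y Z x = 0)
    (hpar : ∀ U : Set M, IsOpen U → ∀ s₁ s₂ : ∀ x, V x, IsParallelOn D U s₁ → IsParallelOn D U s₂ →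
        IsParallelOn D U (fun x => mulV x (s₁ x) (s₂ x)) ∧
        ∀ x ∈ U, mlieBracket I (fun y => α y (s₁ y)) (fun y => α y (s₂ y)) x = 0)
    (hex : ∀ (x : M) (v : V x), ∃ U : Set M, IsOpen U ∧ x ∈ U ∧
      ∃ s : ∀ y, V y, IsParallelOn D U s ∧ s x = v) :
    IsFManifold (I.prod 𝓘(𝕜, F)) (totalMul D mulM mulV α) (verticalField I eV) := by
  have hT := isMultiplication_totalMul hD hF.isMultiplication hV hα hα_mul hα_unit
  refine ⟨hT, fun O hO ξ η ζ θ hξ hη hζ hθ v hv => ?_⟩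
  rw [← sub_eq_zero]
  have hlift : ∀ ξ : TangentSpace (I.prod 𝓘(𝕜, F)) v, ∃ U : Set M, IsOpen U ∧ v.proj ∈ U ∧
      ∃ (X : ∀ x : M, TangentSpace I x) (a : ∀ x, V x), IsSectionOn I E U X ∧ IsParallelOn D U a ∧
        ξ = liftField D X a v := by
    intro ξ
    obtain ⟨U, hU, hvU, X, hX, hXv⟩ := exists_isSectionOn (I := I) (F := E) (dproj I v ξ)
    obtain ⟨U', hU', hvU', a, ha, hav⟩ := hex v.proj (verticalPart D v ξ)
    exact ⟨U ∩ U', hU.inter hU', ⟨hvU, hvU'⟩, X, a, hX.mono Set.inter_subset_left,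
      ⟨ha.1.mono Set.inter_subset_right, fun y hy => ha.2 y hy.2⟩, eq_liftField v ξ hXv hav⟩
  obtain ⟨U₁, hU₁, hv₁, X, a, hX, ha, hXa⟩ := hlift (ξ v)
  obtain ⟨U₂, hU₂, hv₂, Y, b, hY, hb, hYb⟩ := hlift (η v)
  obtain ⟨U₃, hU₃, hv₃, Z, c, hZ, hc, hZc⟩ := hlift (ζ v)
  obtain ⟨U₄, hU₄, hv₄, W, d, hW, hd, hWd⟩ := hlift (θ v)
  -- This section only presents the base point as a value s(x); it need not be parallel.
  obtain ⟨U₅, hU₅, hv₅, s, hs, hsv⟩ := exists_isSectionOn I (F := F) v.2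
  let U := U₁ ∩ U₂ ∩ U₃ ∩ U₄ ∩ U₅
  have hU : IsOpen U := (((hU₁.inter hU₂).inter hU₃).inter hU₄).inter hU₅
  have hvU : v.proj ∈ U := ⟨⟨⟨⟨hv₁, hv₂⟩, hv₃⟩, hv₄⟩, hv₅⟩
  have hpm : ∀ {U' : Set M} {a : ∀ x, V x}, IsParallelOn D U' a → U ⊆ U' → IsParallelOn D U a :=
    fun ha h => ⟨ha.1.mono h, fun y hy => ha.2 y (h hy)⟩
  have i₁ : U ⊆ U₁ := fun y hy => hy.1.1.1.1
  have i₂ : U ⊆ U₂ := fun y hy => hy.1.1.1.2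
  have i₃ : U ⊆ U₃ := fun y hy => hy.1.1.2
  have i₄ : U ⊆ U₄ := fun y hy => hy.1.2
  have i₅ : U ⊆ U₅ := fun y hy => hy.2
  have h := integrabilityDefect_liftField_parallel hD hF hV hα hflat hL hpar hU (hX.mono i₁)
    (hpm ha i₁) (hY.mono i₂) (hpm hb i₂) (hZ.mono i₃) (hpm hc i₃) (hW.mono i₄) (hpm hd i₄)
    (hs.mono i₅) hvU
  rw [hsv] at h
  have hmd : ∀ {X : ∀ x : M, TangentSpace I x} {a : ∀ x, V x}, IsSectionOn I E U X →
      IsParallelOn D U a → MDifferentiableAt (I.prod 𝓘(𝕜, F)) ((I.prod 𝓘(𝕜, F)).prod 𝓘(𝕜, E × F))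
        (fun w => TotalSpace.mk' (E × F) w (liftField D X a w)) v := fun hX ha =>
    (isSectionOn_liftField hD hU hX ha.1).mdifferentiableAt (isOpen_proj_preimage hU) hvU
  exact (integrabilityDefect_congr hT (hξ.mdifferentiableAt hO hv) (hmd (hX.mono i₁) (hpm ha i₁))
    (hη.mdifferentiableAt hO hv) (hmd (hY.mono i₂) (hpm hb i₂))
    (hζ.mdifferentiableAt hO hv) (hmd (hZ.mono i₃) (hpm hc i₃))
    (hθ.mdifferentiableAt hO hv) (hmd (hW.mono i₄) (hpm hd i₄)) hXa hYb hZc hWd).trans h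

end Sufficiency

/-! ### Radial solutions of dS = −A S and their derivatives. -/

section Frobenius

set_option maxSynthPendingDepth 3
set_option linter.unusedSectionVars false

variable {𝕜 : Type*} [RCLike 𝕜]
  {E : Type*} [NormedAddCommGroup E] [NormedSpace 𝕜 E] [NormedSpace ℝ E] [IsScalarTower ℝ 𝕜 E]
  {F : Type*} [NormedAddCommGroup F] [NormedSpace 𝕜 F] [NormedSpace ℝ F] [IsScalarTower ℝ 𝕜 F]

theorem hasDerivWithinAt_clm_line {A : E → E →L[𝕜] F →L[𝕜] F} {A' : E →L[𝕜] E →L[𝕜] F →L[𝕜] F}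
    {z x h : E} {γ : ℝ → F} {γ' : F} {s : Set ℝ} {t : ℝ} (hA : HasFDerivAt A A' (z + t • x))
    (hγ : HasDerivWithinAt γ γ' s t) :
    HasDerivWithinAt (fun t => A (z + t • x) h (γ t))
      (A' x h (γ t) + A (z + t • x) h γ') s t := by
  have h1 : HasFDerivAt (fun q : E × F => A q.1 h q.2)
      ((A (z + t • x) h).comp (ContinuousLinearMap.snd 𝕜 E F)
        + ((((A'.comp (ContinuousLinearMap.fst 𝕜 E F)).flip h)).flip (γ t))) (z + t • x, γ t) := by
    have h2 : HasFDerivAt (fun q : E × F => A q.1) (A'.comp (ContinuousLinearMap.fst 𝕜 E F))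
        (z + t • x, γ t) :=
      HasFDerivAt.comp (g := A) (f := Prod.fst) (z + t • x, γ t) hA hasFDerivAt_fst
    have h3 := h2.clm_apply (hasFDerivAt_const h (z + t • x, γ t))
    have h4 := h3.clm_apply (hasFDerivAt_snd (𝕜 := 𝕜) (p := (z + t • x, γ t)))
    convert! h4 using 1
    ext q
    all_goals simp
  have hline : HasDerivWithinAt (fun t : ℝ => z + t • x) x s t := by
    have := ((hasDerivAt_id t).smul_const x).const_add z
    simpa using this.hasDerivWithinAt
  -- The parameter `t` is real even if 𝕜 = ℂ, so the chain rule is applied after restriction of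
  -- scalars.
  have h5 := (h1.restrictScalars ℝ).comp_hasDerivWithinAt t (hline.prodMk hγ)
  convert! h5 using 1
  simp [add_comm]

/-- A linear ordinary differential equation with small coefficient has a solution on `[0, 1]`. -/
theorem exists_solution_linear [CompleteSpace F] {B : ℝ → F →L[𝕜] F}
    (hB : ContinuousOn B (Set.Icc 0 1)) (hB' : ∀ t ∈ Set.Icc (0 : ℝ) 1, ‖B t‖ ≤ 1 / 2) (c : F) :
    ∃ γ : ℝ → F, γ 0 = c ∧
      ∀ t ∈ Set.Icc (0 : ℝ) 1, HasDerivWithinAt γ (B t (γ t)) (Set.Icc 0 1) t := by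
  have hP : IsPicardLindelof (fun t y => B t y) (⟨0, by simp⟩ : Set.Icc (0 : ℝ) 1) c
      -- On the ball of radius ‖c‖ + 1 around c one has ‖y‖ ≤ 2‖c‖ + 1, so the right side is at most
      -- (2‖c‖ + 1)/2 ≤ ‖c‖ + 1, and the solution stays in the ball for time 1. The bound 1/2 is
      -- what makes this work.
      (‖c‖₊ + 1) 0 (‖c‖₊ + 1) 1 := by
    refine ⟨fun t ht => ?_, fun y _ => ?_, fun t ht y hy => ?_, ?_⟩
    · refine LipschitzWith.lipschitzOnWith (LipschitzWith.of_dist_le_mul fun y y' => ?_)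
      rw [dist_eq_norm, dist_eq_norm, ← map_sub]
      refine ((B t).le_opNorm _).trans ?_
      have := hB' t ht
      gcongr
      exact this.trans (by norm_num)
    · exact hB.clm_apply continuousOn_const
    · have h1 : ‖y‖ ≤ ‖c‖ + (‖c‖ + 1) := by
        have := mem_closedBall_iff_norm.1 hy
        have h2 := norm_le_norm_add_norm_sub' y c
        change _ ≤ ‖c‖ + 1 at this
        linarith
      have := (B t).le_of_opNorm_le (hB' t ht) y
      push_cast
      change _ ≤ ‖c‖ + 1
      linarith [norm_nonneg c]
    · simp
  obtain ⟨γ, h0, h⟩ := hP.exists_eq_forall_mem_Icc_hasDerivWithinAt₀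
  exact ⟨γ, h0, h⟩

theorem norm_apply_apply_le {T : E →L[𝕜] F →L[𝕜] F} {C a b : ℝ} (hT : ‖T‖ ≤ C) {x : E} {g : F}
    (hx : ‖x‖ ≤ a) (hg : ‖g‖ ≤ b) : ‖T x g‖ ≤ C * a * b := by
  have hC := (norm_nonneg T).trans hT
  have ha := (norm_nonneg x).trans hx
  calc ‖T x g‖ ≤ ‖T‖ * ‖x‖ * ‖g‖ := T.le_opNorm₂ x g
    _ ≤ C * a * b := by gcongr

/-- The derivative of the radial solutions of `dS = - A S` with respect to the direction: the error
term is quadratic if `A` satisfies the integrability condition. -/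
theorem norm_radial_sub_le {A : E → E →L[𝕜] F →L[𝕜] F} {z₀ : E} {r C G : ℝ} (hr : r ≤ 1)
    (hd : ∀ z ∈ Metric.ball z₀ r, DifferentiableAt 𝕜 A z)
    (hA : ∀ z ∈ Metric.ball z₀ r, ‖A z‖ ≤ C)
    (hA' : ∀ z ∈ Metric.ball z₀ r, ‖fderiv 𝕜 A z‖ ≤ C)
    (hLip : ∀ z ∈ Metric.ball z₀ r, ∀ z' ∈ Metric.ball z₀ r,
      ‖fderiv 𝕜 A z - fderiv 𝕜 A z'‖ ≤ C * ‖z - z'‖)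
    (hCr : C * r ≤ 1 / 2)
    (hflat : ∀ z ∈ Metric.ball z₀ r, ∀ h k c, fderiv 𝕜 A z h k c - fderiv 𝕜 A z k h c
      + A z h (A z k c) - A z k (A z h c) = 0)
    {x h : E} (hx : ‖x‖ < r) (hxh : ‖x + h‖ < r) {γ δ : ℝ → F} (h0 : δ 0 = γ 0)
    (hγ : ∀ t ∈ Set.Icc (0 : ℝ) 1,
      HasDerivWithinAt γ (-(A (z₀ + t • x) x (γ t))) (Set.Icc 0 1) t)
    (hδ : ∀ t ∈ Set.Icc (0 : ℝ) 1,
      HasDerivWithinAt δ (-(A (z₀ + t • (x + h)) (x + h) (δ t))) (Set.Icc 0 1) t)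
    (hG : ∀ t ∈ Set.Icc (0 : ℝ) 1, ‖γ t‖ ≤ G) :
    ‖δ 1 - γ 1 + A (z₀ + x) h (γ 1)‖ ≤ (2 * C + 2 * C ^ 2) * G * (Real.exp 1 - 1) * ‖h‖ ^ 2 := by
  have hr0 : 0 < r := (norm_nonneg x).trans_lt hx
  have hC0 : 0 ≤ C := (norm_nonneg _).trans (hA z₀ (Metric.mem_ball_self hr0))
  have hG0 : 0 ≤ G := (norm_nonneg _).trans (hG 0 (by simp))
  have hmem : ∀ {y : E}, ‖y‖ < r → ∀ t ∈ Set.Icc (0 : ℝ) 1, z₀ + t • y ∈ Metric.ball z₀ r := by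
    intro y hy t ht
    rw [Metric.mem_ball, dist_eq_norm, add_sub_cancel_left, norm_smul, Real.norm_of_nonneg ht.1]
    exact (mul_le_of_le_one_left (norm_nonneg y) ht.2).trans_lt hy
  -- The error of the expected first-order expansion: the points at time `t` on the two rays differ
  -- by t·h, so a solution S should change by −t A h γ(t) up to second order.
  let φ : ℝ → F := fun t => δ t - γ t + t • A (z₀ + t • x) h (γ t)
  let φ' : ℝ → F := fun t => -(A (z₀ + t • (x + h)) (x + h) (δ t)) - -(A (z₀ + t • x) x (γ t))
    + (t • (fderiv 𝕜 A (z₀ + t • x) x h (γ t)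
      + A (z₀ + t • x) h (-(A (z₀ + t • x) x (γ t)))) + (1 : ℝ) • A (z₀ + t • x) h (γ t))
  have hφ : ∀ t ∈ Set.Icc (0 : ℝ) 1, HasDerivWithinAt φ (φ' t) (Set.Icc 0 1) t := by
    intro t ht
    exact ((hδ t ht).sub (hγ t ht)).add ((hasDerivWithinAt_id t _).smul
      (hasDerivWithinAt_clm_line (h := h) (hd _ (hmem hx t ht)).hasFDerivAt (hγ t ht)))
  have hφ0 : φ 0 = 0 := by simp [φ, h0]
  have hbound : ∀ t ∈ Set.Icc (0 : ℝ) 1,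
      ‖φ' t‖ ≤ 1 * ‖φ t‖ + (2 * C + 2 * C ^ 2) * G * ‖h‖ ^ 2 := by
    intro t ht
    have hp := hmem hx t ht
    have hq := hmem hxh t ht
    have hqp : z₀ + t • (x + h) - (z₀ + t • x) = t • h := by rw [smul_add]; abel
    have hth : ‖t • h‖ ≤ ‖h‖ := by
      rw [norm_smul, Real.norm_of_nonneg ht.1]
      exact mul_le_of_le_one_left (norm_nonneg h) ht.2
    have hseg : ∀ z ∈ segment ℝ (z₀ + t • x) (z₀ + t • (x + h)),
        z ∈ Metric.ball z₀ r ∧ ‖z - (z₀ + t • x)‖ ≤ ‖h‖ := by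
      intro z hz
      refine ⟨(convex_ball z₀ r).segment_subset hp hq hz, ?_⟩
      obtain ⟨θ, hθ, rfl⟩ := (segment_eq_image' ℝ _ _).subset hz
      rw [add_sub_cancel_left, hqp, norm_smul, Real.norm_of_nonneg hθ.1]
      exact (mul_le_of_le_one_left (norm_nonneg _) hθ.2).trans hth
    have hconv := convex_segment (𝕜 := ℝ) (z₀ + t • x) (z₀ + t • (x + h))
    have hleft := left_mem_segment ℝ (z₀ + t • x) (z₀ + t • (x + h))
    have hright := right_mem_segment ℝ (z₀ + t • x) (z₀ + t • (x + h))
    -- Mean value estimates on the segment between the two rays: second order in h thanks to the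
    -- Lipschitz bound on the derivative, then first order.
    have e1 := hconv.norm_image_sub_le_of_norm_fderiv_le' (𝕜 := 𝕜) (C := C * ‖h‖)
      (φ := fderiv 𝕜 A (z₀ + t • x)) (fun z hz => hd z (hseg z hz).1) (fun z hz =>
        (hLip z (hseg z hz).1 _ hp).trans (by gcongr; exact (hseg z hz).2)) hleft hright
    have e2 := hconv.norm_image_sub_le_of_norm_fderiv_le (𝕜 := 𝕜) (C := C)
      (fun z hz => hd z (hseg z hz).1) (fun z hz => hA' z (hseg z hz).1) hleft hright
    rw [hqp] at e1 e2
    have e1' : ‖A (z₀ + t • (x + h)) - A (z₀ + t • x) - fderiv 𝕜 A (z₀ + t • x) (t • h)‖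
        ≤ C * ‖h‖ ^ 2 := e1.trans (by rw [pow_two, ← mul_assoc]; gcongr)
    have e2' : ‖A (z₀ + t • (x + h)) - A (z₀ + t • x)‖ ≤ C * ‖h‖ := e2.trans (by gcongr)
    have hAp := hA _ hp
    have hAq := hA _ hq
    have hdp := hA' _ hp
    have hfl := hflat _ hp x h (γ t)
    have hg := hG t ht
    set a := A (z₀ + t • x)
    set a' := A (z₀ + t • (x + h))
    set d := fderiv 𝕜 A (z₀ + t • x)
    set g := γ t
    have hdh : ‖d h‖ ≤ C * ‖h‖ := (d.le_opNorm h).trans (by gcongr)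
    have hdth : d (t • h) = t • d h := d.map_smul_of_tower t h
    -- The integrability condition trades the derivative of A along x, applied to h, for the
    -- derivative along h, applied to x, plus a commutator. All terms linear in h then cancel,
    -- leaving the linear equation for φ and four quadratic terms.
    have key : φ' t = -(a' (x + h) (φ t)) + (-((a' - a - d (t • h)) (x + h) g)
        + -(t • d h h g) + t • (a' - a) (x + h) (a h g) + t • a h (a h g)) := by
      have hδt : δ t = φ t + g - t • a h g := by simp only [φ]; abel
      change -(a' (x + h) (δ t)) - -(a x g)
        + (t • (d x h g + a h (-(a x g))) + (1 : ℝ) • a h g) = _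
      simp only [hδt, hdth, map_add, map_sub, map_neg, add_apply, sub_apply, smul_apply,
        ContinuousLinearMap.map_smul_of_tower, smul_add, smul_sub, smul_neg, one_smul]
      have hfl' : t • d x h g = t • (d h x g - a x (a h g) + a h (a x g)) := by
        congr 1
        rw [← sub_eq_zero, ← hfl]; abel
      rw [hfl']
      simp only [smul_add, smul_sub]
      abel
    have b0 : ‖a' (x + h) (φ t)‖ ≤ 1 * ‖φ t‖ := by
      refine (norm_apply_apply_le hAq hxh.le le_rfl).trans ?_
      gcongr
      linarith
    have b1 : ‖(a' - a - d (t • h)) (x + h) g‖ ≤ C * ‖h‖ ^ 2 * 1 * G :=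
      norm_apply_apply_le e1' (hxh.le.trans hr) hg
    have ht1 : ∀ y : F, ‖t • y‖ ≤ ‖y‖ := fun y => by
      rw [norm_smul, Real.norm_of_nonneg ht.1]
      exact mul_le_of_le_one_left (norm_nonneg y) ht.2
    have b2 : ‖t • d h h g‖ ≤ C * ‖h‖ * ‖h‖ * G :=
      (ht1 _).trans (norm_apply_apply_le hdh le_rfl hg)
    have hah : ‖a h g‖ ≤ C * ‖h‖ * G := norm_apply_apply_le hAp le_rfl hg
    have b3 : ‖t • (a' - a) (x + h) (a h g)‖ ≤ C * ‖h‖ * 1 * (C * ‖h‖ * G) :=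
      (ht1 _).trans (norm_apply_apply_le e2' (hxh.le.trans hr) hah)
    have b4 : ‖t • a h (a h g)‖ ≤ C * ‖h‖ * (C * ‖h‖ * G) :=
      (ht1 _).trans (norm_apply_apply_le hAp le_rfl hah)
    rw [key]
    refine (norm_add_le _ _).trans (add_le_add (by rw [norm_neg]; exact b0) ?_)
    refine (norm_add₄_le).trans ?_
    rw [norm_neg, norm_neg]
    refine (add_le_add (add_le_add (add_le_add b1 b2) b3) b4).trans_eq ?_
    ring
  -- Gronwall with growth rate 1 and zero initial value on [0,1] turns the quadratic forcing into a
  -- quadratic bound, with factor e − 1.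
  have hgr := norm_le_gronwallBound_of_norm_deriv_right_le (f := φ) (f' := φ') (δ := 0) (a := 0)
    (b := 1) (fun t ht => (hφ t ht).continuousWithinAt)
    (fun t ht => (hφ t (Set.Ico_subset_Icc_self ht)).mono_of_mem_nhdsWithin
      (Icc_mem_nhdsGE_of_mem ht))
    (by rw [hφ0, norm_zero]) (fun t ht => hbound t (Set.Ico_subset_Icc_self ht)) 1 (by simp)
  rw [gronwallBound_of_K_ne_0 one_ne_zero] at hgr
  simp only [φ, one_smul, sub_zero, mul_one, zero_mul, zero_add, div_one] at hgr
  exact hgr.trans_eq (by ring)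

/-- Local solvability of `dS = - A S` under the integrability condition, on a ball where `A` and its
derivative are bounded and Lipschitz with suitable constants. -/
theorem exists_hasFDerivAt_of_bounds [CompleteSpace F] {A : E → E →L[𝕜] F →L[𝕜] F} {z₀ : E}
    {r C : ℝ} (hr : r ≤ 1)
    (hd : ∀ z ∈ Metric.ball z₀ r, DifferentiableAt 𝕜 A z)
    (hA : ∀ z ∈ Metric.ball z₀ r, ‖A z‖ ≤ C)
    (hA' : ∀ z ∈ Metric.ball z₀ r, ‖fderiv 𝕜 A z‖ ≤ C)
    (hLip : ∀ z ∈ Metric.ball z₀ r, ∀ z' ∈ Metric.ball z₀ r,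
      ‖fderiv 𝕜 A z - fderiv 𝕜 A z'‖ ≤ C * ‖z - z'‖)
    (hCr : C * r ≤ 1 / 2)
    (hflat : ∀ z ∈ Metric.ball z₀ r, ∀ h k c, fderiv 𝕜 A z h k c - fderiv 𝕜 A z k h c
      + A z h (A z k c) - A z k (A z h c) = 0) (c : F) :
    ∃ S : E → F, S z₀ = c ∧ ∀ z ∈ Metric.ball z₀ r, HasFDerivAt S (-(A z).flip (S z)) z := by
  have hex : ∀ x : E, ∃ γ : ℝ → F, (x = 0 → γ 1 = c) ∧ γ 0 = c ∧ (‖x‖ < r →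
      ∀ t ∈ Set.Icc (0 : ℝ) 1,
        HasDerivWithinAt γ (-(A (z₀ + t • x) x (γ t))) (Set.Icc 0 1) t) := by
    intro x
    rcases eq_or_ne x 0 with rfl | hx0
    · exact ⟨fun _ => c, fun _ => rfl, rfl, fun _ t _ => by
        simpa using hasDerivWithinAt_const t (Set.Icc (0 : ℝ) 1) c⟩
    by_cases hx : ‖x‖ < r
    · have hmem : ∀ t ∈ Set.Icc (0 : ℝ) 1, z₀ + t • x ∈ Metric.ball z₀ r := by
        intro t ht
        rw [Metric.mem_ball, dist_eq_norm, add_sub_cancel_left, norm_smul,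
          Real.norm_of_nonneg ht.1]
        exact (mul_le_of_le_one_left (norm_nonneg x) ht.2).trans_lt hx
      have hB : ContinuousOn (fun t : ℝ => -(A (z₀ + t • x) x)) (Set.Icc 0 1) := by
        intro t ht
        have h1 : ContinuousAt (fun t : ℝ => A (z₀ + t • x)) t :=
          ContinuousAt.comp (g := A) (f := fun t : ℝ => z₀ + t • x)
            (hd _ (hmem t ht)).continuousAt (by fun_prop)
        exact (h1.clm_apply continuousAt_const).neg.continuousWithinAt
      obtain ⟨γ, h0, h⟩ := exists_solution_linear hB (fun t ht => by
        rw [norm_neg]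
        have h1 := hA _ (hmem t ht)
        refine (((A (z₀ + t • x)).le_opNorm x).trans ?_).trans hCr
        have := (norm_nonneg _).trans h1
        gcongr) c
      exact ⟨γ, fun h => (hx0 h).elim, h0, fun _ => h⟩
    · exact ⟨fun _ => c, fun _ => rfl, rfl, fun h => (hx h).elim⟩
  choose γ hγ1 hγ0 hγ using hex
  -- S(z) is the value at time 1 of the solution along the ray from the center to z.
  refine ⟨fun z => γ (z - z₀) 1, hγ1 _ (sub_self z₀), fun z hz => ?_⟩
  have hx : ‖z - z₀‖ < r := mem_ball_iff_norm.1 hz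
  have hcont : ContinuousOn (γ (z - z₀)) (Set.Icc 0 1) :=
    fun t ht => (hγ _ hx t ht).continuousWithinAt
  obtain ⟨G, hG⟩ := isCompact_Icc.exists_bound_of_continuousOn hcont
  rw [hasFDerivAt_iff_isLittleO_nhds_zero]
  refine Asymptotics.IsBigO.trans_isLittleO (g := fun h : E => ‖h‖ ^ 2)
    (Asymptotics.IsBigO.of_bound ((2 * C + 2 * C ^ 2) * G * (Real.exp 1 - 1)) ?_)
    (Asymptotics.isLittleO_norm_pow_id one_lt_two)
  have hnear : ∀ᶠ h : E in 𝓝 0, ‖z - z₀ + h‖ < r := by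
    have : ContinuousAt (fun h : E => ‖z - z₀ + h‖) 0 := by fun_prop
    exact this.eventually_lt continuousAt_const (by simpa using hx)
  filter_upwards [hnear] with h hh
  have := norm_radial_sub_le hr hd hA hA' hLip hCr hflat hx hh
    ((hγ0 _).trans (hγ0 _).symm) (hγ _ hx) (hγ _ hh) hG
  rw [norm_pow, norm_norm, add_sub_right_comm]
  refine le_trans (le_of_eq ?_) this
  rw [add_sub_cancel]
  congr 1
  simp [sub_neg_eq_add]

end Frobenius

/-! ### The Frobenius theorem for flat linear systems. -/

section Integration

set_option maxSynthPendingDepth 3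

variable {𝕜 : Type*} [RCLike 𝕜]
  {E : Type*} [NormedAddCommGroup E] [NormedSpace 𝕜 E]
  {F : Type*} [NormedAddCommGroup F] [NormedSpace 𝕜 F]

/-- **Frobenius theorem** for linear total differential equations `dS = - A S`. -/
theorem exists_hasFDerivAt_of_flat [CompleteSpace F] {A : E → E →L[𝕜] F →L[𝕜] F} {Ω : Set E}
    (hΩ : IsOpen Ω) (hA : ContDiffOn 𝕜 ∞ A Ω)
    (hflat : ∀ z ∈ Ω, ∀ h k c, fderiv 𝕜 A z h k c - fderiv 𝕜 A z k h c
      + A z h (A z k c) - A z k (A z h c) = 0) {z₀ : E} (hz₀ : z₀ ∈ Ω) (c : F) :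
    ∃ U ⊆ Ω, IsOpen U ∧ z₀ ∈ U ∧ ∃ S : E → F, S z₀ = c ∧ ContDiffOn 𝕜 ∞ S U ∧
      ∀ z ∈ U, HasFDerivAt S (-(A z).flip (S z)) z := by
  -- Real structures are needed for rays and segments; the compatibility with 𝕜 is what the radial
  -- estimates require.
  let : NormedSpace ℝ E := NormedSpace.restrictScalars ℝ 𝕜 E
  let : NormedSpace ℝ F := NormedSpace.restrictScalars ℝ 𝕜 F
  have : IsScalarTower ℝ 𝕜 E := ⟨fun a b x => by
    change (a • b) • x = algebraMap ℝ 𝕜 a • b • x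
    rw [Algebra.smul_def, mul_smul]⟩
  have : IsScalarTower ℝ 𝕜 F := ⟨fun a b x => by
    change (a • b) • x = algebraMap ℝ 𝕜 a • b • x
    rw [Algebra.smul_def, mul_smul]⟩
  have hAz := hA.contDiffAt (hΩ.mem_nhds hz₀)
  have hA'z : ContDiffAt 𝕜 1 (fderiv 𝕜 A) z₀ := hAz.fderiv_right (by norm_cast)
  obtain ⟨K, W, hW, hLip⟩ := hA'z.exists_lipschitzOnWith
  have e1 := hAz.continuousAt.norm.eventually_le_const (lt_add_one _)
  have e2 := hA'z.continuousAt.norm.eventually_le_const (lt_add_one _)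
  obtain ⟨R, hR, hRsub⟩ := Metric.eventually_nhds_iff_ball.1
    (((hΩ.eventually_mem hz₀).and (Filter.eventually_mem_set.2 hW)).and (e1.and e2))
  -- One constant for the bounds on A, on its derivative, and on the Lipschitz constant of the
  -- derivative; the radius below is then chosen to give C·r ≤ 1/2.
  set C : ℝ := ‖A z₀‖ + 1 + (‖fderiv 𝕜 A z₀‖ + 1) + K
  have hC : 0 < C := by positivity
  set r : ℝ := min R (min 1 (1 / (2 * C)))
  have hr : 0 < r := by positivity
  have hrR : Metric.ball z₀ r ⊆ Metric.ball z₀ R := Metric.ball_subset_ball (min_le_left _ _)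
  have hK := K.2
  obtain ⟨S, hS0, hS⟩ := exists_hasFDerivAt_of_bounds (A := A) (z₀ := z₀) (r := r) (C := C)
    ((min_le_right _ _).trans (min_le_left _ _))
    (fun z hz => (hA.contDiffAt (hΩ.mem_nhds (hRsub z (hrR hz)).1.1)).differentiableAt (by simp))
    (fun z hz => (hRsub z (hrR hz)).2.1.trans (by
      have := norm_nonneg (fderiv 𝕜 A z₀); simp only [C]; change 0 ≤ (K : ℝ) at hK; linarith))
    (fun z hz => (hRsub z (hrR hz)).2.2.trans (by
      have := norm_nonneg (A z₀); simp only [C]; change 0 ≤ (K : ℝ) at hK; linarith))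
    (fun z hz z' hz' => (hLip.norm_sub_le (hRsub z (hrR hz)).1.2 (hRsub z' (hrR hz')).1.2).trans (by
      gcongr
      have := norm_nonneg (A z₀)
      have := norm_nonneg (fderiv 𝕜 A z₀)
      simp only [C]; linarith))
    (by
      have : r ≤ 1 / (2 * C) := (min_le_right _ _).trans (min_le_right _ _)
      calc C * r ≤ C * (1 / (2 * C)) := by gcongr
        _ = 1 / 2 := by field_simp)
    (fun z hz => hflat z (hRsub z (hrR hz)).1.1) c
  have hsub : Metric.ball z₀ r ⊆ Ω := fun z hz => (hRsub z (hrR hz)).1.1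
  refine ⟨_, hsub, Metric.isOpen_ball, Metric.mem_ball_self hr, S, hS0, ?_, hS⟩
  rw [contDiffOn_infty]
  intro n
  -- Bootstrapping: if S is of class Cⁿ, so is its derivative −A S, hence S is of class Cⁿ⁺¹.
  induction n with
  | zero =>
    exact contDiffOn_zero.2 fun z hz => (hS z hz).continuousAt.continuousWithinAt
  | succ n ih =>
    push_cast
    refine (contDiffOn_succ_iff_fderiv_of_isOpen Metric.isOpen_ball).2
      ⟨fun z hz => (hS z hz).differentiableAt.differentiableWithinAt, by simp, ?_⟩
    have h1 : ContDiffOn 𝕜 n (fun z => -(A z).flip (S z)) (Metric.ball z₀ r) := by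
      have hAn : ContDiffOn 𝕜 n A (Metric.ball z₀ r) :=
        (hA.mono hsub).of_le (by exact_mod_cast le_top)
      have h2 : ContDiffOn 𝕜 n (fun z => (A z).flip) (Metric.ball z₀ r) :=
        (ContinuousLinearMap.flipₗᵢ 𝕜 E F F).contDiff.comp_contDiffOn hAn
      exact (h2.clm_apply ih).neg
    exact h1.congr fun z hz => (hS z hz).fderiv

end Integration

/-! ### Parallel sections of a flat connection. -/

section ParallelSections

set_option linter.unusedSectionVars false

variable {𝕜 : Type*} [RCLike 𝕜]
  {E : Type*} [NormedAddCommGroup E] [NormedSpace 𝕜 E] [FiniteDimensional 𝕜 E]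
  {H : Type*} [TopologicalSpace H] {I : ModelWithCorners 𝕜 E H} [I.Boundaryless]
  {M : Type*} [TopologicalSpace M] [ChartedSpace H M] [IsManifold I ∞ M]

/-- The coordinate vector field in direction `h`, in the chart at `p`. -/
def coordField (I : ModelWithCorners 𝕜 E H) [IsManifold I ∞ M] (p : M) (h : E) (y : M) :
    TangentSpace I y :=
  (trivializationAt E (TangentSpace I) p).symm y h

theorem mvfderiv_extChartAt_eq {p y : M} (hy : y ∈ (chartAt H p).source) (X : TangentSpace I y) :
    mvfderiv I (extChartAt I p) y X
      = (trivializationAt E (TangentSpace I) p).continuousLinearMapAt 𝕜 y X :=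
  (congrArg (fun L : E →L[𝕜] E => L X)
    (TangentBundle.continuousLinearMapAt_trivializationAt (I := I) hy)).symm

theorem coordField_mvfderiv {p y : M} (hy : y ∈ (chartAt H p).source) (X : TangentSpace I y) :
    coordField I p (mvfderiv I (extChartAt I p) y X) y = X := by
  have hb : y ∈ (trivializationAt E (TangentSpace I) p).baseSet := by simpa using hy
  rw [mvfderiv_extChartAt_eq hy, coordField, ← Trivialization.symmL_apply (R := 𝕜) _ hb]
  exact (trivializationAt E (TangentSpace I) p).symmL_continuousLinearMapAt hb X

theorem mvfderiv_extChartAt_coordField {p y : M} (hy : y ∈ (chartAt H p).source) (h : E) :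
    mvfderiv I (extChartAt I p) y (coordField I p h y) = h := by
  have hb : y ∈ (trivializationAt E (TangentSpace I) p).baseSet := by simpa using hy
  rw [mvfderiv_extChartAt_eq hy, coordField, ← Trivialization.symmL_apply (R := 𝕜) _ hb]
  exact (trivializationAt E (TangentSpace I) p).continuousLinearMapAt_symmL hb h

theorem isSectionOn_coordField (p : M) (h : E) :
    IsSectionOn I E (chartAt H p).source (coordField I p h) := by
  have h1 := isSectionOn_const (I := I) (trivializationAt E (TangentSpace I) p) h
  rwa [TangentBundle.trivializationAt_baseSet] at h1

/-- Coordinate vector fields commute. -/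
theorem mlieBracket_coordField {p y : M} (hy : y ∈ (chartAt H p).source) (h k : E) :
    mlieBracket I (coordField I p h) (coordField I p k) y = 0 := by
  have : CompleteSpace E := FiniteDimensional.complete 𝕜 E
  have : IsManifold I 2 M := .of_le (n := ∞) (by norm_cast)
  have hopen := (chartAt H p).open_source
  -- The chart components of a coordinate field are constant, so both iterated derivatives in the
  -- commutator vanish.
  have hconst : ∀ l : E, mvfderiv I (fun x => mvfderiv I (extChartAt I p) x (coordField I p l x)) y
      = 0 := fun l => by
    have h1 : (fun x => mvfderiv I (extChartAt I p) x (coordField I p l x)) =ᶠ[𝓝 y] fun _ => l := by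
      filter_upwards [hopen.mem_nhds hy] with x hx using mvfderiv_extChartAt_coordField hx l
    exact (mvfderiv_congr h1).trans mfderiv_const
  have h1 := mvfderiv_mlieBracket (G := E)
    ((contMDiffAt_extChartAt' (I := I) (n := 2) hy))
    ((isSectionOn_coordField p h).mdifferentiableAt hopen hy)
    ((isSectionOn_coordField p k).mdifferentiableAt hopen hy)
  rw [hconst, hconst] at h1
  rw [← coordField_mvfderiv hy (mlieBracket I (coordField I p h) (coordField I p k) y), h1]
  have hb : y ∈ (trivializationAt E (TangentSpace I) p).baseSet := by simpa using hy
  rw [coordField, ← Trivialization.symmL_apply (R := 𝕜) _ hb]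
  simp

theorem mvfderiv_comp_extChartAt {G : Type*} [NormedAddCommGroup G] [NormedSpace 𝕜 G] {f : E → G}
    {p y : M} (hy : y ∈ (chartAt H p).source) (hf : DifferentiableAt 𝕜 f (extChartAt I p y))
    (X : TangentSpace I y) :
    mvfderiv I (fun x => f (extChartAt I p x)) y X
      = fderiv 𝕜 f (extChartAt I p y) (mvfderiv I (extChartAt I p) y X) := by
  have h := HasMFDerivAt.comp y hf.hasFDerivAt.hasMFDerivAt
    (mdifferentiableAt_extChartAt (I := I) hy).hasMFDerivAt
  exact congrArg (fun L : E →L[𝕜] G => L X) h.mfderiv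

variable {F : Type*} [NormedAddCommGroup F] [NormedSpace 𝕜 F] [FiniteDimensional 𝕜 F]
  {V : M → Type*} [TopologicalSpace (TotalSpace F V)]
  [∀ x, AddCommGroup (V x)] [∀ x, Module 𝕜 (V x)]
  [∀ x, TopologicalSpace (V x)] [∀ x, IsTopologicalAddGroup (V x)]
  [∀ x, ContinuousSMul 𝕜 (V x)] [FiberBundle F V] [VectorBundle 𝕜 F V]
  [ContMDiffVectorBundle ∞ F V I] {D : CovariantDerivative I F V}
  (e : Trivialization F (TotalSpace.proj : TotalSpace F V → M)) [MemTrivializationAtlas e]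

variable (D) in
/-- The connection form in a chart of the base and a trivialization of the bundle. -/
theorem exists_connectionMatrix (p : M) : ∃ A : E → E →L[𝕜] F →L[𝕜] F,
    ∀ y ∈ (chartAt H p).source ∩ e.baseSet, ∀ h c,
      A (extChartAt I p y) h c = connectionForm D e c y (coordField I p h y) := by
  -- The form is transported point by point, consistently since the chart is injective on its
  -- source; off the image the value is 0. Continuity in `c` comes from finite dimension of the
  -- fiber.
  have hex : ∀ z : E, ∃ L : E →L[𝕜] F →L[𝕜] F, ∀ y ∈ (chartAt H p).source ∩ e.baseSet,
      extChartAt I p y = z → ∀ h c, L h c = connectionForm D e c y (coordField I p h y) := by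
    intro z
    by_cases hz : ∃ y ∈ (chartAt H p).source ∩ e.baseSet, extChartAt I p y = z
    · obtain ⟨y, hy, rfl⟩ := hz
      have hb : y ∈ (trivializationAt E (TangentSpace I) p).baseSet := by simpa using hy.1
      let L : F →ₗ[𝕜] (E →L[𝕜] F) :=
        { toFun := fun c => connectionForm D e c y ∘L
            (trivializationAt E (TangentSpace I) p).symmL 𝕜 y
          map_add' := fun c d => by rw [connectionForm_add D e hy.2, ContinuousLinearMap.add_comp]
          map_smul' := fun r c => by
            rw [connectionForm_smul D e hy.2, ContinuousLinearMap.smul_comp, RingHom.id_apply] }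
      refine ⟨(LinearMap.toContinuousLinearMap L).flip, fun y' hy' hyy' h c => ?_⟩
      obtain rfl : y' = y := (extChartAt I p).injOn (by rw [extChartAt_source]; exact hy'.1)
        (by rw [extChartAt_source]; exact hy.1) hyy'
      exact congrArg (connectionForm D e c y') (Trivialization.symmL_apply (R := 𝕜) _ hb h)
    · exact ⟨0, fun y hy hyz => (hz ⟨y, hy, hyz⟩).elim⟩
  choose A hA using hex
  exact ⟨A, fun y hy => hA _ y hy rfl⟩

/-- A flat connection has parallel local sections with arbitrary initial values. -/
theorem exists_isParallelOn (hD : IsSmoothConnection D) (hflat : IsFlat D) (p : M) (v : V p) :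
    ∃ U : Set M, IsOpen U ∧ p ∈ U ∧ ∃ s : ∀ y, V y, IsParallelOn D U s ∧ s p = v := by
  have : CompleteSpace F := FiniteDimensional.complete 𝕜 F
  let e := trivializationAt F V p
  have hpe : p ∈ e.baseSet := FiberBundle.mem_baseSet_trivializationAt' p
  let W : Set M := (chartAt H p).source ∩ e.baseSet
  have hW : IsOpen W := (chartAt H p).open_source.inter e.open_baseSet
  let Ω : Set E := (extChartAt I p).target ∩ (extChartAt I p).symm ⁻¹' e.baseSet
  have hΩ : IsOpen Ω := (continuousOn_extChartAt_symm p).isOpen_inter_preimage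
    (isOpen_extChartAt_target p) e.open_baseSet
  have hΩW : ∀ z ∈ Ω, (extChartAt I p).symm z ∈ W := fun z hz =>
    ⟨by rw [← extChartAt_source I]; exact (extChartAt I p).map_target hz.1, hz.2⟩
  have hWΩ : ∀ y ∈ W, extChartAt I p y ∈ Ω := fun y hy => by
    have hy' : y ∈ (extChartAt I p).source := by rw [extChartAt_source]; exact hy.1
    refine ⟨(extChartAt I p).map_source hy', ?_⟩
    rw [Set.mem_preimage, (extChartAt I p).left_inv hy']
    exact hy.2
  obtain ⟨A, hA⟩ := exists_connectionMatrix D e p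
  have hAform : ∀ h c, ContMDiffOn I 𝓘(𝕜, F) ∞
      (fun x => connectionForm D e c x (coordField I p h x)) W := fun h c =>
    contMDiffOn_connectionForm e hD hW Set.inter_subset_right
      ((isSectionOn_coordField p h).mono Set.inter_subset_left) c
  have hAsmooth : ContDiffOn 𝕜 ∞ A Ω := by
    refine contDiffOn_clm_apply.2 fun h => contDiffOn_clm_apply.2 fun c => ?_
    rw [← contMDiffOn_iff_contDiffOn]
    refine (ContMDiffOn.comp (hAform h c) ((contMDiffOn_extChartAt_symm p).mono
      Set.inter_subset_left) hΩW).congr fun z hz => ?_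
    have h1 := hA _ (hΩW z hz) h c
    rw [(extChartAt I p).right_inv hz.1] at h1
    exact h1
  have hAd : ∀ z ∈ Ω, DifferentiableAt 𝕜 A z := fun z hz =>
    (hAsmooth.contDiffAt (hΩ.mem_nhds hz)).differentiableAt (by simp)
  -- In the chart D = d + A, here applied twice to the section with constant coordinate c along
  -- coordinate directions.
  have hsecond : ∀ y ∈ W, ∀ h k c, e.continuousLinearMapAt 𝕜 y
      (D (fun x => D (fun x => e.symm x c) x (coordField I p k x)) y (coordField I p h y))
      = fderiv 𝕜 A (extChartAt I p y) h k c + A (extChartAt I p y) h (A (extChartAt I p y) k c) := by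
    intro y hy h k c
    have hs := hD.isSectionOn hW ((isSectionOn_coordField p k).mono Set.inter_subset_left)
      ((isSectionOn_const (I := I) e c).mono Set.inter_subset_right)
    rw [continuousLinearMapAt_covariantDerivative D e hy.2 (hs.mdifferentiableAt hW hy)]
    have hval : ∀ x ∈ W, (e (TotalSpace.mk' F x
        (D (fun x => e.symm x c) x (coordField I p k x)))).2 = A (extChartAt I p x) k c :=
      fun x hx => (e.continuousLinearMapAt_apply_of_mem (R := 𝕜) hx.2 _).symm.trans
        (hA x hx k c).symm
    have hder := ((hAd _ (hWΩ y hy)).hasFDerivAt.clm_apply (hasFDerivAt_const k _)).clm_apply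
      (hasFDerivAt_const c _)
    rw [hval y hy, ← hA y hy, mvfderiv_congr (Filter.eventuallyEq_of_mem (hW.mem_nhds hy) hval)]
    have h2 := mvfderiv_comp_extChartAt (I := I) (f := fun z => A z k c) hy.1
      hder.differentiableAt (coordField I p h y)
    rw [mvfderiv_extChartAt_coordField hy.1, hder.fderiv] at h2
    rw [h2]
    simp
  -- The curvature on two coordinate fields; they commute, so its first-order term is absent.
  have hflatA : ∀ z ∈ Ω, ∀ h k c, fderiv 𝕜 A z h k c - fderiv 𝕜 A z k h c
      + A z h (A z k c) - A z k (A z h c) = 0 := by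
    intro z hz h k c
    have hy := hΩW z hz
    have h0 := hflat W hW (coordField I p h) (coordField I p k) (fun x => e.symm x c)
      ((isSectionOn_coordField p h).mono Set.inter_subset_left)
      ((isSectionOn_coordField p k).mono Set.inter_subset_left)
      ((isSectionOn_const (I := I) e c).mono Set.inter_subset_right) _ hy
    rw [curvature, mlieBracket_coordField hy.1, map_zero, sub_zero] at h0
    have h1 := congrArg (e.continuousLinearMapAt 𝕜 ((extChartAt I p).symm z)) h0
    rw [map_sub, map_zero, hsecond _ hy, hsecond _ hy, (extChartAt I p).right_inv hz.1] at h1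
    rw [← h1]
    abel
  have hpW : p ∈ W := ⟨mem_chart_source H p, hpe⟩
  obtain ⟨U, hUΩ, hU, hpU, S, hS0, hSsmooth, hS⟩ := exists_hasFDerivAt_of_flat hΩ hAsmooth hflatA
    (hWΩ p hpW) (e (TotalSpace.mk' F p v)).2
  let U' : Set M := W ∩ extChartAt I p ⁻¹' U
  have hcont : ContinuousOn (extChartAt I p) W := fun y hy =>
    (continuousAt_extChartAt' (by rw [extChartAt_source]; exact hy.1)).continuousWithinAt
  have hU' : IsOpen U' := hcont.isOpen_inter_preimage hW hU
  have hsec : IsSectionOn I F U' (fun y => e.symm y (S (extChartAt I p y))) := by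
    refine (e.contMDiffOn_section_iff hU' (fun y hy => hy.1.2)).2 ?_
    have h1 : ContMDiffOn I 𝓘(𝕜, F) ∞ (fun y => S (extChartAt I p y)) U' :=
      hSsmooth.contMDiffOn.comp ((contMDiffOn_extChartAt (I := I) (x := p)).mono
        fun y hy => hy.1.1) fun y hy => hy.2
    exact h1.congr fun y hy => fiberCoord_symm e hy.1.2 _
  refine ⟨U', hU', ⟨hpW, hpU⟩, _, ⟨hsec, fun y hy => ?_⟩, ?_⟩
  · ext X
    have h1 := continuousLinearMapAt_covariantDerivative D e hy.1.2
      (hsec.mdifferentiableAt hU' hy) X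
    have hval : ∀ x ∈ U', (e (TotalSpace.mk' F x (e.symm x (S (extChartAt I p x))))).2
        = S (extChartAt I p x) := fun x hx => fiberCoord_symm e hx.1.2 _
    -- Every tangent vector is the value of the coordinate field of its chart components, so dS = −A
    -- S cancels the connection form in all directions.
    have h2 := hA y hy.1 (mvfderiv I (extChartAt I p) y X) (S (extChartAt I p y))
    rw [coordField_mvfderiv hy.1.1] at h2
    rw [hval y hy, mvfderiv_congr (Filter.eventuallyEq_of_mem (hU'.mem_nhds hy) hval),
      mvfderiv_comp_extChartAt hy.1.1 (hS _ hy.2).differentiableAt, (hS _ hy.2).fderiv, ← h2] at h1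
    have h3 : e.continuousLinearMapAt 𝕜 y
        (D (fun y => e.symm y (S (extChartAt I p y))) y X) = 0 := by
      rw [h1]; simp
    have h4 := e.symmL_continuousLinearMapAt (R := 𝕜) hy.1.2
      (D (fun y => e.symm y (S (extChartAt I p y))) y X)
    rw [h3, map_zero] at h4
    exact h4.symm
  · rw [hS0]
    exact e.symm_apply_apply_mk hpe v

end ParallelSections

end TotalSpaceFManifold

end

/-! ### The equivalence. -/

open TotalSpaceFManifold Bundle in
theorem proposition3p1 {𝕜 : Type*} [RCLike 𝕜]
    {E : Type*} [NormedAddCommGroup E] [NormedSpace 𝕜 E] [FiniteDimensional 𝕜 E]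
    {M : Type*} [TopologicalSpace M] [ChartedSpace E M] [IsManifold 𝓘(𝕜, E) ∞ M]
    {F : Type*} [NormedAddCommGroup F] [NormedSpace 𝕜 F] [FiniteDimensional 𝕜 F]
    {V : M → Type*} [TopologicalSpace (TotalSpace F V)]
    [∀ x, AddCommGroup (V x)] [∀ x, Module 𝕜 (V x)]
    [∀ x, TopologicalSpace (V x)] [∀ x, IsTopologicalAddGroup (V x)]
    [∀ x, ContinuousSMul 𝕜 (V x)] [FiberBundle F V] [VectorBundle 𝕜 F V]
    [ContMDiffVectorBundle ∞ F V 𝓘(𝕜, E)]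
    (D : CovariantDerivative 𝓘(𝕜, E) F V) (hD : IsSmoothConnection D)
    (mulM : ∀ x : M, TangentSpace 𝓘(𝕜, E) x →ₗ[𝕜] TangentSpace 𝓘(𝕜, E) x →ₗ[𝕜]
      TangentSpace 𝓘(𝕜, E) x)
    (eM : ∀ x : M, TangentSpace 𝓘(𝕜, E) x) (hM : IsMultiplication 𝓘(𝕜, E) E mulM eM)
    (mulV : ∀ x, V x →ₗ[𝕜] V x →ₗ[𝕜] V x) (eV : ∀ x, V x)
    (hV : IsMultiplication 𝓘(𝕜, E) F mulV eV)
    (α : ∀ x, V x →ₗ[𝕜] TangentSpace 𝓘(𝕜, E) x)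
    (hα : ContMDiff (𝓘(𝕜, E).prod 𝓘(𝕜, F)) (𝓘(𝕜, E).prod 𝓘(𝕜, E)) ∞
      (fun v : TotalSpace F V => (⟨v.proj, α v.proj v.2⟩ : TangentBundle 𝓘(𝕜, E) M)))
    (hα_mul : ∀ x (a b : V x), α x (mulV x a b) = mulM x (α x a) (α x b))
    (hα_unit : ∀ x, α x (eV x) = eM x) :
    IsFManifold (𝓘(𝕜, E).prod 𝓘(𝕜, F)) (totalMul D mulM mulV α) (verticalField 𝓘(𝕜, E) eV) ↔
      IsFManifold 𝓘(𝕜, E) mulM eM ∧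
      IsFlat D ∧
      (∀ U : Set M, IsOpen U → ∀ s : ∀ x, V x, IsParallelOn D U s →
        ∀ Y Z : ∀ x : M, TangentSpace 𝓘(𝕜, E) x,
          IsSectionOn 𝓘(𝕜, E) E U Y → IsSectionOn 𝓘(𝕜, E) E U Z →
          ∀ x ∈ U, lieDerivMul 𝓘(𝕜, E) mulM (fun y => α y (s y)) Y Z x = 0) ∧
      (∀ U : Set M, IsOpen U → ∀ s₁ s₂ : ∀ x, V x, IsParallelOn D U s₁ → IsParallelOn D U s₂ →
        IsParallelOn D U (fun x => mulV x (s₁ x) (s₂ x)) ∧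
        ∀ x ∈ U, VectorField.mlieBracket 𝓘(𝕜, E) (fun y => α y (s₁ y)) (fun y => α y (s₂ y)) x
          = 0) := by
  refine ⟨fun h => ?_, fun ⟨hF, hflat, hL, hpar⟩ => ?_⟩
  · have hflat := isFlat_of_total h hD hM hV hα
    exact ⟨isFManifold_of_total h hD hM hV hα hflat, hflat,
      fun U hU s hs Y Z hY hZ x hx =>
        lieDerivMul_parallel_of_total h hD hM hV hα hflat hU hs hY hZ hx,
      fun U hU a b ha hb => parallel_of_total h hD hM hV hα hflat hU ha hb⟩
  · exact isFManifold_total hD hF hV hα hα_mul hα_unit hflat hL hpar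
      (exists_isParallelOn hD hflat)
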